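/- **Theorem (general local Birch lemma).** Let $F$ be a nonarchimedean local field with ring of integers $\mathcal O_F$, maximal ideal $\mathfrak p$, uniformizer $\varpi$, and absolute value normalized by $|\varpi|=N(\mathfrak p)^{-1}$, where $N(\mathfrak a)=\#(\mathcal O_F/\mathfrak a)$. Let $\psi:F\to\mathbb C^\times$ be a continuous additive character with conductor $\mathcal O_F$, extended to the group $U_k(F)$ of upper triangular unipotent matrices in $\mathrm{GL}_k(F)$ by $\psi(u)=\prod_{i=1}^{k-1}\psi(u_{i,i+1})$, and let $I_k\subseteq \mathrm{GL}_k(\mathcal O_F)$ be the Iwahori subgroup of matrices that are upper triangular modulo $\mathfrak p$. Let $m\ge n\ge 0$ be integers, and let $w:\mathrm{GL}_m(F)\to\mathbb C$ and $v:\mathrm{GL}_n(F)\to\mathbb C$ satisfy $$w(ugk)=\psi(u)\,w(g)\quad(u\in U_m(F),\ k\in I_m),\qquad v(ugk)=\psi(u)^{-1}v(g)\quad(u\in U_n(F),\ k\in I_n).$$ Let $\chi:F^\times\to\mathbb C^\times$ be a quasi-character (continuous homomorphism) with nontrivial conductor $\mathfrak f=f\mathcal O_F\subsetneq\mathcal O_F$,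 $f\ne 0$; no condition is imposed on the conductors of the powers of $\chi$. Put $$G(\chi)=\sum_{x\in(\mathcal O_F/\mathfrak f)^\times}\chi(x)\,\psi(x/f),\qquad D_n=\mathrm{diag}(f^{-(n-1)},f^{-(n-3)},\dots,f^{n-3},f^{n-1}),\qquad \lambda_n(g)=\sum_{k=1}^{n} g_{nk}\,f^{-(n+1-k)},$$ with $\lambda_0=0$. Let $w_n$ be the $n\times n$ permutation matrix with ones on the antidiagonal, and let $j:\mathrm{GL}_n\to\mathrm{GL}_m$ be $g\mapsto\begin{pmatrix}g&0\\0&\mathbf 1_{m-n}\end{pmatrix}$. Let $dg$ also denote the quotient measure on $U_n(F)\backslash\mathrm{GL}_n(F)$ of the Haar measures giving $\mathrm{GL}_n(\mathcal O_F)$ and $U_n(\mathcal O_F)$ volume $1$. Then for every $s\in\mathbb C$ $$\int_{U_n(F)\backslash \mathrm{GL}_n(F)}\psi(\lambda_n(g))\,w\big(j(gD_nw_n)\big)\,v(g)\,\chi(\det g)\,|\det g|^{s-\frac{m-n}{2}}\,dg =\prod_{\nu=1}^{n}\big(1-N(\mathfrak p)^{-\nu}\big)^{-1}\cdot N(\mathfrak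 f)^{-\sum_{k=1}^{n}k(n+1-k)}\cdot G(\chi)^{\frac{n(n+1)}2}\cdot w(\mathbf 1_m)\cdot v(\mathbf 1_n).$$ Here the integral is taken along the decomposition $\mathrm{GL}_n(F)=\bigsqcup_{e\in\mathbb Z^n,\ \omega}U_n(F)\varpi^e\omega I_n$, where $\varpi^e=\mathrm{diag}(\varpi^{e_1},\dots,\varpi^{e_n})$ and $\omega$ runs over the permutation matrices: the integrand is absolutely integrable over each $U_n(F)\backslash U_n(F)\varpi^e\omega I_n$, and the integrals over these pieces sum unconditionally to the right-hand side. Moreover, whenever the integrand is absolutely integrable over $U_n(F)\backslash\mathrm{GL}_n(F)$, its integral in the ordinary sense equals the right-hand side. -/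

import Mathlib

noncomputable section

namespace LocalBirch

open MeasureTheory ValuativeRel
open scoped ENNReal NNReal Pointwise Matrix

/-! ### The quotient measure on `H \ G` -/

/-- `ρ` is the quotient measure `dg/dh` on the space `H \ G` of cosets `H g`: for every nonnegative
measurable `φ` on `G`, `∫_G φ(g) dg = ∫_{H \ G} (∫_H φ(h g) dh) dρ(H g)`.
The hypothesis on `Φ` says that `Φ` is the function on `H \ G` defined by the inner integral. -/
def IsQuotientMeasure {G : Type*} [Group G] [MeasurableSpace G] (H : Subgroup G)
    (μ : Measure G) (ν : Measure H) (ρ : Measure (Quotient (QuotientGroup.rightRel H))) : Prop :=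
  ∀ (φ : G → ℝ≥0∞) (Φ : Quotient (QuotientGroup.rightRel H) → ℝ≥0∞), Measurable φ →
    (∀ g : G, Φ (Quotient.mk _ g) = ∫⁻ h : H, φ ((h : G) * g) ∂ν) →
      ∫⁻ g, φ g ∂μ = ∫⁻ x, Φ x ∂ρ

theorem exists_isQuotientMeasure {G : Type*} [Group G] [TopologicalSpace G] [IsTopologicalGroup G]
    [T2Space G] [LocallyCompactSpace G] [SecondCountableTopology G] [MeasurableSpace G]
    [BorelSpace G] (H : Subgroup G) (hH : IsClosed (H : Set G)) (μ : Measure G)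
    [μ.IsHaarMeasure] (ν : Measure H) [ν.IsHaarMeasure] :
    ∃ ρ, IsQuotientMeasure H μ ν ρ := by
  have : LocallyCompactSpace H := hH.isClosedEmbedding_subtypeVal.locallyCompactSpace
  have : SigmaCompactSpace H := hH.isClosedEmbedding_subtypeVal.sigmaCompactSpace
  have : SigmaFinite ν := inferInstance
  let K : CompactExhaustion G := default
  have hKm : ∀ i, MeasurableSet (K i) := fun i => (K.isCompact i).measurableSet
  let C : ℕ → Set H := fun i => Subtype.val ⁻¹' (K i * (K i)⁻¹)
  have hC : ∀ i, ν (C i) ≠ ∞ := fun i =>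
    (hH.isClosedEmbedding_subtypeVal.isCompact_preimage
      ((K.isCompact i).mul (K.isCompact i).inv)).measure_lt_top.ne
  obtain ⟨δ, hδ, hsum⟩ := ENNReal.exists_pos_tsum_mul_lt_of_countable one_ne_zero _ hC
  let φ₀ : G → ℝ≥0∞ := fun g => ∑' i, (δ i : ℝ≥0∞) * (K i).indicator 1 g
  have hφ₀ : Measurable φ₀ := Measurable.tsum fun i =>
    (measurable_one.indicator (hKm i)).const_mul _
  have hact : Measurable fun p : G × H => ((p.2 : G)⁻¹ * p.1) :=
    ((measurable_subtype_coe.comp measurable_snd).inv.mul measurable_fst)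
  have hact' : Measurable fun p : G × H => ((p.2 : G) * p.1) :=
    ((measurable_subtype_coe.comp measurable_snd).mul measurable_fst)
  let I : G → ℝ≥0∞ := fun g => ∫⁻ h : H, φ₀ ((h : G)⁻¹ * g) ∂ν
  have hI : Measurable I := (hφ₀.comp hact).lintegral_prod_right'
  have hact2 : ∀ g : G, Measurable fun h : H => (h : G)⁻¹ * g := fun g =>
    (measurable_subtype_coe.inv.mul measurable_const)
  have hI_eq : ∀ g, I g = ∑' i, (δ i : ℝ≥0∞) * ν {h : H | (h : G)⁻¹ * g ∈ K i} := by
    intro g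
    simp only [I, φ₀]
    rw [lintegral_tsum]
    · refine tsum_congr fun i => ?_
      have hm : Measurable fun h : H => (K i).indicator (1 : G → ℝ≥0∞) ((h : G)⁻¹ * g) :=
        (measurable_one.indicator (hKm i)).comp (hact2 g)
      rw [lintegral_const_mul _ hm]
      congr 1
      have : (fun h : H => (K i).indicator (1 : G → ℝ≥0∞) ((h : G)⁻¹ * g)) =
          {h : H | (h : G)⁻¹ * g ∈ K i}.indicator 1 := by
        ext h; simp [Set.indicator]
      rw [this, lintegral_indicator_one]
      exact hact2 g (hKm i)
    · exact fun i => ((measurable_one.indicator (hKm i)).comp (hact2 g)).const_mul _ |>.aemeasurable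
  have hI_top : ∀ g, I g ≠ ∞ := by
    intro g
    rw [hI_eq]
    refine (lt_of_le_of_lt (ENNReal.tsum_le_tsum fun i => ?_) (hsum.trans ENNReal.one_lt_top)).ne
    rw [mul_comm]
    refine mul_le_mul_left ?_ _
    by_cases hne : {h : H | (h : G)⁻¹ * g ∈ K i}.Nonempty
    · obtain ⟨h₀, hh₀⟩ := hne
      have hsub : {h : H | (h : G)⁻¹ * g ∈ K i} ⊆ (fun h => h₀⁻¹ * h) ⁻¹' C i := by
        intro h hh
        refine ⟨_, hh₀, _, Set.inv_mem_inv.2 hh, ?_⟩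
        simp
      exact (measure_mono (μ := ν) hsub).trans_eq (measure_preimage_mul ν _ _)
    · rw [Set.not_nonempty_iff_eq_empty.1 hne]; simp
  have hI_pos : ∀ g, I g ≠ 0 := by
    intro g
    obtain ⟨i, hi⟩ := K.exists_mem g
    have hi' : g ∈ interior (K (i + 1)) := K.subset_interior_succ i hi
    rw [hI_eq, Ne, ENNReal.tsum_eq_zero, not_forall]
    refine ⟨i + 1, mul_ne_zero (by exact_mod_cast (hδ (i+1)).ne') ?_⟩
    have ho : IsOpen {h : H | (h : G)⁻¹ * g ∈ interior (K (i + 1))} :=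
      isOpen_interior.preimage (by fun_prop)
    have := ho.measure_pos ν ⟨1, by simpa using hi'⟩
    have hsub : {h : H | (h : G)⁻¹ * g ∈ interior (K (i + 1))} ⊆
        {h : H | (h : G)⁻¹ * g ∈ K (i + 1)} := fun h hh => Set.mem_ofPred.2 (interior_subset hh)
    exact (this.trans_le (measure_mono hsub)).ne'
  have hI_inv : ∀ (h : H) g, I ((h : G)⁻¹ * g) = I g := by
    intro h g
    simp only [I]
    rw [← lintegral_mul_left_eq_self (μ := ν) (fun h' : H => φ₀ ((h' : G)⁻¹ * g)) h]
    simp [mul_assoc]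
  let β : G → ℝ≥0∞ := fun g => φ₀ g / I g
  have hβ : Measurable β := hφ₀.div hI
  have hβ1 : ∀ g, ∫⁻ h : H, β ((h : G)⁻¹ * g) ∂ν = 1 := by
    intro g
    simp only [β, hI_inv, div_eq_mul_inv]
    have hm : Measurable fun h : H => φ₀ ((h : G)⁻¹ * g) := hφ₀.comp (hact2 g)
    rw [lintegral_mul_const _ hm]
    exact ENNReal.mul_inv_cancel (hI_pos g) (hI_top g)
  refine ⟨(μ.withDensity β).map (Quotient.mk _), fun φ Φ hφ hΦ => ?_⟩
  have hF : Measurable fun g : G => ∫⁻ h : H, φ ((h : G) * g) ∂ν :=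
    (hφ.comp hact').lintegral_prod_right'
  have hΦm : Measurable Φ := by
    refine measurable_from_quotient.2 ?_
    have : (Φ ∘ Quotient.mk'') = fun g : G => ∫⁻ h : H, φ ((h : G) * g) ∂ν := funext hΦ
    rw [this]; exact hF
  symm
  calc ∫⁻ x, Φ x ∂((μ.withDensity β).map (Quotient.mk _))
      = ∫⁻ g, Φ (Quotient.mk _ g) ∂(μ.withDensity β) :=
        lintegral_map hΦm measurable_quotient_mk''
    _ = ∫⁻ g, ∫⁻ h : H, β g * φ ((h : G) * g) ∂ν ∂μ := by
        simp_rw [hΦ]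
        rw [lintegral_withDensity_eq_lintegral_mul _ hβ hF]
        refine lintegral_congr fun g => ?_
        have hm : Measurable fun h : H => φ ((h : G) * g) :=
          hφ.comp (measurable_subtype_coe.mul measurable_const)
        rw [lintegral_const_mul _ hm]
        rfl
    _ = ∫⁻ h : H, ∫⁻ g, β g * φ ((h : G) * g) ∂μ ∂ν :=
        lintegral_lintegral_swap
          ((hβ.comp measurable_fst).mul (hφ.comp hact')).aemeasurable
    _ = ∫⁻ h : H, ∫⁻ g, β ((h : G)⁻¹ * g) * φ g ∂μ ∂ν := by
        refine lintegral_congr fun h => ?_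
        rw [← lintegral_mul_left_eq_self (μ := μ) (fun g => β ((h : G)⁻¹ * g) * φ g) (h : G)]
        simp
    _ = ∫⁻ g, ∫⁻ h : H, β ((h : G)⁻¹ * g) * φ g ∂ν ∂μ := by
        symm
        exact lintegral_lintegral_swap
          ((hβ.comp hact).mul (hφ.comp measurable_fst)).aemeasurable
    _ = ∫⁻ g, φ g ∂μ := by
        refine lintegral_congr fun g => ?_
        have hm : Measurable fun h : H => β ((h : G)⁻¹ * g) := hβ.comp (hact2 g)
        rw [lintegral_mul_const _ hm, hβ1, one_mul]

section Field

variable (F : Type*) [Field F]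

/-- The group `U_n(F)` of upper triangular matrices with ones on the diagonal. -/
def unipotent (n : ℕ) : Subgroup (GL (Fin n) F) where
  carrier := {g | (∀ i j, j < i → g i j = 0) ∧ ∀ i, g i i = 1}
  one_mem' := by
    refine ⟨fun i j hij => ?_, fun i => ?_⟩
    · simp [hij.ne']
    · simp
  mul_mem' := by
    rintro a b ⟨ha, ha'⟩ ⟨hb, hb'⟩
    refine ⟨fun i j hij => ?_, fun i => ?_⟩
    · rw [Units.val_mul, Matrix.mul_apply]
      refine Finset.sum_eq_zero fun k _ => ?_
      rcases lt_or_ge k i with h | h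
      · rw [ha i k h, zero_mul]
      · rw [hb k j (hij.trans_le h), mul_zero]
    · rw [Units.val_mul, Matrix.mul_apply, Finset.sum_eq_single i, ha', hb', one_mul]
      · intro k _ hk
        rcases lt_or_gt_of_ne hk with h | h
        · rw [ha i k h, zero_mul]
        · rw [hb k i h, mul_zero]
      · simp
  inv_mem' := by
    rintro a ⟨ha, ha'⟩
    have hinv : ∀ i j, j < i → (a⁻¹ : GL (Fin n) F) i j = 0 := by
      let : Invertible (a : Matrix (Fin n) (Fin n) F) := a.invertible
      have hT : (a : Matrix (Fin n) (Fin n) F).BlockTriangular id := fun i j hij => ha i j hij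
      intro i j hij
      have := Matrix.blockTriangular_inv_of_blockTriangular hT
      rw [Matrix.coe_units_inv]
      exact this hij
    refine ⟨hinv, fun i => ?_⟩
    have h1 : ((a * a⁻¹ : GL (Fin n) F) : Matrix (Fin n) (Fin n) F) i i = 1 := by simp
    rw [Units.val_mul, Matrix.mul_apply, Finset.sum_eq_single i, ha', one_mul] at h1
    · exact h1
    · intro k _ hk
      rcases lt_or_gt_of_ne hk with h | h
      · rw [ha i k h, zero_mul]
      · rw [hinv k i h, mul_zero]
    · simp

variable {F}

/-- The extension `u ↦ ψ(u_{12} + u_{23} + ⋯) = ∏_{i=1}^{n-1} ψ(u_{i,i+1})` of an additive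
character `ψ` to upper triangular unipotent matrices. -/
def psiU (ψ : AddChar F ℂ) {n : ℕ} (u : Matrix (Fin n) (Fin n) F) : ℂ :=
  ∏ i ∈ Finset.range (n - 1),
    if h : i + 1 < n then ψ (u ⟨i, by omega⟩ ⟨i + 1, h⟩) else 1

/-- `w` is a `ψ`-Whittaker function on `GL_n(F)`: `w(u g) = ψ(u) w(g)` for `u ∈ U_n(F)`. (Smoothness
under right translation is implied by the Iwahori invariance imposed separately.) -/
def IsWhittaker (ψ : AddChar F ℂ) {n : ℕ} (w : GL (Fin n) F → ℂ) : Prop :=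
  ∀ u ∈ unipotent F n, ∀ g, w (u * g) = psiU ψ (u : Matrix (Fin n) (Fin n) F) * w g

/-- The diagonal matrix with diagonal entries `d`. -/
def diagGL {n : ℕ} (d : Fin n → Fˣ) : GL (Fin n) F where
  val := Matrix.diagonal fun i => (d i : F)
  inv := Matrix.diagonal fun i => ((d i)⁻¹ : Fˣ)
  val_inv := by simp [Matrix.diagonal_mul_diagonal]
  inv_val := by simp [Matrix.diagonal_mul_diagonal]

variable (F) in
/-- The permutation matrix of `σ`. -/
def permGL {n : ℕ} (σ : Equiv.Perm (Fin n)) : GL (Fin n) F where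
  val := σ.permMatrix F
  inv := σ⁻¹.permMatrix F
  val_inv := by rw [← Matrix.permMatrix_mul]; simp
  inv_val := by rw [← Matrix.permMatrix_mul]; simp

variable (F) in
/-- The longest Weyl element `w_n`: ones on the antidiagonal, zeros elsewhere. -/
def longestWeyl (n : ℕ) : GL (Fin n) F := permGL F Fin.revPerm

/-- `D_n = diag(f^{-(n-1)}, f^{-(n-3)}, …, f^{n-3}, f^{n-1})`. -/
def matD (n : ℕ) (f : Fˣ) : GL (Fin n) F :=
  diagGL fun i => f ^ (2 * (i : ℤ) + 1 - n)

/-- The linear form `λ_n(g) = b_nᵗ g φ_n`, where `b_n` is the last standard basis vector and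
`φ_n = (f^{-n}, f^{-(n-1)}, …, f^{-1})ᵗ`. -/
def lam (n : ℕ) (f : Fˣ) (g : Matrix (Fin n) (Fin n) F) : F :=
  (fun i : Fin n => if (i : ℕ) + 1 = n then (1 : F) else 0) ⬝ᵥ
    (g *ᵥ fun k : Fin n => ((f ^ ((k : ℤ) - n) : Fˣ) : F))

/-- The enumeration of `Fin m` as `Fin n` followed by `Fin (m - n)`. -/
def splitFin {n m : ℕ} (h : n ≤ m) : Fin n ⊕ Fin (m - n) ≃ Fin m :=
  finSumFinEquiv.trans (finCongr (Nat.add_sub_of_le h))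

/-- The inclusion `j : GL_n → GL_m`, sending `g` to the block diagonal matrix
with blocks `g` and the identity. -/
def embGL {n m : ℕ} (h : n ≤ m) : GL (Fin n) F →* GL (Fin m) F where
  toFun g :=
    { val := Matrix.reindex (splitFin h) (splitFin h)
        (Matrix.fromBlocks (g : Matrix (Fin n) (Fin n) F) 0 0 1)
      inv := Matrix.reindex (splitFin h) (splitFin h)
        (Matrix.fromBlocks ((g⁻¹ : GL (Fin n) F) : Matrix (Fin n) (Fin n) F) 0 0 1)
      val_inv := by
        simp [Matrix.submatrix_mul_equiv, Matrix.fromBlocks_multiply]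
      inv_val := by
        simp [Matrix.submatrix_mul_equiv, Matrix.fromBlocks_multiply] }
  map_one' := by ext; simp [Matrix.one_apply]
  map_mul' a b := by
    apply Units.ext
    simp [Matrix.submatrix_mul_equiv, Matrix.fromBlocks_multiply]

theorem embGL_apply {n m : ℕ} (h : n ≤ m) (g : GL (Fin n) F) (a b : Fin m) :
    embGL h g a b =
      if hab : (a : ℕ) < n ∧ (b : ℕ) < n then g ⟨a, hab.1⟩ ⟨b, hab.2⟩
      else if a = b then 1 else 0 := by
  obtain ⟨a, rfl⟩ := (splitFin h).surjective a
  obtain ⟨b, rfl⟩ := (splitFin h).surjective b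
  rcases a with a | a <;> rcases b with b | b <;>
    simp [embGL, splitFin, Matrix.one_apply, Fin.ext_iff] <;> omega

theorem embGL_mem_unipotent {n m : ℕ} (h : n ≤ m) {u : GL (Fin n) F} (hu : u ∈ unipotent F n) :
    embGL h u ∈ unipotent F m := by
  refine ⟨fun i j hij => ?_, fun i => ?_⟩
  · rw [embGL_apply]
    split_ifs with h1 h2
    · exact hu.1 _ _ hij
    · exact absurd h2 hij.ne'
    · rfl
  · rw [embGL_apply]
    split_ifs with h1
    · exact hu.2 _
    · rfl
    · contradiction

theorem psiU_embGL {n m : ℕ} (h : n ≤ m) (ψ : AddChar F ℂ) (u : GL (Fin n) F) :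
    psiU ψ (embGL h u : Matrix (Fin m) (Fin m) F) = psiU ψ (u : Matrix (Fin n) (Fin n) F) := by
  unfold psiU
  symm
  refine (Finset.prod_congr rfl fun i hi => ?_).trans
    (Finset.prod_subset (Finset.range_mono (Nat.sub_le_sub_right h 1)) fun i hi hi' => ?_)
  · have h1 : i + 1 < n := by have := Finset.mem_range.1 hi; omega
    rw [dif_pos h1, dif_pos (h1.trans_le h), embGL_apply, dif_pos ⟨by simp; omega, by simpa using h1⟩]
  · have h1 : i + 1 < m := by have := Finset.mem_range.1 hi; omega
    have h2 : ¬ (i + 1 < n) := fun h2 => hi' (Finset.mem_range.2 (by omega))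
    rw [dif_pos h1, embGL_apply, dif_neg (fun hab => h2 hab.2), if_neg (by simp)]
    exact AddChar.map_zero_eq_one ψ

theorem psiU_mul_psiU_inv (ψ : AddChar F ℂ) {n : ℕ} (u : Matrix (Fin n) (Fin n) F) :
    psiU ψ u * psiU ψ⁻¹ u = 1 := by
  unfold psiU
  rw [← Finset.prod_mul_distrib]
  refine Finset.prod_eq_one fun i _ => ?_
  split_ifs with h
  · rw [AddChar.inv_apply, ← AddChar.map_add_eq_mul, add_neg_cancel, AddChar.map_zero_eq_one]
  · simp

theorem det_of_mem_unipotent {n : ℕ} {u : GL (Fin n) F} (hu : u ∈ unipotent F n) :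
    Matrix.GeneralLinearGroup.det u = 1 := by
  apply Units.ext
  have hT : (u : Matrix (Fin n) (Fin n) F).BlockTriangular id := fun i j hij => hu.1 i j hij
  simp [Matrix.det_of_isUpperTriangular hT, hu.2]

theorem lam_unipotent_mul {n : ℕ} (f : Fˣ) {u : GL (Fin n) F} (hu : u ∈ unipotent F n)
    (g : GL (Fin n) F) :
    lam n f ((u * g : GL (Fin n) F) : Matrix (Fin n) (Fin n) F) =
      lam n f (g : Matrix (Fin n) (Fin n) F) := by
  unfold lam
  rw [Units.val_mul, ← Matrix.mulVec_mulVec,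
    Matrix.dotProduct_mulVec _ (u : Matrix (Fin n) (Fin n) F)]
  congr 1
  ext j
  simp only [Matrix.vecMul, dotProduct]
  have key : ∀ i : Fin n, (if (i : ℕ) + 1 = n then (1 : F) else 0) * u i j =
      if i = j ∧ (i : ℕ) + 1 = n then 1 else 0 := by
    intro i
    by_cases hi : (i : ℕ) + 1 = n
    · by_cases hij : i = j
      · subst hij; simp [hi, hu.2]
      · have : j < i := by
          have := j.2; have : (i : ℕ) ≠ j := fun h => hij (Fin.ext h)
          exact Fin.lt_def.2 (by omega)
        simp [hi, hij, hu.1 i j this]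
    · simp [hi]
  simp only [key]
  by_cases hj : (j : ℕ) + 1 = n
  · rw [Finset.sum_eq_single j] <;> simp +contextual [hj]
  · rw [if_neg hj]
    refine Finset.sum_eq_zero fun i _ => if_neg ?_
    rintro ⟨rfl, h⟩; exact hj h

end Field

section LocalField

variable (F : Type*) [Field F] [ValuativeRel F] [TopologicalSpace F] [IsNonarchimedeanLocalField F]

theorem t2Space_localField : T2Space F := by
  let := IsTopologicalAddGroup.rightUniformSpace F
  have := isUniformAddGroup_of_addCommGroup (G := F)
  infer_instance

theorem secondCountable_localField : SecondCountableTopology F := by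
  let := IsTopologicalAddGroup.rightUniformSpace F
  have := isUniformAddGroup_of_addCommGroup (G := F)
  let : (Valued.v (R := F)).RankOne :=
  { hom' := IsRankLeOne.nonempty.some.emb (R := F).comp MonoidWithZeroHom.ValueGroup₀.embedding
    strictMono' := IsRankLeOne.nonempty.some.strictMono.comp
        MonoidWithZeroHom.ValueGroup₀.embedding_strictMono }
  open scoped Valued in
  have : ProperSpace F := .of_nontriviallyNormedField_of_weaklyLocallyCompactSpace F
  exact secondCountable_of_proper

theorem t2Space_GL (n : ℕ) : T2Space (GL (Fin n) F) := by
  have := t2Space_localField F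
  have : T2Space (Matrix (Fin n) (Fin n) F) := inferInstance
  infer_instance

theorem locallyCompactSpace_GL (n : ℕ) : LocallyCompactSpace (GL (Fin n) F) := by
  have := t2Space_localField F
  have : LocallyCompactSpace (Matrix (Fin n) (Fin n) F) :=
    inferInstanceAs (LocallyCompactSpace (Fin n → Fin n → F))
  infer_instance

theorem secondCountable_GL (n : ℕ) : SecondCountableTopology (GL (Fin n) F) := by
  have := secondCountable_localField F
  have : SecondCountableTopology (Matrix (Fin n) (Fin n) F) :=
    inferInstanceAs (SecondCountableTopology (Fin n → Fin n → F))
  have : SecondCountableTopology (Matrix (Fin n) (Fin n) F)ᵐᵒᵖ :=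
    MulOpposite.opHomeomorph.symm.isEmbedding.secondCountableTopology
  exact Units.isEmbedding_embedProduct.secondCountableTopology

theorem isClosed_unipotent (n : ℕ) : IsClosed (unipotent F n : Set (GL (Fin n) F)) := by
  have := t2Space_localField F
  have hc : ∀ i j, Continuous fun g : GL (Fin n) F => g i j := fun i j =>
    Units.continuous_val.matrix_elem i j
  have : (unipotent F n : Set (GL (Fin n) F)) =
      (⋂ i, ⋂ j, ⋂ (_ : j < i), {g : GL (Fin n) F | g i j = 0}) ∩
        ⋂ i, {g : GL (Fin n) F | g i i = 1} := by
    ext g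
    simp [unipotent]
  rw [this]
  refine IsClosed.inter (isClosed_iInter fun i => isClosed_iInter fun j => isClosed_iInter fun _ =>
    isClosed_eq (hc i j) continuous_const) (isClosed_iInter fun i =>
    isClosed_eq (hc i i) continuous_const)

theorem exists_quotientMeasure (n : ℕ) [MeasurableSpace (GL (Fin n) F)] [BorelSpace (GL (Fin n) F)]
    (μ : Measure (GL (Fin n) F)) [μ.IsHaarMeasure]
    (ν : Measure (unipotent F n)) [ν.IsHaarMeasure] :
    ∃ ρ, IsQuotientMeasure (unipotent F n) μ ν ρ := by
  have := t2Space_GL F n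
  have := locallyCompactSpace_GL F n
  have := secondCountable_GL F n
  exact exists_isQuotientMeasure _ (isClosed_unipotent F n) μ ν

variable {F}

/-- The quotient measure `dg/du` on `U_n(F) \ GL_n(F)` attached to Haar measures `dg = μ` on
`GL_n(F)` and `du = ν` on `U_n(F)`; it is the only measure with `IsQuotientMeasure`, as both groups
are unimodular. -/
def quotientMeasure {n : ℕ} [MeasurableSpace (GL (Fin n) F)] [BorelSpace (GL (Fin n) F)]
    (μ : Measure (GL (Fin n) F)) [μ.IsHaarMeasure]
    (ν : Measure (unipotent F n)) [ν.IsHaarMeasure] :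
    Measure (Quotient (QuotientGroup.rightRel (unipotent F n))) :=
  Classical.choose (exists_quotientMeasure F n μ ν)

theorem quotientMeasure_spec {n : ℕ} [MeasurableSpace (GL (Fin n) F)] [BorelSpace (GL (Fin n) F)]
    (μ : Measure (GL (Fin n) F)) [μ.IsHaarMeasure]
    (ν : Measure (unipotent F n)) [ν.IsHaarMeasure] :
    IsQuotientMeasure (unipotent F n) μ ν (quotientMeasure μ ν) :=
  Classical.choose_spec (exists_quotientMeasure F n μ ν)

variable (F) in
/-- The maximal compact subgroup `GL_n(𝒪_F)` of `GL_n(F)`. -/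
def intGL (n : ℕ) : Subgroup (GL (Fin n) F) :=
  (Matrix.GeneralLinearGroup.map (𝒪[F]).subtype).range

variable (F) in
/-- The Iwahori subgroup `I_n`: the elements of `GL_n(𝒪_F)` that are upper triangular modulo the
maximal ideal. -/
def iwahori (n : ℕ) : Set (GL (Fin n) F) :=
  {k | ∃ k₀ : GL (Fin n) 𝒪[F], Matrix.GeneralLinearGroup.map (𝒪[F]).subtype k₀ = k ∧
    ∀ i j, j < i → k₀ i j ∈ 𝓂[F]}

/-- A function on `GL_n(F)` is Iwahori invariant if it is invariant under right translation
by `I_n`. -/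
def IsIwahoriInvariant {n : ℕ} (w : GL (Fin n) F → ℂ) : Prop :=
  ∀ g, ∀ k ∈ iwahori F n, w (g * k) = w g

variable (F) in
/-- `N(𝔭)`, the cardinality of the residue field. -/
def normP : ℕ := Nat.card 𝓀[F]

theorem normP_ne_zero : (normP F : ℝ≥0) ≠ 0 := by
  have : Finite 𝓀[F] := inferInstance
  exact_mod_cast (Nat.card_pos (α := 𝓀[F])).ne'

/-- The normalized absolute value of `F`: the multiplicative absolute value with
`|ϖ| = N(𝔭)⁻¹` for every uniformizer `ϖ`. -/
def normAbs (x : F) : ℝ :=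
  WithZeroMulInt.toNNReal (normP_ne_zero (F := F))
    (IsNonarchimedeanLocalField.valueGroupWithZeroIsoInt F (valuation F x))

/-- The additive character `ψ` has conductor `𝒪_F`. -/
def HasConductorIntegers (ψ : AddChar F ℂ) : Prop :=
  ∀ x : F, (∀ y : 𝒪[F], ψ (x * y) = 1) ↔ x ∈ 𝒪[F]

/-- The quasi-character `χ` has conductor the ideal `𝔣`: the largest ideal such that `χ` is trivial
on the units `u` of `𝒪_F` with `u ≡ 1` modulo it. -/
def HasConductor (χ : Fˣ →* ℂˣ) (𝔣 : Ideal 𝒪[F]) : Prop :=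
  IsGreatest {𝔞 : Ideal 𝒪[F] |
    ∀ u : (𝒪[F])ˣ, (u : 𝒪[F]) - 1 ∈ 𝔞 → χ (Units.map (𝒪[F]).subtype u) = 1} 𝔣

open Classical in
/-- A quasi-character of `Fˣ`, as a function on `F` that is zero at `0`. -/
def evalChar (χ : Fˣ →* ℂˣ) (x : F) : ℂ :=
  if h : x = 0 then 0 else χ (Units.mk0 x h)

/-- The Gauss sum `G(χ) = ∑ χ(x) ψ(x / f)`, over representatives `x ∈ 𝒪_F` of `(𝒪_F / f 𝒪_F)ˣ`.
If `f 𝒪_F` is the conductor of `χ` and is a proper ideal, and `ψ` has conductor `𝒪_F`, the summands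
do not depend on the representatives, which are units of `𝒪_F`. -/
def localGaussSum (ψ : AddChar F ℂ) (χ : Fˣ →* ℂˣ) (f : 𝒪[F]) : ℂ :=
  ∑ᶠ a : (𝒪[F] ⧸ Ideal.span {f})ˣ,
    let x : F :=
      (Function.surjInv Ideal.Quotient.mk_surjective (a : 𝒪[F] ⧸ Ideal.span {f}) : 𝒪[F])
    evalChar χ x * ψ (x / f)

/-- The absolute norm of the ideal `f 𝒪_F`. -/
def normIdeal (f : 𝒪[F]) : ℕ := Nat.card (𝒪[F] ⧸ Ideal.span {f})

/-- A nonzero integer of `F`, as an element of `Fˣ`. -/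
def toUnit (f : 𝒪[F]) (hf : f ≠ 0) : Fˣ := Units.mk0 (f : F) (by simpa using hf)

/-- The integrand
`ψ(λ_n(g)) w(j(g D_n w_n)) v(g) χ(det g) |det g|^{s - (m - n)/2}` on `GL_n(F)`. -/
def zetaIntegrand {n m : ℕ} (h : n ≤ m) (ψ : AddChar F ℂ) (w : GL (Fin m) F → ℂ)
    (v : GL (Fin n) F → ℂ) (χ : Fˣ →* ℂˣ) (f : Fˣ) (s : ℂ) (g : GL (Fin n) F) : ℂ :=
  ψ (lam n f (g : Matrix (Fin n) (Fin n) F)) *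
    w (embGL h (g * matD n f * longestWeyl F n)) * v g *
    (χ (Matrix.GeneralLinearGroup.det g) : ℂ) *
    (normAbs (Matrix.GeneralLinearGroup.det g : F) : ℂ) ^ (s - ((m : ℂ) - n) / 2)

theorem zetaIntegrand_unipotent_mul {n m : ℕ} (h : n ≤ m) {ψ : AddChar F ℂ}
    {w : GL (Fin m) F → ℂ} (hw : IsWhittaker ψ w) {v : GL (Fin n) F → ℂ}
    (hv : IsWhittaker ψ⁻¹ v) (χ : Fˣ →* ℂˣ) (f : Fˣ) (s : ℂ) {u : GL (Fin n) F}
    (hu : u ∈ unipotent F n) (g : GL (Fin n) F) :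
    zetaIntegrand h ψ w v χ f s (u * g) = zetaIntegrand h ψ w v χ f s g := by
  unfold zetaIntegrand
  rw [lam_unipotent_mul f hu, mul_assoc u g, mul_assoc u, map_mul (embGL h) u,
    hw _ (embGL_mem_unipotent h hu), hv _ hu, psiU_embGL,
    map_mul Matrix.GeneralLinearGroup.det u g, det_of_mem_unipotent hu, one_mul]
  linear_combination (ψ (lam n f (g : Matrix (Fin n) (Fin n) F)) *
    w (embGL h (g * matD n f * longestWeyl F n)) * v g *
    (χ (Matrix.GeneralLinearGroup.det g) : ℂ) *
    (normAbs (Matrix.GeneralLinearGroup.det g : F) : ℂ) ^ (s - ((m : ℂ) - n) / 2)) *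
    psiU_mul_psiU_inv ψ (u : Matrix (Fin n) (Fin n) F)

/-- The integrand as a function on `U_n(F) \ GL_n(F)`. -/
def zetaQuotient {n m : ℕ} (h : n ≤ m) {ψ : AddChar F ℂ}
    {w : GL (Fin m) F → ℂ} (hw : IsWhittaker ψ w) {v : GL (Fin n) F → ℂ}
    (hv : IsWhittaker ψ⁻¹ v) (χ : Fˣ →* ℂˣ) (f : Fˣ) (s : ℂ) :
    Quotient (QuotientGroup.rightRel (unipotent F n)) → ℂ :=
  Quotient.lift (zetaIntegrand h ψ w v χ f s) fun a b hab => by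
    have hu : b * a⁻¹ ∈ unipotent F n := QuotientGroup.rightRel_apply.1 hab
    have := zetaIntegrand_unipotent_mul h hw hv χ f s hu a
    rw [inv_mul_cancel_right] at this
    exact this.symm

/-- The image of `U_n(F) ϖ^e ω I_n` in `U_n(F) \ GL_n(F)`, where `p = (e, σ)` and `ω` is the
permutation matrix of `σ`. For `e ∈ ℤⁿ` and `σ ∈ S_n`, these sets form a countable partition of `U_n(F) \ GL_n(F)` into
compact open subsets. -/
def cell {n : ℕ} (ϖ : Fˣ) (p : (Fin n → ℤ) × Equiv.Perm (Fin n)) :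
    Set (Quotient (QuotientGroup.rightRel (unipotent F n))) :=
  {x | ∃ k ∈ iwahori F n, x = Quotient.mk _ (diagGL (fun i => ϖ ^ p.1 i) * permGL F p.2 * k)}

/-- The integral of `Z` over a space partitioned into the countable family `A` has the value `C`, as
an improper integral: `Z` is absolutely integrable over every `A i`, the integrals over the `A i` sum
(unconditionally) to `C`, and if `Z` is absolutely integrable over the whole space then its
integral is `C`. -/
def HasIntegralAlong {X ι : Type*} [MeasurableSpace X] (A : ι → Set X) (Z : X → ℂ) (ρ : Measure X)
    (C : ℂ) : Prop :=
  (∀ i, IntegrableOn Z (A i) ρ) ∧ HasSum (fun i => ∫ x in A i, Z x ∂ρ) C ∧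
    (Integrable Z ρ → ∫ x, Z x ∂ρ = C)

end LocalField

end LocalBirch
end

open LocalBirch MeasureTheory ValuativeRel

noncomputable section

namespace LocalBirch

open MeasureTheory ValuativeRel
set_option linter.unusedSectionVars false
open scoped ENNReal NNReal Pointwise Matrix Classical

/-! The integral splits over the orbits of the Iwahori group `I_n` on `U_n \ GL_n`. On a coset `g
I_n` the factors `v` and `|det|` are constant. Up to nonzero volumes, an orbit integral is therefore
a constant times the integral over `I_n` of `birchFun (g k) = w(j(g k D_n w_n)) χ(det g k) ψ(λ_n(g
k))`. This is computed with additive Haar measure on integral matrices, which on `GL_n(𝒪)` is a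
multiple of multiplicative Haar measure (`volGL_smul_restrict_intGL`). The multiple is the density
of `GL_n` over the residue field, whence the factor `∏ (1 - N(𝔭)^{-ν})⁻¹` (`volGL_eq`).

The first mechanism is orthogonality. A diagonal matrix `t` of units, multiplied on the right of
`k`, can be moved past `D_n w_n` and is absorbed by the Iwahori invariance of `w`. Only `∏ χ(t_i)`
remains, while the `i`-th summand of `λ_n` is scaled by `t_i`. As for incomplete Gauss sums, the
integral only sees those `k` for which `f` times every summand is a unit
(`iwahoriIntegral_birchFun_eq_adapted`). Each coordinate is scaled separately, so only the conductor
of `χ` itself enters, never that of a power.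

The second mechanism is a descent from `n + 1` to `n`. If such a `k` exists, then, up to units, the
last row of `g k` is that of the lower triangular matrix `A = (f^{i-j})`, so `g` lies in `U j(g')
I`. For `g = j(g')` the form `λ` depends only on the last row of `k`. By equivariance under the
units, integration over that row splits off `n + 1` Gauss sums and leaves the integral over the
matrices with the last row of `A`. These are the products of matrices `(H, y; 0, 1)` with `A`. The
identity `A D_{n+1} w_{n+1} = u j(D_n w_n) κ`, with `u` unipotent and `κ` in the Iwahori group
(`lowerPow_mul_matD_mul_longestWeyl`), turns the integrand into the one of rank `n`: the Whittaker
property of `w` under `u` reproduces `ψ(λ_n)`. The result is the recursion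
`iwahoriIntegral_birchFun_embGL`.

The recursion evaluates the integral at `g = 1`. It also shows that the integral vanishes unless `g`
lies in `U_n I_n`. Hence exactly one Iwahori orbit, that of the identity, can contribute, and both
the sum over the cells and the absolutely convergent integral reduce to it. -/

theorem continuous_ite_of_isClopen {X Y : Type*} [TopologicalSpace X] [TopologicalSpace Y]
    {p : X → Prop} [DecidablePred p] (hp : IsClopen {x | p x}) {f g : X → Y} (hf : Continuous f)
    (hg : Continuous g) : Continuous fun x => if p x then f x else g x :=
  Continuous.if (by simp [hp.frontier_eq]) hf hg

/-! ### Units, valuations and the conductor of the quasi-character. -/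

section Basic

variable {F : Type*} [Field F] [ValuativeRel F] [TopologicalSpace F] [IsNonarchimedeanLocalField F]

theorem isUnit_iff_valuation_eq_one (x : 𝒪[F]) : IsUnit x ↔ valuation F (x : F) = 1 :=
  (Valuation.integer.integers (valuation F)).isUnit_iff_valuation_eq_one

theorem mem_maximalIdeal_iff_valuation_lt_one (x : 𝒪[F]) :
    x ∈ 𝓂[F] ↔ valuation F (x : F) < 1 := by
  rw [IsLocalRing.mem_maximalIdeal, mem_nonunits_iff, isUnit_iff_valuation_eq_one]
  exact ⟨fun h => lt_of_le_of_ne x.2 h, fun h => h.ne⟩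

theorem valuation_unit (u : (𝒪[F])ˣ) : valuation F ((u : 𝒪[F]) : F) = 1 :=
  (isUnit_iff_valuation_eq_one _).1 u.isUnit

theorem isClopen_valuation_le_one : IsClopen {x : F | valuation F x ≤ 1} :=
  (valuation F).isClopen_integer

theorem isClopen_valuation_lt_one : IsClopen {x : F | valuation F x < 1} := by
  simpa only [Valuation.restrict_lt_one_iff] using Valuation.isClopen_ball (v := valuation F) 1

theorem isClopen_valuation_eq_one : IsClopen {x : F | valuation F x = 1} := by
  have : {x : F | valuation F x = 1} =
      {x : F | valuation F x ≤ 1} ∩ {x : F | valuation F x < 1}ᶜ := by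
    ext x; simp [le_antisymm_iff]
  rw [this]
  exact isClopen_valuation_le_one.inter isClopen_valuation_lt_one.compl

theorem exists_unit_of_valuation_eq_one {x : F} (hx : valuation F x = 1) :
    ∃ u : (𝒪[F])ˣ, ((u : 𝒪[F]) : F) = x := by
  have hu : IsUnit (⟨x, hx.le⟩ : 𝒪[F]) := (isUnit_iff_valuation_eq_one _).2 hx
  exact ⟨hu.unit, rfl⟩

theorem psi_integer {ψ : AddChar F ℂ} (hψ : HasConductorIntegers ψ) {x : F}
    (hx : valuation F x ≤ 1) : ψ x = 1 := by
  have := (hψ 1).2 (one_mem _) ⟨x, hx⟩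
  simpa using this

/-- The character of the units of `𝒪_F` defined by a quasi-character. -/
def unitChar (χ : Fˣ →* ℂˣ) (u : (𝒪[F])ˣ) : ℂ := χ (Units.map (𝒪[F]).subtype u)

theorem unitChar_mul (χ : Fˣ →* ℂˣ) (u u' : (𝒪[F])ˣ) :
    unitChar χ (u * u') = unitChar χ u * unitChar χ u' := by simp [unitChar]

theorem unitChar_one (χ : Fˣ →* ℂˣ) : unitChar χ (1 : (𝒪[F])ˣ) = 1 := by simp [unitChar]

theorem evalChar_unit (χ : Fˣ →* ℂˣ) (u : (𝒪[F])ˣ) :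
    evalChar χ ((u : 𝒪[F]) : F) = unitChar χ u := by
  rw [evalChar, dif_neg (by simp), unitChar]
  congr 2
  ext; simp

theorem unitChar_eq_one_of_dvd {χ : Fˣ →* ℂˣ} {f : 𝒪[F]} (hχ : HasConductor χ (Ideal.span {f}))
    (u : (𝒪[F])ˣ) (hu : f ∣ (u : 𝒪[F]) - 1) : unitChar χ u = 1 := by
  rw [unitChar, hχ.1 u (Ideal.mem_span_singleton.2 hu), Units.val_one]

/-- Write `f = ϖ f'`. Since `f` generates the largest admissible ideal, `χ` is nontrivial on some
unit `u` congruent to `1` modulo `f'`. If `r f` lies in `𝔭`, then `r f'` is integral, hence so is `r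
(u - 1)`. The bound says that `ψ(r u) = ψ(r)` for such `r`. -/
theorem exists_unitChar_ne_one {χ : Fˣ →* ℂˣ} {f : 𝒪[F]} (hf0 : f ≠ 0) (hf : ¬ IsUnit f)
    (hχ : HasConductor χ (Ideal.span {f})) :
    ∃ u : (𝒪[F])ˣ, unitChar χ u ≠ 1 ∧
      ∀ r : F, valuation F (r * f) < 1 → valuation F (r * ((u : 𝒪[F]) - 1 : 𝒪[F])) ≤ 1 := by
  obtain ⟨ϖ, hϖ⟩ := IsDiscreteValuationRing.exists_irreducible 𝒪[F]
  have hm : 𝓂[F] = Ideal.span {ϖ} := hϖ.maximalIdeal_eq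
  have hfm : f ∈ 𝓂[F] := hf
  rw [hm, Ideal.mem_span_singleton] at hfm
  obtain ⟨f', rfl⟩ := hfm
  have hf' : f' ≠ 0 := right_ne_zero_of_mul hf0
  by_contra! hcon
  have hmem : Ideal.span {f'} ∈ {𝔞 : Ideal 𝒪[F] |
      ∀ u : (𝒪[F])ˣ, (u : 𝒪[F]) - 1 ∈ 𝔞 → χ (Units.map (𝒪[F]).subtype u) = 1} := by
    intro u hu
    by_contra hne
    obtain ⟨r, hr, hr'⟩ := hcon u (fun h => hne (Units.ext h))
    obtain ⟨c, hc⟩ := Ideal.mem_span_singleton.1 hu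
    have h1 : (⟨r * ((ϖ * f' : 𝒪[F]) : F), hr.le⟩ : 𝒪[F]) ∈ 𝓂[F] :=
      (mem_maximalIdeal_iff_valuation_lt_one _).2 hr
    rw [hm, Ideal.mem_span_singleton] at h1
    obtain ⟨d, hd⟩ := h1
    have hd' : r * (ϖ * f') = (ϖ : F) * d := congrArg Subtype.val hd
    have hϖ0 : (ϖ : F) ≠ 0 := by simpa using hϖ.ne_zero
    have : r * f' = d := mul_left_cancel₀ hϖ0 (by rw [← hd']; ring)
    rw [hc, Subring.coe_mul, ← mul_assoc, this, map_mul] at hr'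
    exact absurd (mul_le_one' d.2 c.2) (not_le.2 hr')
  have hle : Ideal.span {f'} ≤ Ideal.span {ϖ * f'} := hχ.2 hmem
  rw [Ideal.span_singleton_le_span_singleton] at hle
  obtain ⟨c, hc⟩ := hle
  -- Otherwise `f'` would be a multiple of `ϖ f'`, making `ϖ` a unit.
  apply hϖ.not_isUnit
  refine IsUnit.of_mul_eq_one c (mul_right_cancel₀ hf' ?_)
  rw [one_mul]; conv_rhs => rw [hc]
  ring

end Basic

/-! ### Orthogonality under an action of the units. -/

section Torus

variable {F : Type*} [Field F] [ValuativeRel F] [TopologicalSpace F] [IsNonarchimedeanLocalField F]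
variable [MeasurableSpace 𝒪[F]] [BorelSpace 𝒪[F]] (η : Measure 𝒪[F]) [η.IsAddHaarMeasure]

/-- Translation by a `y` with `ψ(z y) ≠ 1` multiplies the integral by `ψ(z y)`. -/
theorem integral_psi_eq_zero {ψ : AddChar F ℂ} (hψ : HasConductorIntegers ψ) {z : F}
    (hz : ¬ valuation F z ≤ 1) : ∫ s : 𝒪[F], ψ (z * s) ∂η = 0 := by
  have : ¬ ∀ y : 𝒪[F], ψ (z * y) = 1 := fun h => hz ((hψ z).1 h)
  push Not at this
  obtain ⟨y, hy⟩ := this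
  have h := integral_add_left_eq_self (μ := η) (fun s : 𝒪[F] => ψ (z * s)) y
  simp only [Subring.coe_add, mul_add, AddChar.map_add_eq_mul] at h
  rw [integral_const_mul] at h
  have : (ψ (z * y) - 1) * ∫ s : 𝒪[F], ψ (z * s) ∂η = 0 := by rw [sub_mul, h]; ring
  exact (mul_eq_zero.1 this).resolve_left (sub_ne_zero.2 hy)

/-- A function that transforms under an action of the units of `𝒪_F` by a character of conductor `f`
is orthogonal to `ψ(ζ)` on the locus where `ζ f` is not a unit. -/
theorem integral_mul_psi_eq_integral_unit_locus {Ω : Type*} [TopologicalSpace Ω] [CompactSpace Ω]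
    [SecondCountableTopology Ω] [MeasurableSpace Ω] [BorelSpace Ω] (m : Measure Ω)
    [IsFiniteMeasure m]
    {ψ : AddChar F ℂ} (hψc : Continuous ψ) (hψ : HasConductorIntegers ψ) {χ : Fˣ →* ℂˣ}
    {f : 𝒪[F]} (hf0 : f ≠ 0) (hf : ¬ IsUnit f) (hχ : HasConductor χ (Ideal.span {f}))
    (τ : (𝒪[F])ˣ → Ω ≃ₜ Ω) (hτ : ∀ u, MeasurePreserving (τ u) m m)
    {Φ : Ω → ℂ} (hΦ : Continuous Φ) (hΦτ : ∀ u k, Φ (τ u k) = unitChar χ u * Φ k)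
    {ζ : Ω → F} (hζ : Continuous ζ) (hζτ : ∀ u k, ζ (τ u k) = u * ζ k) :
    ∫ k, Φ k * ψ (ζ k) ∂m =
      ∫ k, (if valuation F (ζ k * f) = 1 then Φ k else 0) * ψ (ζ k) ∂m := by
  have := secondCountable_localField F
  have hint : ∀ {g : Ω → ℂ}, Continuous g → Integrable g m := fun hg =>
    hg.integrable_of_hasCompactSupport (HasCompactSupport.of_compactSpace _)
  have hζf : Continuous fun k => ζ k * f := hζ.mul continuous_const
  have cl : IsClopen {k | valuation F (ζ k * f) < 1} := isClopen_valuation_lt_one.preimage hζf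
  have ce : IsClopen {k | valuation F (ζ k * f) = 1} := isClopen_valuation_eq_one.preimage hζf
  have cg : IsClopen {k | ¬ valuation F (ζ k * f) ≤ 1} :=
    (isClopen_valuation_le_one.preimage hζf).compl
  have hψζ : Continuous fun k => ψ (ζ k) := hψc.comp hζ
  have hval : ∀ (u : (𝒪[F])ˣ) k, valuation F (ζ (τ u k) * f) = valuation F (ζ k * f) := by
    intro u k
    rw [hζτ, mul_assoc, map_mul, valuation_unit, one_mul]
  have hchange : ∀ u (g : Ω → ℂ), ∫ k, g (τ u k) ∂m = ∫ k, g k ∂m := fun u g =>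
    (hτ u).integral_comp (τ u).measurableEmbedding g
  have cont_lt : Continuous fun k => (if valuation F (ζ k * f) < 1 then Φ k else 0) * ψ (ζ k) :=
    (continuous_ite_of_isClopen cl hΦ continuous_const).mul hψζ
  have cont_gt : Continuous fun k => (if ¬ valuation F (ζ k * f) ≤ 1 then Φ k else 0) * ψ (ζ k) :=
    (continuous_ite_of_isClopen cg hΦ continuous_const).mul hψζ
  have cont_eq : Continuous fun k => (if valuation F (ζ k * f) = 1 then Φ k else 0) * ψ (ζ k) :=
    (continuous_ite_of_isClopen ce hΦ continuous_const).mul hψζ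
  have h_lt : ∫ k, (if valuation F (ζ k * f) < 1 then Φ k else 0) * ψ (ζ k) ∂m = 0 := by
    -- Acting by this `u` multiplies `Φ` by `χ(u) ≠ 1` and leaves `ψ(ζ)` unchanged where `|ζ f| <
    -- 1`, so the integral equals `χ(u)` times itself.
    obtain ⟨u, hu, hu'⟩ := exists_unitChar_ne_one hf0 hf hχ
    have h := hchange u fun k => (if valuation F (ζ k * f) < 1 then Φ k else 0) * ψ (ζ k)
    have h2 : ∀ k, (if valuation F (ζ (τ u k) * f) < 1 then Φ (τ u k) else 0) * ψ (ζ (τ u k)) =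
        unitChar χ u * ((if valuation F (ζ k * f) < 1 then Φ k else 0) * ψ (ζ k)) := by
      intro k
      rw [hval]
      split_ifs with hk
      · have : ζ (τ u k) = ζ k + ζ k * ((u : 𝒪[F]) - 1 : 𝒪[F]) := by rw [hζτ]; push_cast; ring
        rw [hΦτ, this, AddChar.map_add_eq_mul, psi_integer hψ (hu' _ hk)]
        ring
      · simp
    simp only [h2] at h
    rw [integral_const_mul] at h
    have h3 := sub_eq_zero.2 h
    rw [← sub_one_mul] at h3
    exact (mul_eq_zero.1 h3).resolve_left (sub_ne_zero.2 hu)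
  have h_gt : ∫ k, (if ¬ valuation F (ζ k * f) ≤ 1 then Φ k else 0) * ψ (ζ k) ∂m = 0 := by
    -- The integral is averaged over the units `1 + f s`, on which `χ` is trivial: `Φ` is unchanged,
    -- while `ψ(ζ)` acquires the factor `ψ(ζ f s)`, whose mean over `s` is zero because `ζ f` is not
    -- integral. Taking `K` to be the whole ring gives `η` total mass one.
    let : MeasurableSpace 𝒪[F] := borel _
    have : BorelSpace 𝒪[F] := ⟨rfl⟩
    let K : TopologicalSpace.PositiveCompacts 𝒪[F] := ⟨⟨Set.univ, isCompact_univ⟩, by simp⟩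
    let η := Measure.addHaarMeasure K
    have h1 : ∀ s : 𝒪[F], ∫ k, (if ¬ valuation F (ζ k * f) ≤ 1 then Φ k else 0) *
        ψ (ζ k) * ψ (ζ k * f * s) ∂m =
        ∫ k, (if ¬ valuation F (ζ k * f) ≤ 1 then Φ k else 0) * ψ (ζ k) ∂m := by
      intro s
      have hfm : f * s ∈ 𝓂[F] := Ideal.mul_mem_right _ _ hf
      have hu : IsUnit (1 + f * s) := by
        by_contra h
        have h1 : 1 + f * s ∈ 𝓂[F] := h
        have := (Ideal.add_mem_iff_left _ hfm).1 h1
        exact this isUnit_one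
      refine Eq.trans ?_ (hchange hu.unit _)
      refine integral_congr_ae (Filter.Eventually.of_forall fun k => ?_)
      simp only [hval]
      rw [hΦτ, unitChar_eq_one_of_dvd hχ _ (by simp), one_mul, mul_assoc,
        ← AddChar.map_add_eq_mul]
      congr 2
      rw [hζτ, IsUnit.unit_spec]; push_cast; ring
    have hcont : Continuous fun p : 𝒪[F] × Ω => (if ¬ valuation F (ζ p.2 * f) ≤ 1 then Φ p.2 else 0) *
        ψ (ζ p.2) * ψ (ζ p.2 * f * p.1) :=
      (cont_gt.comp continuous_snd).mul (hψc.comp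
        ((hζf.comp continuous_snd).mul (continuous_subtype_val.comp continuous_fst)))
    have : SecondCountableTopology 𝒪[F] := TopologicalSpace.Subtype.secondCountableTopology _
    have hswap := integral_integral_swap (μ := η) (ν := m)
      (f := fun (s : 𝒪[F]) k => (if ¬ valuation F (ζ k * f) ≤ 1 then Φ k else 0) *
        ψ (ζ k) * ψ (ζ k * f * s))
      (hcont.integrable_of_hasCompactSupport (HasCompactSupport.of_compactSpace _))
    simp only [h1] at hswap
    have h2 : ∀ k, ∫ s : 𝒪[F], (if ¬ valuation F (ζ k * f) ≤ 1 then Φ k else 0) *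
        ψ (ζ k) * ψ (ζ k * f * s) ∂η = 0 := by
      intro k
      rw [integral_const_mul]
      by_cases hk : valuation F (ζ k * f) ≤ 1
      · rw [if_neg (not_not.2 hk), zero_mul, zero_mul]
      · rw [integral_psi_eq_zero η hψ hk, mul_zero]
    simp only [h2, integral_zero, integral_const] at hswap
    have hη : η.real Set.univ = 1 := by
      have : η (K : Set 𝒪[F]) = 1 := Measure.addHaarMeasure_self
      simp only [Measure.real]
      change (η (K : Set 𝒪[F])).toReal = 1
      rw [this]; simp
    rw [hη, one_smul] at hswap
    exact hswap
  have hsplit : ∀ k, Φ k * ψ (ζ k) =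
      (if valuation F (ζ k * f) = 1 then Φ k else 0) * ψ (ζ k) +
      ((if valuation F (ζ k * f) < 1 then Φ k else 0) * ψ (ζ k) +
        (if ¬ valuation F (ζ k * f) ≤ 1 then Φ k else 0) * ψ (ζ k)) := by
    intro k
    rcases lt_trichotomy (valuation F (ζ k * f)) 1 with h | h | h
    · rw [if_neg h.ne, if_pos h, if_neg (not_not.2 h.le)]; ring
    · rw [if_pos h, if_neg h.not_lt, if_neg (not_not.2 h.le)]; ring
    · rw [if_neg h.ne', if_neg h.not_gt, if_pos (not_le.2 h)]; ring
  rw [integral_congr_ae (Filter.Eventually.of_forall hsplit), integral_add (hint cont_eq)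
    (g := fun k => (if valuation F (ζ k * f) < 1 then Φ k else 0) * ψ (ζ k) +
        (if ¬ valuation F (ζ k * f) ≤ 1 then Φ k else 0) * ψ (ζ k))
    (hint (cont_lt.add cont_gt)), integral_add (hint cont_lt) (hint cont_gt), h_lt, h_gt]
  simp

end Torus

/-! ### Gauss sums as integrals over the ring of integers. -/

section GaussIntegral

variable {F : Type*} [Field F] [ValuativeRel F] [TopologicalSpace F] [IsNonarchimedeanLocalField F]

theorem secondCountable_integers : SecondCountableTopology 𝒪[F] := by
  have := secondCountable_localField F
  exact TopologicalSpace.Subtype.secondCountableTopology _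

theorem t2Space_integers : T2Space 𝒪[F] := by
  have := t2Space_localField F
  infer_instance

theorem dvd_iff_valuation_div_le_one {c : 𝒪[F]} (hc : c ≠ 0) (r : 𝒪[F]) :
    c ∣ r ↔ valuation F ((r : F) / c) ≤ 1 := by
  have hc' : (c : F) ≠ 0 := by simpa using hc
  constructor
  · rintro ⟨d, rfl⟩
    rw [Subring.coe_mul, mul_div_cancel_left₀ _ hc']
    exact d.2
  · intro h
    refine ⟨⟨_, h⟩, Subtype.ext ?_⟩
    rw [Subring.coe_mul, mul_div_cancel₀ _ hc']

theorem isClopen_span_singleton {c : 𝒪[F]} (hc : c ≠ 0) :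
    IsClopen ((Ideal.span {c} : Ideal 𝒪[F]) : Set 𝒪[F]) := by
  have : ((Ideal.span {c} : Ideal 𝒪[F]) : Set 𝒪[F]) =
      (fun r : 𝒪[F] => (r : F) / c) ⁻¹' {x | valuation F x ≤ 1} := by
    ext r
    rw [SetLike.mem_coe, Ideal.mem_span_singleton, dvd_iff_valuation_div_le_one hc]
    rfl
  rw [this]
  exact isClopen_valuation_le_one.preimage (continuous_subtype_val.div_const _)

theorem finite_quotient_span {c : 𝒪[F]} (hc : c ≠ 0) : Finite (𝒪[F] ⧸ Ideal.span {c}) :=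
  AddSubgroup.quotient_finite_of_isOpen (Ideal.span {c} : Ideal 𝒪[F]).toAddSubgroup
    (isClopen_span_singleton hc).isOpen

variable [MeasurableSpace 𝒪[F]] [BorelSpace 𝒪[F]] (η : Measure 𝒪[F]) [η.IsAddHaarMeasure]
  [IsProbabilityMeasure η]

/-- The cosets of this open subgroup have equal measure and cover a space of mass one. -/
theorem measure_span_singleton {c : 𝒪[F]} (hc : c ≠ 0) :
    η (Ideal.span {c} : Ideal 𝒪[F]) = (normIdeal c : ℝ≥0∞)⁻¹ := by
  have := finite_quotient_span hc
  let H : AddSubgroup 𝒪[F] := (Ideal.span {c} : Ideal 𝒪[F]).toAddSubgroup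
  have : Finite (𝒪[F] ⧸ H) := this
  have : H.FiniteIndex := AddSubgroup.finiteIndex_of_finite_quotient
  have h := H.index_mul_measure (isClopen_span_singleton hc).isOpen.measurableSet η
  rw [measure_univ, mul_comm] at h
  exact ENNReal.eq_inv_of_mul_eq_one_left h

theorem measurableEmbedding_mul_left {c : 𝒪[F]} (hc : c ≠ 0) :
    MeasurableEmbedding fun r : 𝒪[F] => c * r := by
  have := t2Space_integers (F := F)
  exact ((continuous_const.mul continuous_id).isClosedEmbedding
    (mul_right_injective₀ hc)).measurableEmbedding

theorem range_mul_left (c : 𝒪[F]) :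
    Set.range (fun r : 𝒪[F] => c * r) = (Ideal.span {c} : Ideal 𝒪[F]) := by
  ext r
  simp [Ideal.mem_span_singleton, dvd_def, eq_comm]

/-- The pullback of `η` along multiplication by `c` is translation invariant, hence a multiple of
`η`. Evaluation on the whole ring identifies the scalar as the measure of `c 𝒪`. Multiplication by
`c` is a measurable embedding, so `g` may be arbitrary. -/
theorem setIntegral_span_singleton {c : 𝒪[F]} (hc : c ≠ 0) (g : 𝒪[F] → ℂ) :
    ∫ r in (Ideal.span {c} : Ideal 𝒪[F]), g r ∂η = (normIdeal c : ℂ)⁻¹ * ∫ t, g (c * t) ∂η := by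
  have := secondCountable_integers (F := F)
  have he := measurableEmbedding_mul_left hc
  have hr := range_mul_left c
  let m := η.comap fun r : 𝒪[F] => c * r
  have hm : ∀ s, m s = η ((fun r : 𝒪[F] => c * r) '' s) := fun s => he.comap_apply _ _
  have hfin : IsFiniteMeasure m := ⟨by rw [hm]; exact measure_lt_top _ _⟩
  have hinv : m.IsAddLeftInvariant := by
    refine ⟨fun x => ?_⟩
    ext s hs
    rw [Measure.map_apply (measurable_const_add x) hs, hm, hm]
    have : (fun r : 𝒪[F] => c * r) '' ((fun y => x + y) ⁻¹' s) =
        (fun y => c * x + y) ⁻¹' ((fun r : 𝒪[F] => c * r) '' s) := by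
      ext y
      constructor
      · rintro ⟨z, hz, rfl⟩
        exact ⟨x + z, hz, by simp [mul_add]⟩
      · rintro ⟨z, hz, hzy⟩
        refine ⟨z - x, by simpa using hz, ?_⟩
        simp only at hzy ⊢
        rw [mul_sub, hzy]; ring
    rw [this, measure_preimage_add]
  have hmη := Measure.isAddLeftInvariant_eq_smul m η
  have hscal : (m.addHaarScalarFactor η : ℝ≥0∞) = (normIdeal c : ℝ≥0∞)⁻¹ := by
    have h1 : m Set.univ = (normIdeal c : ℝ≥0∞)⁻¹ := by
      rw [hm, Set.image_univ, hr, measure_span_singleton η hc]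
    rw [hmη] at h1
    simpa using h1
  have hrest : η.restrict (Ideal.span {c} : Ideal 𝒪[F]) = m.map fun r : 𝒪[F] => c * r := by
    rw [he.map_comap, hr]
  rw [hrest, he.integral_map, hmη]
  rw [integral_smul_nnreal_measure]
  have : ((m.addHaarScalarFactor η : ℝ≥0) : ℝ) = (normIdeal c : ℝ)⁻¹ := by
    have := congrArg ENNReal.toReal hscal
    simpa using this
  rw [NNReal.smul_def, this, Complex.real_smul]
  push_cast
  rfl

variable (ψ : AddChar F ℂ) (χ : Fˣ →* ℂˣ) (f : 𝒪[F])

/-- The function `r ↦ χ(r / f^l) ψ(r / f^{l+1})` on `f^l 𝒪_Fˣ`, extended by zero. -/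
def gaussFun (l : ℕ) (r : F) : ℂ :=
  (if valuation F (r / (f : F) ^ l) = 1 then evalChar χ (r / (f : F) ^ l) else 0) *
    ψ (r / (f : F) ^ (l + 1))

variable {ψ χ f}

theorem gaussFun_succ_mul (hf0 : f ≠ 0) (l : ℕ) (r : F) :
    gaussFun ψ χ f (l + 1) (f * r) = gaussFun ψ χ f l r := by
  have hf' : (f : F) ≠ 0 := by simpa using hf0
  unfold gaussFun
  rw [pow_succ' _ (l + 1), mul_div_mul_left _ _ hf', pow_succ' _ l, mul_div_mul_left _ _ hf']

/-- At level `l + 1` the integrand is supported in `f 𝒪`, and the substitution `r = f t` lowers the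
level. -/
theorem integral_gaussFun_succ (hf0 : f ≠ 0) (l : ℕ) :
    ∫ r : 𝒪[F], gaussFun ψ χ f (l + 1) r ∂η =
      (normIdeal f : ℂ)⁻¹ * ∫ r : 𝒪[F], gaussFun ψ χ f l r ∂η := by
  have h := setIntegral_span_singleton η hf0 fun r : 𝒪[F] => gaussFun ψ χ f (l + 1) r
  simp only [Subring.coe_mul, gaussFun_succ_mul hf0] at h
  rw [← h, setIntegral_eq_integral_of_forall_compl_eq_zero]
  intro r hr
  unfold gaussFun
  rw [if_neg, zero_mul]
  intro h1
  apply hr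
  rw [SetLike.mem_coe, Ideal.mem_span_singleton, dvd_iff_valuation_div_le_one hf0]
  have h2 : (r : F) / f = r / (f : F) ^ (l + 1) * (f : F) ^ l := by
    have hf' : (f : F) ≠ 0 := by simpa using hf0
    rw [pow_succ]; field_simp
  rw [h2, map_mul, h1, one_mul, map_pow]
  exact pow_le_one' f.2 _

/-- Congruent units differ by a factor that is `1` modulo `f`, which `χ` ignores, and `r / f`
changes by an integer, which `ψ` ignores. As `f` lies in `𝔭`, being a unit depends only on the
class. -/
theorem gaussFun_zero_congr (hψ : HasConductorIntegers ψ) (hf0 : f ≠ 0) (hf : ¬ IsUnit f)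
    (hχ : HasConductor χ (Ideal.span {f})) {r r' : 𝒪[F]} (h : f ∣ r - r') :
    gaussFun ψ χ f 0 r = gaussFun ψ χ f 0 r' := by
  have hf' : (f : F) ≠ 0 := by simpa using hf0
  have hu : IsUnit r ↔ IsUnit r' := by
    have hm : r - r' ∈ 𝓂[F] := Ideal.mem_of_dvd _ h hf
    rw [← not_iff_not, ← mem_nonunits_iff, ← mem_nonunits_iff, ← IsLocalRing.mem_maximalIdeal,
      ← IsLocalRing.mem_maximalIdeal]
    have : r = (r - r') + r' := by ring
    rw [this, Ideal.add_mem_iff_right _ hm]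
  unfold gaussFun
  simp only [pow_zero, div_one, zero_add, pow_one, ← isUnit_iff_valuation_eq_one, hu]
  split_ifs with h1
  · have h2 := hu.2 h1
    obtain ⟨u', rfl⟩ := h1
    obtain ⟨u, rfl⟩ := h2
    obtain ⟨d, hd⟩ := h
    congr 1
    · rw [evalChar_unit, evalChar_unit]
      have : u = u' * (u'⁻¹ * u) := by simp
      rw [this, unitChar_mul, unitChar_eq_one_of_dvd hχ (u'⁻¹ * u), mul_one]
      refine ⟨(u'⁻¹ : (𝒪[F])ˣ) * d, ?_⟩
      rw [mul_left_comm, ← hd, Units.val_mul, mul_sub, Units.inv_mul]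
    · have : ((u : 𝒪[F]) : F) / f = ((u' : 𝒪[F]) : F) / f + d := by
        have := congrArg (Subtype.val) hd
        push_cast at this
        field_simp
        rw [← this]; ring
      rw [this, AddChar.map_add_eq_mul, psi_integer hψ d.2, mul_one]
  · simp

/-- The integrand is constant on the classes modulo `f`, each of measure `N(f)⁻¹`. -/
theorem integral_gaussFun_zero (hψ : HasConductorIntegers ψ) (hf0 : f ≠ 0) (hf : ¬ IsUnit f)
    (hχ : HasConductor χ (Ideal.span {f})) :
    ∫ r : 𝒪[F], gaussFun ψ χ f 0 r ∂η = (normIdeal f : ℂ)⁻¹ * localGaussSum ψ χ f := by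
  have := finite_quotient_span hf0
  let : Fintype (𝒪[F] ⧸ Ideal.span {f}) := Fintype.ofFinite _
  let : Fintype (𝒪[F] ⧸ Ideal.span {f})ˣ := Fintype.ofFinite _
  let mk : 𝒪[F] → 𝒪[F] ⧸ Ideal.span {f} := Ideal.Quotient.mk _
  let rep : 𝒪[F] ⧸ Ideal.span {f} → 𝒪[F] :=
    Function.surjInv (Ideal.Quotient.mk_surjective (I := Ideal.span {f}))
  have hrep : ∀ a, mk (rep a) = a := Function.surjInv_eq _
  have hdvd : ∀ r, f ∣ r - rep (mk r) := fun r => by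
    rw [← Ideal.mem_span_singleton, ← Ideal.Quotient.eq]
    exact (hrep (mk r)).symm
  have hfib : ∀ a, mk ⁻¹' {a} = (fun r => -rep a + r) ⁻¹' (Ideal.span {f} : Ideal 𝒪[F]) := by
    intro a
    ext r
    rw [Set.mem_preimage, Set.mem_singleton_iff, Set.mem_preimage, SetLike.mem_coe,
      neg_add_eq_sub, ← Ideal.Quotient.eq]
    change mk r = a ↔ mk r = mk (rep a)
    rw [hrep]
  have hmeas : ∀ a, MeasurableSet (mk ⁻¹' {a}) := fun a => by
    rw [hfib]
    exact (measurable_const_add _) (isClopen_span_singleton hf0).isOpen.measurableSet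
  have hη : ∀ a, η.real (mk ⁻¹' {a}) = (normIdeal f : ℝ)⁻¹ := fun a => by
    rw [Measure.real, hfib, measure_preimage_add, measure_span_singleton η hf0]
    simp
  have hsum : ∀ r : 𝒪[F], gaussFun ψ χ f 0 r =
      ∑ a, (mk ⁻¹' {a}).indicator (fun _ => gaussFun ψ χ f 0 (rep a)) r := by
    intro r
    rw [Finset.sum_eq_single (mk r)]
    · rw [Set.indicator_of_mem (by simp)]
      exact gaussFun_zero_congr hψ hf0 hf hχ (hdvd r)
    · intro b _ hb
      exact Set.indicator_of_notMem (fun h => hb (by simpa using h.symm)) _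
    · simp
  rw [integral_congr_ae (Filter.Eventually.of_forall hsum),
    integral_finsetSum _ fun a _ => (integrable_const _).indicator (hmeas a)]
  simp only [integral_indicator_const _ (hmeas _), hη]
  rw [← Finset.smul_sum, Complex.real_smul, Complex.ofReal_inv, Complex.ofReal_natCast]
  congr 1
  unfold localGaussSum
  rw [finsum_eq_sum_of_fintype]
  have hzero : ∀ a, ¬ IsUnit a → gaussFun ψ χ f 0 (rep a) = 0 := by
    intro a ha
    unfold gaussFun
    rw [if_neg, zero_mul]
    rw [pow_zero, div_one, ← isUnit_iff_valuation_eq_one]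
    intro h
    exact ha (hrep a ▸ h.map (Ideal.Quotient.mk (Ideal.span {f})))
  symm
  refine Finset.sum_of_injOn (fun a => (a : 𝒪[F] ⧸ Ideal.span {f}))
    (fun a _ b _ h => Units.ext h) (fun _ _ => Finset.mem_coe.2 (Finset.mem_univ _)) ?_ ?_
  · intro a _ ha
    refine hzero a fun hu => ha ?_
    exact ⟨hu.unit, by simp, rfl⟩
  · intro a _
    unfold gaussFun
    -- `localGaussSum` has no unit test in its summands. The two sums agree because a representative
    -- of an invertible class is itself a unit, `f` being in `𝔭`.
    have hloc : IsUnit (rep a) := by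
      by_contra h
      have h1 : (1 : 𝒪[F]) - rep a * rep (a⁻¹ : (𝒪[F] ⧸ Ideal.span {f})ˣ) ∈ Ideal.span {f} := by
        rw [← Ideal.Quotient.eq, map_one, map_mul]
        change 1 = mk (rep _) * mk (rep _)
        rw [hrep, hrep, Units.mul_inv]
      have h2 : (1 : 𝒪[F]) - rep a * rep (a⁻¹ : (𝒪[F] ⧸ Ideal.span {f})ˣ) ∈ 𝓂[F] :=
        Ideal.mem_of_dvd _ (Ideal.mem_span_singleton.1 h1) hf
      have h3 : rep a * rep (a⁻¹ : (𝒪[F] ⧸ Ideal.span {f})ˣ) ∈ 𝓂[F] :=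
        Ideal.mul_mem_right _ _ h
      have h4 := Ideal.add_mem _ h2 h3
      rw [sub_add_cancel] at h4
      exact h4 isUnit_one
    rw [pow_zero, div_one, if_pos ((isUnit_iff_valuation_eq_one _).1 hloc), zero_add, pow_one]

theorem integral_gaussFun (hψ : HasConductorIntegers ψ) (hf0 : f ≠ 0) (hf : ¬ IsUnit f)
    (hχ : HasConductor χ (Ideal.span {f})) (l : ℕ) :
    ∫ r : 𝒪[F], gaussFun ψ χ f l r ∂η =
      ((normIdeal f : ℂ) ^ (l + 1))⁻¹ * localGaussSum ψ χ f := by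
  induction l with
  | zero => rw [integral_gaussFun_zero η hψ hf0 hf hχ, zero_add, pow_one]
  | succ l ih => rw [integral_gaussFun_succ η hf0, ih, pow_succ _ (l + 1), mul_inv]; ring

end GaussIntegral

/-! ### The Iwahori subgroup inside the integral matrices. -/

section Iwahori

variable {F : Type*} [Field F] [ValuativeRel F] [TopologicalSpace F] [IsNonarchimedeanLocalField F]

instance instSecondCountableTopologyIntegers : SecondCountableTopology 𝒪[F] :=
  secondCountable_integers

variable (F) in
/-- Integral square matrices, as a product of copies of `𝒪_F`. -/
abbrev IntMat (n : ℕ) : Type _ := Fin n → Fin n → 𝒪[F]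

/-- The integral matrix `k` is upper triangular modulo `𝔭` with units on the diagonal. -/
def IsIwahoriMat {n : ℕ} (k : IntMat F n) : Prop :=
  (∀ i j, j < i → k i j ∈ 𝓂[F]) ∧ ∀ i, IsUnit (k i i)

/-- The entries of an integral matrix, as elements of `F`. -/
def valMat {n : ℕ} (k : IntMat F n) : Matrix (Fin n) (Fin n) F := Matrix.of fun i j => (k i j : F)

theorem valMat_eq_map {n : ℕ} (k : IntMat F n) :
    valMat k = (Matrix.of k).map (𝒪[F]).subtype := rfl

theorem det_valMat {n : ℕ} (k : IntMat F n) : (valMat k).det = ((Matrix.of k).det : F) := by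
  rw [valMat_eq_map]
  exact ((𝒪[F]).subtype.map_det _).symm

/-- An integral matrix with unit determinant as an element of `GL_n(F)`; the value for other
matrices is `1`. -/
def toGL {n : ℕ} (k : IntMat F n) : GL (Fin n) F :=
  if h : IsUnit (Matrix.of k).det then
    Matrix.GeneralLinearGroup.map (𝒪[F]).subtype ((Matrix.of k).nonsingInvUnit h) else 1

theorem toGL_of_isUnit {n : ℕ} {k : IntMat F n} (h : IsUnit (Matrix.of k).det) :
    toGL k = Matrix.GeneralLinearGroup.map (𝒪[F]).subtype ((Matrix.of k).nonsingInvUnit h) :=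
  dif_pos h

theorem coe_toGL {n : ℕ} {k : IntMat F n} (h : IsUnit (Matrix.of k).det) :
    (toGL k : Matrix (Fin n) (Fin n) F) = valMat k := by
  rw [toGL_of_isUnit h]; rfl

theorem isUnit_det_coe {n : ℕ} (k : GL (Fin n) 𝒪[F]) :
    IsUnit (Matrix.of (Matrix.of.symm (k : Matrix (Fin n) (Fin n) 𝒪[F]))).det :=
  (Matrix.isUnit_iff_isUnit_det _).1 k.isUnit

theorem toGL_coe {n : ℕ} (k : GL (Fin n) 𝒪[F]) :
    toGL (Matrix.of.symm (k : Matrix (Fin n) (Fin n) 𝒪[F])) =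
      Matrix.GeneralLinearGroup.map (𝒪[F]).subtype k := by
  apply Units.ext
  rw [coe_toGL (isUnit_det_coe k)]; rfl

theorem toGL_mul_map {n : ℕ} {k : IntMat F n} (h : IsUnit (Matrix.of k).det)
    (k' : GL (Fin n) 𝒪[F]) :
    toGL (Matrix.of.symm (Matrix.of k * (k' : Matrix (Fin n) (Fin n) 𝒪[F]))) =
      toGL k * Matrix.GeneralLinearGroup.map (𝒪[F]).subtype k' := by
  have h' : Matrix.of k * (k' : Matrix (Fin n) (Fin n) 𝒪[F]) =
    (((Matrix.of k).nonsingInvUnit h * k' : GL (Fin n) 𝒪[F]) : Matrix (Fin n) (Fin n) 𝒪[F]) := rfl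
  rw [h', toGL_coe, map_mul, ← toGL_of_isUnit h]

theorem toGL_mem_intGL {n : ℕ} (k : IntMat F n) : toGL k ∈ intGL F n := by
  unfold toGL
  split_ifs with h
  · exact ⟨_, rfl⟩
  · exact one_mem _

/-- Upper triangular invertible matrices over a commutative ring. -/
def upperTriangularGL (R : Type*) [CommRing R] (n : ℕ) : Subgroup (GL (Fin n) R) where
  carrier := {g | (g : Matrix (Fin n) (Fin n) R).BlockTriangular id}
  one_mem' := Matrix.blockTriangular_one
  mul_mem' := fun ha hb => Matrix.BlockTriangular.mul ha hb
  inv_mem' := by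
    intro a ha
    let : Invertible (a : Matrix (Fin n) (Fin n) R) := a.invertible
    have := Matrix.blockTriangular_inv_of_blockTriangular ha
    simpa [Matrix.coe_units_inv] using this

variable (F) in
/-- The Iwahori subgroup of `GL_n(𝒪_F)`. -/
def iwahoriInt (n : ℕ) : Subgroup (GL (Fin n) 𝒪[F]) :=
  (upperTriangularGL 𝓀[F] n).comap
    (Matrix.GeneralLinearGroup.map (IsLocalRing.residue 𝒪[F]))

theorem mem_iwahoriInt_iff {n : ℕ} (k : GL (Fin n) 𝒪[F]) :
    k ∈ iwahoriInt F n ↔ ∀ i j, j < i → k i j ∈ 𝓂[F] := by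
  constructor
  · intro h i j hij
    have : IsLocalRing.residue 𝒪[F] (k i j) = 0 := h hij
    rwa [IsLocalRing.residue_eq_zero_iff] at this
  · intro h i j hij
    exact (IsLocalRing.residue_eq_zero_iff _).2 (h i j hij)

variable (F) in
/-- The Iwahori subgroup as a subgroup of `GL_n(F)`. -/
def iwahoriGL (n : ℕ) : Subgroup (GL (Fin n) F) :=
  (iwahoriInt F n).map (Matrix.GeneralLinearGroup.map (𝒪[F]).subtype)

theorem coe_iwahoriGL (n : ℕ) : (iwahoriGL F n : Set (GL (Fin n) F)) = iwahori F n := by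
  ext g
  constructor
  · rintro ⟨k, hk, rfl⟩
    exact ⟨k, rfl, (mem_iwahoriInt_iff k).1 hk⟩
  · rintro ⟨k, rfl, hk⟩
    exact ⟨k, (mem_iwahoriInt_iff k).2 hk, rfl⟩

theorem mem_iwahori_iff_mem {n : ℕ} {g : GL (Fin n) F} : g ∈ iwahori F n ↔ g ∈ iwahoriGL F n := by
  rw [← coe_iwahoriGL]; rfl

/-- Modulo `𝔭` the matrix is upper triangular, so its determinant reduces to the product of the
diagonal residues. A product in the residue field is nonzero exactly when all factors are. -/
theorem isIwahoriMat_iff {n : ℕ} (k : IntMat F n) :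
    IsIwahoriMat k ↔ (∀ i j, j < i → k i j ∈ 𝓂[F]) ∧ IsUnit (Matrix.of k).det := by
  refine and_congr_right fun h => ?_
  have htri : ((Matrix.of k).map (IsLocalRing.residue 𝒪[F])).IsUpperTriangular := fun i j hij =>
    (IsLocalRing.residue_eq_zero_iff _).2 (h i j hij)
  have hdet : IsLocalRing.residue 𝒪[F] (Matrix.of k).det =
      ∏ i, IsLocalRing.residue 𝒪[F] (k i i) := by
    rw [RingHom.map_det]
    exact Matrix.det_of_isUpperTriangular htri
  have hu : ∀ x : 𝒪[F], IsUnit x ↔ IsLocalRing.residue 𝒪[F] x ≠ 0 := fun x => by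
    rw [Ne, IsLocalRing.residue_eq_zero_iff, IsLocalRing.notMem_maximalIdeal]
  rw [hu, hdet, Finset.prod_ne_zero_iff]
  exact ⟨fun h i _ => (hu _).1 (h i), fun h i => (hu _).2 (h i (Finset.mem_univ _))⟩

theorem IsIwahoriMat.isUnit_det {n : ℕ} {k : IntMat F n} (h : IsIwahoriMat k) :
    IsUnit (Matrix.of k).det := ((isIwahoriMat_iff k).1 h).2

theorem isIwahoriMat_coe_iff {n : ℕ} (k : GL (Fin n) 𝒪[F]) :
    IsIwahoriMat (Matrix.of.symm (k : Matrix (Fin n) (Fin n) 𝒪[F])) ↔ k ∈ iwahoriInt F n := by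
  rw [isIwahoriMat_iff, mem_iwahoriInt_iff]
  exact and_iff_left (isUnit_det_coe k)

theorem IsIwahoriMat.toGL_mem {n : ℕ} {k : IntMat F n} (h : IsIwahoriMat k) :
    toGL k ∈ iwahoriGL F n := by
  rw [toGL_of_isUnit h.isUnit_det]
  exact ⟨_, (mem_iwahoriInt_iff _).2 h.1, rfl⟩

theorem toGL_mem_iwahoriGL_iff {n : ℕ} {k : IntMat F n} (hk : IsUnit (Matrix.of k).det) :
    toGL k ∈ iwahoriGL F n ↔ IsIwahoriMat k := by
  refine ⟨?_, fun h => h.toGL_mem⟩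
  rintro ⟨k', hk', h⟩
  have : k = Matrix.of.symm (k' : Matrix (Fin n) (Fin n) 𝒪[F]) := by
    have h2 := congrArg (fun g : GL (Fin n) F => (g : Matrix (Fin n) (Fin n) F)) h
    simp only [coe_toGL hk] at h2
    ext i j
    exact (congrFun (congrFun h2 i) j).symm
  rw [this, isIwahoriMat_coe_iff]
  exact hk'

theorem isIwahoriMat_mul_iff {n : ℕ} (k : IntMat F n) (k' : GL (Fin n) 𝒪[F])
    (hk' : k' ∈ iwahoriInt F n) :
    IsIwahoriMat (Matrix.of.symm (Matrix.of k * (k' : Matrix (Fin n) (Fin n) 𝒪[F]))) ↔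
      IsIwahoriMat k := by
  have hu := isUnit_det_coe k'
  have hdet : IsUnit (Matrix.of (Matrix.of.symm
      (Matrix.of k * (k' : Matrix (Fin n) (Fin n) 𝒪[F])))).det ↔
      IsUnit (Matrix.of k).det := by
    rw [Equiv.apply_symm_apply, Matrix.det_mul, IsUnit.mul_iff]
    exact and_iff_left hu
  -- Outside the unit-determinant locus `toGL` takes a default value, so membership in the group
  -- cannot be used there; both sides are then false.
  by_cases h : IsUnit (Matrix.of k).det
  · rw [← toGL_mem_iwahoriGL_iff h, ← toGL_mem_iwahoriGL_iff (hdet.2 h), toGL_mul_map h]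
    exact Subgroup.mul_mem_cancel_right _ ⟨k', hk', rfl⟩
  · exact ⟨fun h' => absurd (hdet.1 h'.isUnit_det) h, fun h' => absurd h'.isUnit_det h⟩

theorem iwahoriGL_le_intGL (n : ℕ) : iwahoriGL F n ≤ intGL F n := by
  rintro _ ⟨k, _, rfl⟩
  exact ⟨k, rfl⟩

theorem mem_iwahoriGL_of_valMat {n : ℕ} {k : IntMat F n} (hk : IsIwahoriMat k)
    {g : GL (Fin n) F} (hg : (g : Matrix (Fin n) (Fin n) F) = valMat k) : g ∈ iwahoriGL F n := by
  have : g = toGL k := Units.ext (by rw [coe_toGL hk.isUnit_det, hg])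
  rw [this]
  exact hk.toGL_mem

end Iwahori

/-! ### Openness, compactness and continuity. -/

section Topology

variable {F : Type*} [Field F] [ValuativeRel F] [TopologicalSpace F] [IsNonarchimedeanLocalField F]

theorem isClopen_isUnit : IsClopen {x : 𝒪[F] | IsUnit x} := by
  have : {x : 𝒪[F] | IsUnit x} = Subtype.val ⁻¹' {x : F | valuation F x = 1} := by
    ext x; simp [isUnit_iff_valuation_eq_one]
  rw [this]
  exact isClopen_valuation_eq_one.preimage continuous_subtype_val

theorem isClopen_maximalIdeal : IsClopen {x : 𝒪[F] | x ∈ 𝓂[F]} := by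
  have : {x : 𝒪[F] | x ∈ 𝓂[F]} = {x : 𝒪[F] | IsUnit x}ᶜ := by
    ext x; simp [IsLocalRing.mem_maximalIdeal]
  rw [this]
  exact isClopen_isUnit.compl

theorem continuous_of {n : ℕ} :
    Continuous fun k : IntMat F n => (Matrix.of k : Matrix (Fin n) (Fin n) 𝒪[F]) := continuous_id

theorem isClopen_isUnit_det (n : ℕ) : IsClopen {k : IntMat F n | IsUnit (Matrix.of k).det} :=
  isClopen_isUnit.preimage continuous_of.matrix_det

theorem continuous_valMat {n : ℕ} : Continuous (valMat : IntMat F n → _) :=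
  continuous_matrix fun i j => continuous_subtype_val.comp
    ((continuous_apply j).comp (continuous_apply i))

theorem isClopen_isIwahoriMat (n : ℕ) : IsClopen {k : IntMat F n | IsIwahoriMat k} := by
  have : {k : IntMat F n | IsIwahoriMat k} =
      (⋂ i, ⋂ j, ⋂ (_ : j < i), {k : IntMat F n | k i j ∈ 𝓂[F]}) ∩
        ⋂ i, {k : IntMat F n | IsUnit (k i i)} := by
    ext k; simp [IsIwahoriMat]
  rw [this]
  have hc : ∀ i j, Continuous fun k : IntMat F n => k i j := fun i j =>
    (continuous_apply j).comp (continuous_apply i)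
  exact (isClopen_iInter_of_finite fun i => isClopen_iInter_of_finite fun j =>
    isClopen_iInter_of_finite fun _ => isClopen_maximalIdeal.preimage (hc i j)).inter
    (isClopen_iInter_of_finite fun i => isClopen_isUnit.preimage (hc i i))

/-- The locus of unit determinant is clopen, so extension by the constant `1` is continuous. With
this default the determinant never vanishes, and the inverse is continuous by Cramer's rule. -/
theorem continuous_toGL (n : ℕ) : Continuous (toGL : IntMat F n → GL (Fin n) F) := by
  have := t2Space_localField F
  let X : IntMat F n → Matrix (Fin n) (Fin n) F :=
    fun k => if IsUnit (Matrix.of k).det then valMat k else 1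
  have hX : Continuous X :=
    continuous_ite_of_isClopen (isClopen_isUnit_det n) continuous_valMat continuous_const
  have hval : ∀ k, (toGL k : Matrix (Fin n) (Fin n) F) = X k := by
    intro k
    simp only [X]
    split_ifs with h
    · exact coe_toGL h
    · rw [toGL, dif_neg h]; rfl
  have hdet : ∀ k, (X k).det ≠ 0 := fun k => by
    rw [← hval]
    exact ((Matrix.isUnit_iff_isUnit_det _).1 (toGL k).isUnit).ne_zero
  rw [Units.continuous_iff]
  constructor
  · exact hX.congr fun k => (hval k).symm
  · have : ∀ k, ((toGL k)⁻¹ : GL (Fin n) F) = ((X k).det⁻¹ • (X k).adjugate :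
        Matrix (Fin n) (Fin n) F) := by
      intro k
      rw [Matrix.coe_units_inv, hval, Matrix.inv_def, Ring.inverse_eq_inv']
    simp only [this]
    exact (hX.matrix_det.inv₀ hdet).smul hX.matrix_adjugate

theorem isCompact_image_toGL {n : ℕ} {s : Set (IntMat F n)} (hs : IsClosed s) :
    IsCompact (toGL '' s) := hs.isCompact.image (continuous_toGL n)

theorem coe_iwahoriGL_eq_image (n : ℕ) : (iwahoriGL F n : Set (GL (Fin n) F)) =
    toGL '' {k : IntMat F n | IsIwahoriMat k} := by
  ext g
  constructor
  · rintro ⟨k, hk, rfl⟩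
    exact ⟨_, (isIwahoriMat_coe_iff k).2 hk, toGL_coe k⟩
  · rintro ⟨k, hk, rfl⟩
    exact IsIwahoriMat.toGL_mem hk

theorem isCompact_iwahoriGL (n : ℕ) : IsCompact (iwahoriGL F n : Set (GL (Fin n) F)) := by
  rw [coe_iwahoriGL_eq_image]
  exact isCompact_image_toGL (isClopen_isIwahoriMat n).isClosed

theorem mem_intGL_iff {n : ℕ} (g : GL (Fin n) F) : g ∈ intGL F n ↔
    (∀ i j, g i j ∈ 𝒪[F]) ∧ ∀ i j, (g⁻¹ : GL (Fin n) F) i j ∈ 𝒪[F] := by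
  constructor
  · rintro ⟨k, rfl⟩
    refine ⟨fun i j => (k i j).2, fun i j => ?_⟩
    rw [← map_inv]
    exact ((k⁻¹ : GL (Fin n) 𝒪[F]) i j).2
  · rintro ⟨h1, h2⟩
    have hinj : Function.Injective fun M : Matrix (Fin n) (Fin n) 𝒪[F] =>
        M.map (𝒪[F]).subtype := Matrix.map_injective Subtype.val_injective
    refine ⟨⟨Matrix.of fun i j => ⟨g i j, h1 i j⟩,
      Matrix.of fun i j => ⟨(g⁻¹ : GL (Fin n) F) i j, h2 i j⟩, ?_, ?_⟩, ?_⟩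
    · apply hinj
      simp only [Matrix.map_mul]
      rw [Matrix.map_one _ (map_zero _) (map_one _)]
      exact g.mul_inv
    · apply hinj
      simp only [Matrix.map_mul]
      rw [Matrix.map_one _ (map_zero _) (map_one _)]
      exact g.inv_mul
    · exact Units.ext rfl

theorem continuous_GL_entry {n : ℕ} (i j : Fin n) : Continuous fun g : GL (Fin n) F => g i j :=
  Units.continuous_val.matrix_elem i j

theorem isOpen_intGL (n : ℕ) : IsOpen (intGL F n : Set (GL (Fin n) F)) := by
  have : (intGL F n : Set (GL (Fin n) F)) =
      (⋂ i, ⋂ j, {g : GL (Fin n) F | g i j ∈ 𝒪[F]}) ∩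
        ⋂ i, ⋂ j, {g : GL (Fin n) F | (g⁻¹ : GL (Fin n) F) i j ∈ 𝒪[F]} := by
    ext g
    simp only [SetLike.mem_coe, mem_intGL_iff, Set.mem_inter_iff, Set.mem_iInter,
      Set.mem_ofPred_eq]
  rw [this]
  exact (isOpen_iInter_of_finite fun i => isOpen_iInter_of_finite fun j =>
    isClopen_valuation_le_one.isOpen.preimage (continuous_GL_entry i j)).inter
    (isOpen_iInter_of_finite fun i => isOpen_iInter_of_finite fun j =>
    isClopen_valuation_le_one.isOpen.preimage ((continuous_GL_entry i j).comp continuous_inv))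

theorem isOpen_iwahoriGL (n : ℕ) : IsOpen (iwahoriGL F n : Set (GL (Fin n) F)) := by
  have : (iwahoriGL F n : Set (GL (Fin n) F)) = (intGL F n : Set (GL (Fin n) F)) ∩
      ⋂ i, ⋂ j, ⋂ (_ : j < i), {g : GL (Fin n) F | valuation F (g i j) < 1} := by
    ext g
    constructor
    · rintro ⟨k, hk, rfl⟩
      refine ⟨⟨k, rfl⟩, ?_⟩
      simp only [Set.mem_iInter, Set.mem_ofPred_eq]
      intro i j hij
      exact (mem_maximalIdeal_iff_valuation_lt_one _).1 ((mem_iwahoriInt_iff k).1 hk i j hij)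
    · rintro ⟨⟨k, rfl⟩, h⟩
      simp only [Set.mem_iInter, Set.mem_ofPred_eq] at h
      exact ⟨k, (mem_iwahoriInt_iff k).2 fun i j hij =>
        (mem_maximalIdeal_iff_valuation_lt_one _).2 (h i j hij), rfl⟩
  rw [this]
  exact (isOpen_intGL n).inter (isOpen_iInter_of_finite fun i => isOpen_iInter_of_finite fun j =>
    isOpen_iInter_of_finite fun _ =>
    isClopen_valuation_lt_one.isOpen.preimage (continuous_GL_entry i j))

/-- A function on `GL_n(F)` that is right invariant under the Iwahori subgroup is continuous. -/
theorem continuous_of_iwahori_invariant {n : ℕ} {Y : Type*} [TopologicalSpace Y]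
    {w : GL (Fin n) F → Y} (hw : ∀ g, ∀ k ∈ iwahoriGL F n, w (g * k) = w g) : Continuous w := by
  refine IsLocallyConstant.continuous ((IsLocallyConstant.iff_exists_open w).2 fun g => ?_)
  refine ⟨(fun x => g⁻¹ * x) ⁻¹' (iwahoriGL F n), (isOpen_iwahoriGL n).preimage
    (continuous_const.mul continuous_id), ?_, fun x hx => ?_⟩
  · simp [one_mem]
  · have := hw g (g⁻¹ * x) hx
    rwa [mul_inv_cancel_left] at this

end Topology

/-! ### Additive Haar measure on integral matrices against multiplicative Haar measure. -/

section HaarMat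

variable {F : Type*} [Field F] [ValuativeRel F] [TopologicalSpace F] [IsNonarchimedeanLocalField F]
variable [MeasurableSpace 𝒪[F]] [BorelSpace 𝒪[F]] (η : Measure 𝒪[F]) [η.IsAddHaarMeasure]
  [IsProbabilityMeasure η]

/-- The Haar probability measure on integral matrices. -/
abbrev haarMat (n : ℕ) : Measure (IntMat F n) := Measure.pi fun _ => Measure.pi fun _ => η

instance instIsAddHaarMeasurePi (n : ℕ) :
    (Measure.pi fun _ : Fin n => η).IsAddHaarMeasure := Measure.pi.isAddHaarMeasure _

instance instIsAddHaarMeasureHaarMat (n : ℕ) : (haarMat η n).IsAddHaarMeasure :=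
  Measure.pi.isAddHaarMeasure _

/-- Uniqueness of Haar measure, with equal total masses fixing the scalar. The linear changes of
variable on integral matrices all rest on this, so only continuity and surjectivity have to be
checked for them. -/
theorem measurePreserving_addMonoidHom {G H : Type*} [AddGroup G] [TopologicalSpace G]
    [IsTopologicalAddGroup G] [MeasurableSpace G] [BorelSpace G] [AddGroup H] [TopologicalSpace H]
    [IsTopologicalAddGroup H] [CompactSpace H] [MeasurableSpace H] [BorelSpace H]
    (μ : Measure G) [μ.IsAddHaarMeasure] [IsProbabilityMeasure μ] (ν : Measure H)
    [ν.IsAddHaarMeasure] [IsProbabilityMeasure ν] (φ : G →+ H) (hφ : Continuous φ)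
    (hs : Function.Surjective φ) : MeasurePreserving φ μ ν :=
  φ.measurePreserving hφ hs (by simp)

/-- Right multiplication by an element of `GL_n(𝒪_F)` on integral matrices. -/
def mulRightMat {n : ℕ} (k : GL (Fin n) 𝒪[F]) : IntMat F n ≃ₜ IntMat F n where
  toFun x := Matrix.of.symm (Matrix.of x * (k : Matrix (Fin n) (Fin n) 𝒪[F]))
  invFun x := Matrix.of.symm
    (Matrix.of x * ((k⁻¹ : GL (Fin n) 𝒪[F]) : Matrix (Fin n) (Fin n) 𝒪[F]))
  left_inv x := by
    beta_reduce
    rw [Equiv.apply_symm_apply, Matrix.mul_assoc, ← Units.val_mul, mul_inv_cancel, Units.val_one,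
      Matrix.mul_one, Equiv.symm_apply_apply]
  right_inv x := by
    beta_reduce
    rw [Equiv.apply_symm_apply, Matrix.mul_assoc, ← Units.val_mul, inv_mul_cancel, Units.val_one,
      Matrix.mul_one, Equiv.symm_apply_apply]
  continuous_toFun := (continuous_of.matrix_mul continuous_const : Continuous fun x : IntMat F n =>
    Matrix.of x * (k : Matrix (Fin n) (Fin n) 𝒪[F]))
  continuous_invFun := (continuous_of.matrix_mul continuous_const : Continuous fun x : IntMat F n =>
    Matrix.of x * ((k⁻¹ : GL (Fin n) 𝒪[F]) : Matrix (Fin n) (Fin n) 𝒪[F]))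

theorem mulRightMat_apply {n : ℕ} (k : GL (Fin n) 𝒪[F]) (x : IntMat F n) :
    mulRightMat k x = Matrix.of.symm (Matrix.of x * (k : Matrix (Fin n) (Fin n) 𝒪[F])) := rfl

theorem measurePreserving_mulRightMat {n : ℕ} (k : GL (Fin n) 𝒪[F]) :
    MeasurePreserving (mulRightMat k) (haarMat η n) (haarMat η n) :=
  measurePreserving_addMonoidHom (haarMat η n) (haarMat η n)
    { toFun := mulRightMat k
      map_zero' := by
        rw [mulRightMat_apply]
        exact congrArg Matrix.of.symm (Matrix.zero_mul (k : Matrix (Fin n) (Fin n) 𝒪[F]))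
      map_add' := fun x y => by
        simp only [mulRightMat_apply]
        exact congrArg Matrix.of.symm (Matrix.add_mul _ _ _) }
    (mulRightMat k).continuous (mulRightMat k).surjective

theorem isUnit_det_mulRightMat_iff {n : ℕ} (k : GL (Fin n) 𝒪[F]) (x : IntMat F n) :
    IsUnit (Matrix.of (mulRightMat k x)).det ↔ IsUnit (Matrix.of x).det := by
  rw [mulRightMat_apply, Equiv.apply_symm_apply, Matrix.det_mul, IsUnit.mul_iff]
  exact and_iff_left (isUnit_det_coe k)

theorem toGL_mulRightMat {n : ℕ} (k : GL (Fin n) 𝒪[F]) {x : IntMat F n}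
    (hx : IsUnit (Matrix.of x).det) :
    toGL (mulRightMat k x) = toGL x * Matrix.GeneralLinearGroup.map (𝒪[F]).subtype k :=
  toGL_mul_map hx k

/-- The integral of a function over the Iwahori subgroup with respect to the additive Haar measure
on integral matrices. -/
def iwahoriIntegral {n : ℕ} (φ : GL (Fin n) F → ℂ) : ℂ :=
  ∫ k, (if IsIwahoriMat k then φ (toGL k) else 0) ∂(haarMat η n)

/-- The volume of `GL_n(𝒪_F)` for the additive Haar measure on integral matrices. -/
def volGL (n : ℕ) : ℝ≥0∞ := haarMat η n {k | IsUnit (Matrix.of k).det}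

/-- Integrate `φ(k g)` over `k` of unit determinant and `g` in `GL_n(𝒪)`. Left invariance of `μ`
removes `k` and right invariance of the additive measure removes `g`; Tonelli equates the two
results. Unimodularity of `GL_n` is not needed. -/
theorem volGL_smul_restrict_intGL {n : ℕ} [MeasurableSpace (GL (Fin n) F)]
    [BorelSpace (GL (Fin n) F)] (μ : Measure (GL (Fin n) F)) [μ.IsHaarMeasure]
    (hμ : μ (intGL F n : Set (GL (Fin n) F)) = 1) :
    volGL η n • μ.restrict (intGL F n) =
      ((haarMat η n).restrict {k | IsUnit (Matrix.of k).det}).map toGL := by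
  have := t2Space_GL F n
  have := locallyCompactSpace_GL F n
  have := secondCountable_GL F n
  have hU : MeasurableSet {k : IntMat F n | IsUnit (Matrix.of k).det} :=
    (isClopen_isUnit_det n).isOpen.measurableSet
  have hK : MeasurableSet (intGL F n : Set (GL (Fin n) F)) := (isOpen_intGL n).measurableSet
  have hT : Measurable (toGL : IntMat F n → GL (Fin n) F) := (continuous_toGL n).measurable
  refine Measure.ext_of_lintegral _ fun φ hφ => ?_
  rw [lintegral_map hφ hT, lintegral_smul_measure]
  have h1 : ∀ k : IntMat F n, ∫⁻ g in intGL F n, φ (toGL k * g) ∂μ = ∫⁻ g in intGL F n, φ g ∂μ := by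
    intro k
    rw [← lintegral_indicator hK, ← lintegral_indicator hK]
    refine Eq.trans ?_ (lintegral_mul_left_eq_self (μ := μ) _ (toGL k))
    refine lintegral_congr fun g => ?_
    have : toGL k * g ∈ (intGL F n : Set (GL (Fin n) F)) ↔ g ∈ (intGL F n : Set (GL (Fin n) F)) :=
      Subgroup.mul_mem_cancel_left _ (toGL_mem_intGL k)
    simp only [Set.indicator, this]
  have h2 : ∀ g ∈ intGL F n, ∫⁻ k in {k : IntMat F n | IsUnit (Matrix.of k).det},
      φ (toGL k * g) ∂(haarMat η n) =
      ∫⁻ k in {k : IntMat F n | IsUnit (Matrix.of k).det}, φ (toGL k) ∂(haarMat η n) := by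
    rintro _ ⟨g, rfl⟩
    rw [← lintegral_indicator hU, ← lintegral_indicator hU]
    refine Eq.trans ?_ ((measurePreserving_mulRightMat η g).lintegral_comp_emb
        (mulRightMat g).measurableEmbedding _)
    refine lintegral_congr fun k => ?_
    have h := isUnit_det_mulRightMat_iff g k
    simp only [Set.indicator, Set.mem_ofPred_eq, h]
    split_ifs with hk
    · rw [toGL_mulRightMat g hk]
    · rfl
  have hmeas : Measurable fun p : IntMat F n × GL (Fin n) F => φ (toGL p.1 * p.2) :=
    hφ.comp ((hT.comp measurable_fst).mul measurable_snd)
  calc volGL η n • ∫⁻ g in intGL F n, φ g ∂μ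
      = ∫⁻ k in {k : IntMat F n | IsUnit (Matrix.of k).det}, ∫⁻ g in intGL F n,
          φ (toGL k * g) ∂μ ∂(haarMat η n) := by
        simp only [h1, lintegral_const, Measure.restrict_apply MeasurableSet.univ, Set.univ_inter]
        rw [smul_eq_mul, mul_comm, volGL]
    _ = ∫⁻ g in intGL F n, ∫⁻ k in {k : IntMat F n | IsUnit (Matrix.of k).det},
          φ (toGL k * g) ∂(haarMat η n) ∂μ := lintegral_lintegral_swap hmeas.aemeasurable
    _ = ∫⁻ g in intGL F n, ∫⁻ k in {k : IntMat F n | IsUnit (Matrix.of k).det},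
          φ (toGL k) ∂(haarMat η n) ∂μ := setLIntegral_congr_fun hK h2
    _ = _ := by
        rw [lintegral_const, Measure.restrict_apply MeasurableSet.univ, Set.univ_inter, hμ, mul_one]

theorem volGL_mul_setIntegral_iwahori {n : ℕ} [MeasurableSpace (GL (Fin n) F)]
    [BorelSpace (GL (Fin n) F)] (μ : Measure (GL (Fin n) F)) [μ.IsHaarMeasure]
    (hμ : μ (intGL F n : Set (GL (Fin n) F)) = 1) {φ : GL (Fin n) F → ℂ} (hφ : Continuous φ) :
    ((volGL η n).toReal : ℂ) * ∫ g in iwahoriGL F n, φ g ∂μ = iwahoriIntegral η φ := by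
  have := secondCountable_GL F n
  have hI : MeasurableSet (iwahoriGL F n : Set (GL (Fin n) F)) := (isOpen_iwahoriGL n).measurableSet
  have hT : Measurable (toGL : IntMat F n → GL (Fin n) F) := (continuous_toGL n).measurable
  have h := congrArg (fun m => m.restrict (iwahoriGL F n : Set (GL (Fin n) F)))
    (volGL_smul_restrict_intGL η μ hμ)
  simp only [Measure.restrict_smul] at h
  rw [Measure.restrict_restrict hI, Set.inter_eq_left.2 (iwahoriGL_le_intGL n),
    Measure.restrict_map hT hI, Measure.restrict_restrict (hT hI)] at h
  have hset : toGL ⁻¹' (iwahoriGL F n : Set (GL (Fin n) F)) ∩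
      {k : IntMat F n | IsUnit (Matrix.of k).det} = {k | IsIwahoriMat k} := by
    ext k
    constructor
    · rintro ⟨h1, h2⟩
      exact (toGL_mem_iwahoriGL_iff h2).1 h1
    · intro h1
      have h1 : IsIwahoriMat k := h1
      exact ⟨h1.toGL_mem, h1.isUnit_det⟩
  rw [hset] at h
  have h2 := congrArg (fun m => ∫ g, φ g ∂m) h
  rw [integral_smul_measure, integral_map hT.aemeasurable hφ.aestronglyMeasurable,
    ← integral_indicator (isClopen_isIwahoriMat n).isOpen.measurableSet] at h2
  rw [← Complex.real_smul, h2]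
  rfl

end HaarMat

/-! ### The additive volume of the integral general linear group. -/

section Volume

variable {F : Type*} [Field F] [ValuativeRel F] [TopologicalSpace F] [IsNonarchimedeanLocalField F]
variable [MeasurableSpace 𝒪[F]] [BorelSpace 𝒪[F]] (η : Measure 𝒪[F]) [η.IsAddHaarMeasure]
  [IsProbabilityMeasure η]

theorem measure_residue_fiber (a : 𝓀[F]) :
    η {x | IsLocalRing.residue 𝒪[F] x = a} = (normP F : ℝ≥0∞)⁻¹ := by
  obtain ⟨ϖ, hϖ⟩ := IsDiscreteValuationRing.exists_irreducible 𝒪[F]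
  obtain ⟨b, rfl⟩ := IsLocalRing.residue_surjective a
  have : {x | IsLocalRing.residue 𝒪[F] x = IsLocalRing.residue 𝒪[F] b} =
      (fun x => -b + x) ⁻¹' (Ideal.span {ϖ} : Ideal 𝒪[F]) := by
    ext x
    rw [Set.mem_preimage, SetLike.mem_coe, ← hϖ.maximalIdeal_eq, neg_add_eq_sub,
      ← IsLocalRing.residue_eq_zero_iff, map_sub, sub_eq_zero]
    rfl
  rw [this, measure_preimage_add, measure_span_singleton η hϖ.ne_zero, normIdeal,
    ← hϖ.maximalIdeal_eq]
  rfl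

/-- Unit determinant is a condition modulo `𝔭`, and each fibre of reduction has measure `q^{-n²}`,
`q` being the residue cardinality. The volume is therefore the order of `GL_n` over the residue
field divided by `q^{n²}`. -/
theorem volGL_eq (n : ℕ) : ((volGL η n).toReal : ℂ) =
    ∏ k ∈ Finset.Icc 1 n, (1 - ((normP F : ℂ) ^ k)⁻¹) := by
  let : Fintype 𝓀[F] := Fintype.ofFinite _
  have hq : (normP F : ℝ) ≠ 0 := by exact_mod_cast normP_ne_zero (F := F)
  let red : IntMat F n → Matrix (Fin n) (Fin n) 𝓀[F] :=
    fun k => Matrix.of fun i j => IsLocalRing.residue 𝒪[F] (k i j)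
  have hfib : ∀ A : Matrix (Fin n) (Fin n) 𝓀[F], {k | red k = A} =
      Set.univ.pi fun i => Set.univ.pi fun j => {x | IsLocalRing.residue 𝒪[F] x = A i j} := by
    intro A
    ext k
    simp only [Set.mem_ofPred_eq, Set.mem_pi, Set.mem_univ, true_implies, ← Matrix.ext_iff]
    rfl
  have hmeasfib : ∀ A : Matrix (Fin n) (Fin n) 𝓀[F], (haarMat η n) {k | red k = A} =
      ((normP F : ℝ≥0∞)⁻¹) ^ (n * n) := by
    intro A
    rw [hfib, Measure.pi_pi]
    simp only [Measure.pi_pi, measure_residue_fiber, Finset.prod_const, Finset.card_univ,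
      Fintype.card_fin, ← pow_mul]
  have hms : ∀ A : Matrix (Fin n) (Fin n) 𝓀[F], MeasurableSet {k | red k = A} := by
    intro A
    rw [hfib]
    refine MeasurableSet.univ_pi fun i => MeasurableSet.univ_pi fun j => ?_
    obtain ⟨b, hb⟩ := IsLocalRing.residue_surjective (A i j)
    have : {x | IsLocalRing.residue 𝒪[F] x = A i j} = (fun x => x - b) ⁻¹' {x | x ∈ 𝓂[F]} := by
      ext x
      rw [Set.mem_preimage, Set.mem_ofPred_eq, Set.mem_ofPred_eq,
        ← IsLocalRing.residue_eq_zero_iff, map_sub, sub_eq_zero, hb]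
    rw [this]
    exact (isClopen_maximalIdeal.isOpen.preimage (continuous_id.sub continuous_const)).measurableSet
  have hU : {k : IntMat F n | IsUnit (Matrix.of k).det} =
      ⋃ A : GL (Fin n) 𝓀[F], {k | red k = (A : Matrix (Fin n) (Fin n) 𝓀[F])} := by
    ext k
    have hdet : (red k).det = IsLocalRing.residue 𝒪[F] (Matrix.of k).det := by
      rw [RingHom.map_det]; rfl
    rw [Set.mem_iUnion, Set.mem_ofPred_eq, ← isUnit_map_iff (IsLocalRing.residue 𝒪[F]), ← hdet,
      ← Matrix.isUnit_iff_isUnit_det]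
    exact ⟨fun ⟨u, hu⟩ => ⟨u, hu.symm⟩, fun ⟨u, hu⟩ => ⟨u, Eq.symm hu⟩⟩
  have hvol : volGL η n = (Nat.card (GL (Fin n) 𝓀[F]) : ℝ≥0∞) *
      ((normP F : ℝ≥0∞)⁻¹) ^ (n * n) := by
    rw [volGL, hU, measure_iUnion _ fun A => hms _]
    · simp only [hmeasfib, tsum_fintype, Finset.sum_const, Finset.card_univ, nsmul_eq_mul,
        Nat.card_eq_fintype_card]
    · intro A B hAB
      refine Set.disjoint_left.2 fun k hk hk' => hAB (Units.ext ?_)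
      exact (Eq.symm hk).trans hk'
  have hcard : Fintype.card 𝓀[F] = normP F := by rw [normP, Nat.card_eq_fintype_card]
  have hq1 : (normP F : ℂ) ≠ 0 := by exact_mod_cast hq
  rw [hvol, Matrix.card_GL_field, hcard, ENNReal.toReal_mul, ENNReal.toReal_pow,
    ENNReal.toReal_inv, ENNReal.toReal_natCast, ENNReal.toReal_natCast]
  push_cast [Finset.prod_congr]
  -- The truncated subtraction is genuine since `i < n`. The factors `q^n` cancel `q^{-n²}`, and the
  -- remaining exponents `n - i` are put in increasing order by reflecting the index.
  have hcast : ∀ i : Fin n, (((normP F) ^ n - (normP F) ^ (i : ℕ) : ℕ) : ℂ) =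
      (normP F : ℂ) ^ n * (1 - ((normP F : ℂ) ^ (n - i))⁻¹) := by
    intro i
    have hpos : 0 < normP F := Nat.pos_of_ne_zero (by exact_mod_cast hq)
    rw [Nat.cast_sub (Nat.pow_le_pow_right hpos i.2.le)]
    push_cast
    rw [mul_sub, mul_one, pow_sub₀ _ hq1 i.2.le, mul_inv, inv_inv, ← mul_assoc,
      mul_inv_cancel₀ (pow_ne_zero _ hq1), one_mul]
  simp only [hcast]
  rw [Finset.prod_mul_distrib, Finset.prod_const, Finset.card_univ, Fintype.card_fin, ← pow_mul,
    mul_right_comm, ← mul_pow, mul_inv_cancel₀ hq1, one_pow, one_mul,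
    Fin.prod_univ_eq_prod_range (fun i => 1 - ((normP F : ℂ) ^ (n - i))⁻¹) n,
    ← Finset.prod_range_reflect]
  have : Finset.Icc 1 n = Finset.Ico 1 (n + 1) := by
    ext; rw [Finset.mem_Icc, Finset.mem_Ico, Nat.lt_succ_iff]
  rw [this, Finset.prod_Ico_eq_prod_range]
  refine Finset.prod_congr (by simp) fun i hi => ?_
  have := Finset.mem_range.1 hi
  congr 3
  omega

end Volume

/-! ### The part of the integrand that varies on Iwahori cosets. -/

section BirchFun

variable {F : Type*} [Field F] [ValuativeRel F] [TopologicalSpace F] [IsNonarchimedeanLocalField F]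

variable (F) in
/-- The last standard basis vector, as a row. -/
def lastVec (n : ℕ) : Fin n → F := fun i => if (i : ℕ) + 1 = n then 1 else 0

theorem lam_eq_sum (n : ℕ) (f : Fˣ) (M : Matrix (Fin n) (Fin n) F) :
    lam n f M = ∑ i, (lastVec F n ᵥ* M) i * ((f ^ ((i : ℤ) - n) : Fˣ) : F) := by
  unfold lam
  rw [Matrix.dotProduct_mulVec]
  rfl

theorem continuous_lam (n : ℕ) (f : Fˣ) : Continuous (lam n f : Matrix (Fin n) (Fin n) F → F) := by
  unfold lam
  exact (continuous_const.dotProduct (continuous_id.matrix_mulVec continuous_const))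

/-- The factor `w(j(g D_n w_n)) χ(det g)` of the zeta integrand. -/
def whittakerFactor {n m : ℕ} (h : n ≤ m) (w : GL (Fin m) F → ℂ) (χ : Fˣ →* ℂˣ) (f : Fˣ)
    (g : GL (Fin n) F) : ℂ :=
  w (embGL h (g * matD n f * longestWeyl F n)) * (χ (Matrix.GeneralLinearGroup.det g) : ℂ)

/-- The part `ψ(λ_n(g)) w(j(g D_n w_n)) χ(det g)` of the zeta integrand. -/
def birchFun {n m : ℕ} (h : n ≤ m) (ψ : AddChar F ℂ) (w : GL (Fin m) F → ℂ) (χ : Fˣ →* ℂˣ) (f : Fˣ)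
    (g : GL (Fin n) F) : ℂ :=
  whittakerFactor h w χ f g * ψ (lam n f (g : Matrix (Fin n) (Fin n) F))

theorem embGL_mem_iwahoriGL {n m : ℕ} (h : n ≤ m) {k : GL (Fin n) F} (hk : k ∈ iwahoriGL F n) :
    embGL h k ∈ iwahoriGL F m := by
  have hint : embGL h k ∈ intGL F m := by
    have h1 := (mem_intGL_iff k).1 (iwahoriGL_le_intGL n hk)
    rw [mem_intGL_iff, ← map_inv]
    constructor <;>
    · intro i j
      rw [embGL_apply]
      split_ifs with h2 h3
      · first | exact h1.1 _ _ | exact h1.2 _ _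
      · exact one_mem _
      · exact zero_mem _
  obtain ⟨k', hk', rfl⟩ := hk
  obtain ⟨K, hK⟩ := hint
  refine ⟨K, (mem_iwahoriInt_iff K).2 fun i j hij => ?_, hK⟩
  rw [mem_maximalIdeal_iff_valuation_lt_one]
  have h2 : ((K i j : 𝒪[F]) : F) = embGL h (Matrix.GeneralLinearGroup.map (𝒪[F]).subtype k') i j := by
    rw [← hK]; rfl
  rw [h2, embGL_apply]
  split_ifs with h3 h4
  · exact (mem_maximalIdeal_iff_valuation_lt_one _).1 ((mem_iwahoriInt_iff k').1 hk' _ _ hij)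
  · exact absurd h4 hij.ne'
  · rw [map_zero]; exact zero_lt_one

theorem continuous_of_isIwahoriInvariant {n : ℕ} {w : GL (Fin n) F → ℂ}
    (hw : IsIwahoriInvariant w) : Continuous w :=
  continuous_of_iwahori_invariant fun g k hk => hw g k (mem_iwahori_iff_mem.2 hk)

theorem continuous_embGL {n m : ℕ} (h : n ≤ m) :
    Continuous (embGL h : GL (Fin n) F → GL (Fin m) F) := by
  have key : ∀ a b : Fin m, Continuous fun g : GL (Fin n) F => embGL h g a b := by
    intro a b
    simp only [embGL_apply]
    split_ifs with h1 h2
    · exact continuous_GL_entry _ _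
    · exact continuous_const
    · exact continuous_const
  rw [Units.continuous_iff]
  refine ⟨continuous_matrix key, continuous_matrix fun a b => ?_⟩
  simp only [← map_inv]
  exact (key a b).comp continuous_inv

theorem diagGL_apply {n : ℕ} (d : Fin n → Fˣ) (i j : Fin n) :
    diagGL d i j = if i = j then (d i : F) else 0 := Matrix.diagonal_apply _ _ _

theorem mul_diagGL_apply {n : ℕ} (g : GL (Fin n) F) (d : Fin n → Fˣ) (i j : Fin n) :
    (g * diagGL d) i j = g i j * d j := Matrix.mul_diagonal _ _ _ _

theorem mul_permGL_apply {n : ℕ} (g : GL (Fin n) F) (σ : Equiv.Perm (Fin n)) (i j : Fin n) :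
    (g * permGL F σ) i j = g i (σ.symm j) := by
  have : ((g * permGL F σ : GL (Fin n) F) : Matrix (Fin n) (Fin n) F) =
    (g : Matrix (Fin n) (Fin n) F) * σ.toPEquiv.toMatrix := rfl
  rw [this, PEquiv.mul_toMatrix_toPEquiv]
  rfl

theorem mul_matD_mul_longestWeyl_apply {n : ℕ} (f : Fˣ) (g : GL (Fin n) F) (i j : Fin n) :
    (g * matD n f * longestWeyl F n) i j =
      g i j.rev * ((f ^ (2 * ((j.rev : Fin n) : ℤ) + 1 - n) : Fˣ) : F) := by
  unfold longestWeyl matD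
  rw [mul_permGL_apply, mul_diagGL_apply]
  rfl

/-- Diagonal matrices commute with `D_n`, and `w_n` reverses their entries. This moves a unit torus
element to the far right, where the Iwahori invariance of `w` absorbs it. -/
theorem diagGL_mul_matD_mul_longestWeyl {n : ℕ} (f : Fˣ) (g : GL (Fin n) F) (d : Fin n → Fˣ) :
    g * diagGL d * matD n f * longestWeyl F n =
      g * matD n f * longestWeyl F n * diagGL fun i => d i.rev := by
  ext i j
  rw [mul_diagGL_apply, mul_matD_mul_longestWeyl_apply, mul_matD_mul_longestWeyl_apply,
    mul_diagGL_apply]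
  ring

theorem det_diagGL {n : ℕ} (d : Fin n → Fˣ) :
    Matrix.GeneralLinearGroup.det (diagGL d) = ∏ i, d i := by
  apply Units.ext
  rw [Units.coe_prod]
  exact Matrix.det_diagonal

/-- The diagonal matrix with unit entries. -/
def diagInt {n : ℕ} (t : Fin n → (𝒪[F])ˣ) : GL (Fin n) 𝒪[F] where
  val := Matrix.diagonal fun i => (t i : 𝒪[F])
  inv := Matrix.diagonal fun i => ((t i)⁻¹ : (𝒪[F])ˣ)
  val_inv := by simp [Matrix.diagonal_mul_diagonal]
  inv_val := by simp [Matrix.diagonal_mul_diagonal]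

theorem diagInt_mem_iwahoriInt {n : ℕ} (t : Fin n → (𝒪[F])ˣ) : diagInt t ∈ iwahoriInt F n := by
  rw [mem_iwahoriInt_iff]
  intro i j hij
  change Matrix.diagonal (fun i => (t i : 𝒪[F])) i j ∈ _
  rw [Matrix.diagonal_apply_ne _ hij.ne']
  exact zero_mem _

theorem map_diagInt {n : ℕ} (t : Fin n → (𝒪[F])ˣ) :
    Matrix.GeneralLinearGroup.map (𝒪[F]).subtype (diagInt t) =
      diagGL fun i => Units.map (𝒪[F]).subtype (t i) := by
  apply Units.ext
  exact Matrix.diagonal_map (map_zero (𝒪[F]).subtype)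

theorem diagGL_mem_iwahoriGL {n : ℕ} (t : Fin n → (𝒪[F])ˣ) :
    diagGL (fun i => Units.map (𝒪[F]).subtype (t i) : Fin n → Fˣ) ∈ iwahoriGL F n :=
  ⟨_, diagInt_mem_iwahoriInt t, map_diagInt t⟩

section

variable {n m : ℕ} (h : n ≤ m) {ψ : AddChar F ℂ} {w : GL (Fin m) F → ℂ} {χ : Fˣ →* ℂˣ} (f : Fˣ)

theorem whittakerFactor_mul_diagGL (hwI : IsIwahoriInvariant w) (g : GL (Fin n) F)
    (t : Fin n → (𝒪[F])ˣ) :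
    whittakerFactor h w χ f (g * diagGL fun i => Units.map (𝒪[F]).subtype (t i)) =
      (∏ i, unitChar χ (t i)) * whittakerFactor h w χ f g := by
  unfold whittakerFactor
  rw [diagGL_mul_matD_mul_longestWeyl, map_mul (embGL h) (_ * _ * _),
    map_mul Matrix.GeneralLinearGroup.det, det_diagGL, map_mul χ, map_prod χ, Units.val_mul,
    Units.coe_prod, hwI _ _ (mem_iwahori_iff_mem.2 (embGL_mem_iwahoriGL h (diagGL_mem_iwahoriGL fun i => t i.rev)))]
  unfold unitChar
  ring

theorem birchFun_unipotent_mul (hw : IsWhittaker ψ w) {u : GL (Fin n) F} (hu : u ∈ unipotent F n)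
    (g : GL (Fin n) F) :
    birchFun h ψ w χ f (u * g) =
      psiU ψ (u : Matrix (Fin n) (Fin n) F) * birchFun h ψ w χ f g := by
  unfold birchFun whittakerFactor
  rw [lam_unipotent_mul f hu, mul_assoc u g, mul_assoc u, map_mul (embGL h) u,
    hw _ (embGL_mem_unipotent h hu), psiU_embGL,
    map_mul Matrix.GeneralLinearGroup.det u g, det_of_mem_unipotent hu, one_mul]
  ring

theorem continuous_whittakerFactor (hwI : IsIwahoriInvariant w) (hχc : Continuous χ) :
    Continuous (whittakerFactor h w χ f : GL (Fin n) F → ℂ) :=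
  ((continuous_of_isIwahoriInvariant hwI).comp ((continuous_embGL h).comp
    ((continuous_id.mul continuous_const).mul continuous_const))).mul
    (Units.continuous_val.comp (hχc.comp Matrix.GeneralLinearGroup.continuous_det))

theorem continuous_birchFun (hψc : Continuous ψ) (hwI : IsIwahoriInvariant w)
    (hχc : Continuous χ) : Continuous (birchFun h ψ w χ f : GL (Fin n) F → ℂ) :=
  (continuous_whittakerFactor h f hwI hχc).mul
    (hψc.comp ((continuous_lam n f).comp Units.continuous_val))

end

end BirchFun

/-! ### Restriction to the locus cut out by the conductor. -/

section TorusLocus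

variable {F : Type*} [Field F] [ValuativeRel F] [TopologicalSpace F] [IsNonarchimedeanLocalField F]
variable [MeasurableSpace 𝒪[F]] [BorelSpace 𝒪[F]] (η : Measure 𝒪[F]) [η.IsAddHaarMeasure]
  [IsProbabilityMeasure η]

/-- The `i`-th summand of `λ_n(g k)`. -/
def lamTerm {n : ℕ} (f : Fˣ) (g : GL (Fin n) F) (i : Fin n) (k : IntMat F n) : F :=
  (lastVec F n ᵥ* ((g : Matrix (Fin n) (Fin n) F) * valMat k)) i * ((f ^ ((i : ℤ) - n) : Fˣ) : F)

theorem continuous_lamTerm {n : ℕ} (f : Fˣ) (g : GL (Fin n) F) (i : Fin n) :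
    Continuous (lamTerm f g i) :=
  ((continuous_apply i).comp (continuous_const.matrix_vecMul
    (continuous_const.matrix_mul continuous_valMat))).mul continuous_const

theorem valMat_mulRightMat {n : ℕ} (k : GL (Fin n) 𝒪[F]) (x : IntMat F n) :
    valMat (mulRightMat k x) = valMat x *
      (Matrix.GeneralLinearGroup.map (𝒪[F]).subtype k : Matrix (Fin n) (Fin n) F) := by
  rw [valMat_eq_map, mulRightMat_apply, Equiv.apply_symm_apply, Matrix.map_mul]
  rfl

theorem lamTerm_mulRightMat_diagInt {n : ℕ} (f : Fˣ) (g : GL (Fin n) F) (i : Fin n)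
    (t : Fin n → (𝒪[F])ˣ) (k : IntMat F n) :
    lamTerm f g i (mulRightMat (diagInt t) k) = ((t i : 𝒪[F]) : F) * lamTerm f g i k := by
  unfold lamTerm
  rw [valMat_mulRightMat, map_diagInt, ← Matrix.mul_assoc, ← Matrix.vecMul_vecMul]
  have : ((diagGL fun i => Units.map (𝒪[F]).subtype (t i) : GL (Fin n) F) :
    Matrix (Fin n) (Fin n) F) = Matrix.diagonal fun i => ((t i : 𝒪[F]) : F) := rfl
  rw [this, Matrix.vecMul_diagonal]
  ring

theorem psi_lam_eq_prod {n : ℕ} (ψ : AddChar F ℂ) (f : Fˣ) (g : GL (Fin n) F) {k : IntMat F n}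
    (hk : IsUnit (Matrix.of k).det) :
    ψ (lam n f ((g * toGL k : GL (Fin n) F) : Matrix (Fin n) (Fin n) F)) =
      ∏ i, ψ (lamTerm f g i k) := by
  rw [lam_eq_sum, Units.val_mul, coe_toGL hk]
  exact map_prod ψ.toMonoidHom (fun i => Multiplicative.ofAdd (lamTerm f g i k)) Finset.univ

/-- The matrices `k` for which all coordinates of the last row of `g k` have the valuation
required by the conductor. -/
def IsAdapted {n : ℕ} (f : Fˣ) (g : GL (Fin n) F) (k : IntMat F n) : Prop :=
  ∀ i, valuation F (lamTerm f g i k * f) = 1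

/-- Scaling the `i`-th column of `k` by a unit changes only the `i`-th summand of `λ_n(g k)` and
multiplies the Whittaker factor by `χ` of that unit. Orthogonality thus applies to one coordinate at
a time. -/
theorem iwahoriIntegral_birchFun_eq_adapted {n m : ℕ} (h : n ≤ m) {ψ : AddChar F ℂ}
    (hψc : Continuous ψ) (hψ : HasConductorIntegers ψ) {w : GL (Fin m) F → ℂ}
    (hwI : IsIwahoriInvariant w) {χ : Fˣ →* ℂˣ} (hχc : Continuous χ) {f : 𝒪[F]} (hf0 : f ≠ 0)
    (hf : ¬ IsUnit f) (hχ : HasConductor χ (Ideal.span {f})) (g : GL (Fin n) F) :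
    iwahoriIntegral η (fun k => birchFun h ψ w χ (toUnit f hf0) (g * k)) =
      ∫ k, (if IsAdapted (toUnit f hf0) g k then
        (if IsIwahoriMat k then birchFun h ψ w χ (toUnit f hf0) (g * toGL k) else 0) else 0)
        ∂(haarMat η n) := by
  set fU := toUnit f hf0 with hfU
  let P : IntMat F n → ℂ := fun k =>
    if IsIwahoriMat k then whittakerFactor h w χ fU (g * toGL k) else 0
  have hP : Continuous P := continuous_ite_of_isClopen (isClopen_isIwahoriMat n)
    ((continuous_whittakerFactor h fU hwI hχc).comp (continuous_const.mul (continuous_toGL n)))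
    continuous_const
  have hQ : ∀ k, (if IsIwahoriMat k then birchFun h ψ w χ fU (g * toGL k) else 0) =
      P k * ∏ i, ψ (lamTerm fU g i k) := by
    intro k
    simp only [P]
    split_ifs with hk
    · rw [birchFun, psi_lam_eq_prod ψ fU g hk.isUnit_det]
    · rw [zero_mul]
  have hPτ : ∀ (t : Fin n → (𝒪[F])ˣ) k,
      P (mulRightMat (diagInt t) k) = (∏ i, unitChar χ (t i)) * P k := by
    intro t k
    have hbox := isIwahoriMat_mul_iff k (diagInt t) (diagInt_mem_iwahoriInt t)
    rw [← mulRightMat_apply] at hbox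
    simp only [P, hbox]
    split_ifs with hk
    · rw [toGL_mulRightMat _ hk.isUnit_det, map_diagInt, ← mul_assoc,
        whittakerFactor_mul_diagGL h fU hwI]
    · rw [mul_zero]
  have hcl : ∀ i, IsClopen {k | valuation F (lamTerm fU g i k * fU) = 1} := fun i =>
    isClopen_valuation_eq_one.preimage ((continuous_lamTerm fU g i).mul continuous_const)
  have hclA : ∀ A : Finset (Fin n),
      IsClopen {k | ∀ i ∈ A, valuation F (lamTerm fU g i k * fU) = 1} := by
    intro A
    have : {k | ∀ i ∈ A, valuation F (lamTerm fU g i k * fU) = 1} =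
        ⋂ i, ⋂ (_ : i ∈ A), {k | valuation F (lamTerm fU g i k * fU) = 1} := by
      ext k; simp only [Set.mem_iInter, Set.mem_ofPred_eq]
    rw [this]
    exact isClopen_iInter_of_finite fun i => isClopen_iInter_of_finite fun _ => hcl i
  -- `A` is the set of coordinates on which the unit condition has already been imposed.
  have key : ∀ A : Finset (Fin n), ∫ k, P k * ∏ i, ψ (lamTerm fU g i k) ∂(haarMat η n) =
      ∫ k, (if ∀ i ∈ A, valuation F (lamTerm fU g i k * fU) = 1 then P k else 0) *
        ∏ i, ψ (lamTerm fU g i k) ∂(haarMat η n) := by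
    intro A
    induction A using Finset.induction_on with
    | empty => simp
    | insert i₀ A hi₀ ih =>
      rw [ih]
      -- Everything except `ψ` of the `i₀`-th summand. The conditions already imposed survive the
      -- torus action because units preserve valuations.
      let Φ : IntMat F n → ℂ := fun k =>
        (if ∀ i ∈ A, valuation F (lamTerm fU g i k * fU) = 1 then P k else 0) *
          ∏ i ∈ Finset.univ.erase i₀, ψ (lamTerm fU g i k)
      have hΦ : Continuous Φ := (continuous_ite_of_isClopen (hclA A) hP continuous_const).mul
        (continuous_finsetProd _ fun i _ => hψc.comp (continuous_lamTerm fU g i))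
      let t : (𝒪[F])ˣ → Fin n → (𝒪[F])ˣ := fun u => Function.update 1 i₀ u
      have hti₀ : ∀ u, t u i₀ = u := fun u => Function.update_self _ _ _
      have hti : ∀ u i, i ≠ i₀ → t u i = 1 := fun u i hi => Function.update_of_ne hi _ _
      have hprod : ∀ u, ∏ i, unitChar χ (t u i) = unitChar χ u := by
        intro u
        rw [Finset.prod_eq_single i₀, hti₀]
        · intro i _ hi
          rw [hti u i hi, unitChar_one]
        · simp
      have hΦτ : ∀ u k, Φ (mulRightMat (diagInt (t u)) k) = unitChar χ u * Φ k := by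
        intro u k
        have h1 : ∀ i, valuation F (lamTerm fU g i (mulRightMat (diagInt (t u)) k) * fU) =
            valuation F (lamTerm fU g i k * fU) := by
          intro i
          rw [lamTerm_mulRightMat_diagInt, mul_assoc, map_mul, valuation_unit, one_mul]
        have h2 : ∏ i ∈ Finset.univ.erase i₀, ψ (lamTerm fU g i (mulRightMat (diagInt (t u)) k)) =
            ∏ i ∈ Finset.univ.erase i₀, ψ (lamTerm fU g i k) := by
          refine Finset.prod_congr rfl fun i hi => ?_
          rw [lamTerm_mulRightMat_diagInt, hti u i (Finset.ne_of_mem_erase hi), Units.val_one,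
            Subring.coe_one, one_mul]
        simp only [Φ, h1, h2, hPτ, hprod]
        split_ifs
        · ring
        · ring
      have hmain := integral_mul_psi_eq_integral_unit_locus (haarMat η n) hψc hψ hf0 hf hχ
        (fun u => mulRightMat (diagInt (t u))) (fun u => measurePreserving_mulRightMat η _) hΦ hΦτ
        (continuous_lamTerm fU g i₀)
        (fun u k => by rw [lamTerm_mulRightMat_diagInt, hti₀])
      have hsplit : ∀ k, ∏ i, ψ (lamTerm fU g i k) =
          (∏ i ∈ Finset.univ.erase i₀, ψ (lamTerm fU g i k)) * ψ (lamTerm fU g i₀ k) := fun k =>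
        (Finset.prod_erase_mul _ _ (Finset.mem_univ i₀)).symm
      refine Eq.trans (integral_congr_ae (Filter.Eventually.of_forall fun k => ?_))
        (hmain.trans (integral_congr_ae (Filter.Eventually.of_forall fun k => ?_)))
      · simp only [Φ, hsplit]
        ring
      · simp only [Φ, hsplit, Finset.forall_mem_insert]
        have hfe : ((fU : Fˣ) : F) = f := rfl
        rw [hfe]
        by_cases h1 : valuation F (lamTerm fU g i₀ k * f) = 1
        · simp only [h1, true_and, if_true]
          ring
        · simp only [h1, false_and, if_false, zero_mul]
  unfold iwahoriIntegral
  refine Eq.trans (integral_congr_ae (Filter.Eventually.of_forall hQ))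
    ((key Finset.univ).trans (integral_congr_ae (Filter.Eventually.of_forall fun k => ?_)))
  simp only [hQ, IsAdapted, Finset.mem_univ, true_implies]
  split_ifs
  · rfl
  · rw [zero_mul]

end TorusLocus

/-! ### Block matrices with a scalar lower right corner. -/

section BlockMat

variable {R : Type*} {n : ℕ}

/-- The square matrix with blocks `H`, `y`, `r`, `d`, where `d` is a scalar. -/
def blockMat (H : Matrix (Fin n) (Fin n) R) (y r : Fin n → R) (d : R) :
    Matrix (Fin (n + 1)) (Fin (n + 1)) R :=
  Matrix.of fun i j => Fin.lastCases (motive := fun _ => R)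
    (Fin.lastCases (motive := fun _ => R) d r j)
    (fun i => Fin.lastCases (motive := fun _ => R) (y i) (fun j => H i j) j) i

section

variable (H : Matrix (Fin n) (Fin n) R) (y r : Fin n → R) (d : R)

@[simp] theorem blockMat_castSucc_castSucc (i j : Fin n) :
    blockMat H y r d i.castSucc j.castSucc = H i j := by simp [blockMat]

@[simp] theorem blockMat_castSucc_last (i : Fin n) :
    blockMat H y r d i.castSucc (Fin.last n) = y i := by simp [blockMat]

@[simp] theorem blockMat_last_castSucc (j : Fin n) :
    blockMat H y r d (Fin.last n) j.castSucc = r j := by simp [blockMat]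

@[simp] theorem blockMat_last_last : blockMat H y r d (Fin.last n) (Fin.last n) = d := by
  simp [blockMat]

end

theorem blockMat_ext {M N : Matrix (Fin (n + 1)) (Fin (n + 1)) R}
    (h1 : ∀ i j : Fin n, M i.castSucc j.castSucc = N i.castSucc j.castSucc)
    (h2 : ∀ i : Fin n, M i.castSucc (Fin.last n) = N i.castSucc (Fin.last n))
    (h3 : ∀ j : Fin n, M (Fin.last n) j.castSucc = N (Fin.last n) j.castSucc)
    (h4 : M (Fin.last n) (Fin.last n) = N (Fin.last n) (Fin.last n)) : M = N := by
  ext i j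
  induction i using Fin.lastCases with
  | last => induction j using Fin.lastCases with
    | last => exact h4
    | cast j => exact h3 j
  | cast i => induction j using Fin.lastCases with
    | last => exact h2 i
    | cast j => exact h1 i j

variable [CommRing R]

theorem blockMat_mul_blockMat (H H' : Matrix (Fin n) (Fin n) R) (y y' : Fin n → R) (d d' : R) :
    blockMat H y 0 d * blockMat H' y' 0 d' =
      blockMat (H * H') (H *ᵥ y' + d' • y) 0 (d * d') := by
  apply blockMat_ext <;> intros <;>
    simp [Matrix.mul_apply, Fin.sum_univ_castSucc, Matrix.mulVec, dotProduct, mul_comm]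

theorem blockMat_one : blockMat (1 : Matrix (Fin n) (Fin n) R) 0 0 1 = 1 := by
  apply blockMat_ext
  · intro i j
    rw [blockMat_castSucc_castSucc]
    simp [Matrix.one_apply]
  · intro i
    rw [blockMat_castSucc_last, Matrix.one_apply_ne (Fin.castSucc_lt_last i).ne, Pi.zero_apply]
  · intro j
    rw [blockMat_last_castSucc, Matrix.one_apply_ne (Fin.castSucc_lt_last j).ne', Pi.zero_apply]
  · simp

/-- The unipotent matrix with last column `(x, 1)`. -/
def uniGL (x : Fin n → R) : GL (Fin (n + 1)) R where
  val := blockMat 1 x 0 1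
  inv := blockMat 1 (-x) 0 1
  val_inv := by rw [blockMat_mul_blockMat]; simp [blockMat_one]
  inv_val := by rw [blockMat_mul_blockMat]; simp [blockMat_one]

theorem coe_uniGL (x : Fin n → R) :
    (uniGL x : Matrix (Fin (n + 1)) (Fin (n + 1)) R) = blockMat 1 x 0 1 := rfl

theorem uniGL_mul_castSucc (x : Fin n → R) (M : Matrix (Fin (n + 1)) (Fin (n + 1)) R) (i : Fin n)
    (j : Fin (n + 1)) :
    (blockMat 1 x 0 1 * M) i.castSucc j = M i.castSucc j + x i * M (Fin.last n) j := by
  simp [Matrix.mul_apply, Fin.sum_univ_castSucc, Matrix.one_apply]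

theorem uniGL_mul_last (x : Fin n → R) (M : Matrix (Fin (n + 1)) (Fin (n + 1)) R)
    (j : Fin (n + 1)) : (blockMat 1 x 0 1 * M) (Fin.last n) j = M (Fin.last n) j := by
  simp [Matrix.mul_apply, Fin.sum_univ_castSucc]

end BlockMat

/-! ### The embedding of rank `n` into rank `n + 1`. -/

section EmbSucc

variable {F : Type*} [Field F] {n : ℕ}

theorem coe_embGL_succ (g : GL (Fin n) F) :
    (embGL (Nat.le_succ n) g : Matrix (Fin (n + 1)) (Fin (n + 1)) F) =
      blockMat (g : Matrix (Fin n) (Fin n) F) 0 0 1 := by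
  apply blockMat_ext <;> intros <;> rw [embGL_apply] <;> simp [Fin.ext_iff]
  · omega
  · omega

theorem embGL_embGL_succ {m : ℕ} (h : n + 1 ≤ m) (g : GL (Fin n) F) :
    embGL h (embGL (Nat.le_succ n) g) = embGL ((Nat.le_succ n).trans h) g := by
  ext a b
  rw [embGL_apply, embGL_apply]
  by_cases h2 : (a : ℕ) < n ∧ (b : ℕ) < n
  · rw [dif_pos h2, dif_pos ⟨by omega, by omega⟩, embGL_apply, dif_pos h2]
  · rw [dif_neg h2]
    by_cases h1 : (a : ℕ) < n + 1 ∧ (b : ℕ) < n + 1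
    · rw [dif_pos h1, embGL_apply, dif_neg h2]
      simp [Fin.ext_iff]
    · rw [dif_neg h1]

theorem uniGL_mem_unipotent (x : Fin n → F) : uniGL x ∈ unipotent F (n + 1) := by
  constructor
  · intro i j hij
    rw [coe_uniGL]
    induction i using Fin.lastCases with
    | last => induction j using Fin.lastCases with
      | last => exact absurd hij (lt_irrefl _)
      | cast j => simp
    | cast i => induction j using Fin.lastCases with
      | last => exact absurd hij (Fin.castSucc_lt_last i).not_gt
      | cast j =>
        rw [blockMat_castSucc_castSucc]
        exact Matrix.one_apply_ne (fun h => by subst h; exact lt_irrefl _ hij)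
  · intro i
    rw [coe_uniGL]
    induction i using Fin.lastCases with
    | last => simp
    | cast i => simp

/-- The only superdiagonal entry that can be nonzero is the bottom one, the last coordinate of `x`;
for `n = 0` there is none and both sides are `1`. -/
theorem psiU_uniGL (ψ : AddChar F ℂ) (x : Fin n → F) :
    psiU ψ (uniGL x : Matrix (Fin (n + 1)) (Fin (n + 1)) F) = ψ (lastVec F n ⬝ᵥ x) := by
  rw [coe_uniGL]
  unfold psiU
  rcases n with _ | n
  · simp [dotProduct]
  · rw [Nat.add_sub_cancel, Finset.prod_range_succ, Finset.prod_eq_one, one_mul,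
      dif_pos (Nat.lt_succ_self _)]
    · congr 1
      have h1 : (⟨n, by omega⟩ : Fin (n + 2)) = (Fin.last n).castSucc := rfl
      have h2 : (⟨n + 1, by omega⟩ : Fin (n + 2)) = Fin.last (n + 1) := rfl
      rw [h1, h2, blockMat_castSucc_last]
      simp only [dotProduct, lastVec]
      rw [Fin.sum_univ_castSucc, Finset.sum_eq_zero]
      · simp
      · intro i _
        rw [if_neg, zero_mul]
        simp [i.2.ne]
    · intro i hi
      have hi' := Finset.mem_range.1 hi
      rw [dif_pos (by omega)]
      have h1 : (⟨i, by omega⟩ : Fin (n + 2)) = (⟨i, by omega⟩ : Fin (n + 1)).castSucc := rfl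
      have h2 : (⟨i + 1, by omega⟩ : Fin (n + 2)) = (⟨i + 1, by omega⟩ : Fin (n + 1)).castSucc := rfl
      rw [h1, h2, blockMat_castSucc_castSucc, Matrix.one_apply_ne (by simp),
        AddChar.map_zero_eq_one]

theorem embGL_mul_uniGL (g : GL (Fin n) F) (x : Fin n → F) :
    embGL (Nat.le_succ n) g * uniGL x =
      uniGL ((g : Matrix (Fin n) (Fin n) F) *ᵥ x) * embGL (Nat.le_succ n) g := by
  apply Units.ext
  rw [Units.val_mul, Units.val_mul, coe_uniGL, coe_uniGL, coe_embGL_succ, blockMat_mul_blockMat,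
    blockMat_mul_blockMat]
  simp

theorem det_embGL_succ (g : GL (Fin n) F) :
    Matrix.GeneralLinearGroup.det (embGL (Nat.le_succ n) g) =
      Matrix.GeneralLinearGroup.det g := by
  apply Units.ext
  change (embGL (Nat.le_succ n) g : Matrix (Fin (n + 1)) (Fin (n + 1)) F).det =
    (g : Matrix (Fin n) (Fin n) F).det
  have : (embGL (Nat.le_succ n) g : Matrix (Fin (n + 1)) (Fin (n + 1)) F) =
    Matrix.reindex (splitFin (Nat.le_succ n)) (splitFin (Nat.le_succ n))
        (Matrix.fromBlocks (g : Matrix (Fin n) (Fin n) F) 0 0 1) := rfl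
  rw [this, Matrix.det_reindex_self, Matrix.det_fromBlocks_zero₂₁, Matrix.det_one, mul_one]

end EmbSucc

/-! ### The matrix identity behind the descent. -/

section Decomposition

variable {F : Type*} [Field F] [ValuativeRel F] [TopologicalSpace F] [IsNonarchimedeanLocalField F]
variable {n : ℕ} {f : 𝒪[F]}

/-- The lower triangular matrix `(f^{i-j})_{i ≥ j}`. -/
def lowerPow (n : ℕ) (f : 𝒪[F]) : IntMat F n :=
  fun i j => if j ≤ i then f ^ ((i : ℕ) - j) else 0

/-- The lower triangular matrix with entries `-f^{i-j}` in all rows but the last, and `f^{n-j}` in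
the last. -/
def lowerPowNeg (n : ℕ) (f : 𝒪[F]) : IntMat F (n + 1) :=
  fun i j => if i = Fin.last n then f ^ (n - (j : ℕ)) else
    if j ≤ i then - f ^ ((i : ℕ) - j) else 0

theorem isIwahoriMat_lowerPow (hf : ¬ IsUnit f) : IsIwahoriMat (lowerPow n f) := by
  constructor
  · intro i j hij
    rw [lowerPow, if_pos hij.le]
    exact Ideal.pow_mem_of_mem _ hf _ (Nat.sub_pos_of_lt hij)
  · intro i
    simp [lowerPow]

theorem isIwahoriMat_lowerPowNeg (hf : ¬ IsUnit f) : IsIwahoriMat (lowerPowNeg n f) := by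
  constructor
  · intro i j hij
    unfold lowerPowNeg
    split_ifs with h
    · subst h
      exact Ideal.pow_mem_of_mem _ hf _ (Nat.sub_pos_of_lt hij)
    · exact neg_mem (Ideal.pow_mem_of_mem _ hf _ (Nat.sub_pos_of_lt hij))
    · exact zero_mem _
  · intro i
    unfold lowerPowNeg
    split_ifs with h
    · subst h; simp
    · simp
    · simp_all

theorem det_toGL_lowerPow (hf : ¬ IsUnit f) :
    Matrix.GeneralLinearGroup.det (toGL (lowerPow n f)) = 1 := by
  apply Units.ext
  change (toGL (lowerPow n f) : Matrix (Fin n) (Fin n) F).det = 1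
  rw [coe_toGL (isIwahoriMat_lowerPow hf).isUnit_det, det_valMat, ← Matrix.det_transpose,
    Matrix.det_of_isUpperTriangular]
  · simp [lowerPow]
  · intro i j hij
    simp only [Matrix.transpose_apply, Matrix.of_apply, lowerPow]
    exact if_neg (not_le.2 hij)

/-- The vector `(f^{-n}, …, f^{-1})`. -/
def invPowVec (n : ℕ) (f : Fˣ) : Fin n → F := fun k => ((f ^ ((k : ℤ) - n) : Fˣ) : F)

theorem lam_eq_dotProduct (n : ℕ) (f : Fˣ) (g : Matrix (Fin n) (Fin n) F) :
    lam n f g = lastVec F n ⬝ᵥ (g *ᵥ invPowVec n f) := rfl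

/-- Row operations prove it. With indices from `0`, the left side has entries `f^{i-c}` where `i + c
≥ n` and zeros elsewhere. Subtracting `f^{i-n}` times the last row `(f^{n-c})` from row `i` kills
the entries with `i + c ≥ n` and puts `-f^{i-c}` in the others. Divided by `f^{2i+1-n}`, this is row
`n - 1 - i` of `lowerPowNeg`. The multipliers `f^{i-n}` are the coefficients of `λ_n`, which is why
`λ_n` appears in the integrand of rank `n`. -/
theorem lowerPow_mul_matD_mul_longestWeyl (hf0 : f ≠ 0) (hf : ¬ IsUnit f) :
    toGL (lowerPow (n + 1) f) * matD (n + 1) (toUnit f hf0) * longestWeyl F (n + 1) =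
      uniGL (invPowVec n (toUnit f hf0)) *
        (embGL (Nat.le_succ n) (matD n (toUnit f hf0) * longestWeyl F n) *
          toGL (lowerPowNeg n f)) := by
  have hA : ((toGL (lowerPow (n + 1) f) : GL (Fin (n + 1)) F) : Matrix _ _ F) =
    valMat (lowerPow (n + 1) f) := coe_toGL (isIwahoriMat_lowerPow hf).isUnit_det
  have hK : ((toGL (lowerPowNeg n f) : GL (Fin (n + 1)) F) : Matrix _ _ F) =
    valMat (lowerPowNeg n f) := coe_toGL (isIwahoriMat_lowerPowNeg hf).isUnit_det
  have hf' : (f : F) ≠ 0 := by simpa using hf0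
  have hz : ∀ z : ℤ, (((toUnit f hf0) ^ z : Fˣ) : F) = (f : F) ^ z := fun z => by
    rw [Units.val_zpow_eq_zpow_val]; rfl
  have hmid : ∀ (i : Fin n) (c : Fin (n + 1)),
      ((embGL (Nat.le_succ n) (matD n (toUnit f hf0) * longestWeyl F n) *
          toGL (lowerPowNeg n f) : GL (Fin (n + 1)) F) : Matrix _ _ F) i.castSucc c =
        (f : F) ^ (2 * (i : ℤ) + 1 - n) * (lowerPowNeg n f i.rev.castSucc c : F) := by
    intro i c
    rw [Units.val_mul, coe_embGL_succ, hK, Matrix.mul_apply, Fin.sum_univ_castSucc,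
      Finset.sum_eq_single i.rev]
    · rw [blockMat_castSucc_castSucc, blockMat_castSucc_last, Pi.zero_apply, zero_mul, add_zero]
      have := mul_matD_mul_longestWeyl_apply (toUnit f hf0) (1 : GL (Fin n) F) i i.rev
      rw [one_mul, Fin.rev_rev, hz] at this
      rw [this]
      simp [valMat]
    · intro l _ hl
      rw [blockMat_castSucc_castSucc]
      have := mul_matD_mul_longestWeyl_apply (toUnit f hf0) (1 : GL (Fin n) F) i l
      rw [one_mul] at this
      rw [this, Units.val_one, Matrix.one_apply_ne (fun h => hl (by rw [h, Fin.rev_rev])), zero_mul,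
        zero_mul]
    · simp
  have hlast : ∀ c : Fin (n + 1),
      ((embGL (Nat.le_succ n) (matD n (toUnit f hf0) * longestWeyl F n) *
          toGL (lowerPowNeg n f) : GL (Fin (n + 1)) F) : Matrix _ _ F) (Fin.last n) c =
        (f : F) ^ ((n : ℤ) - c) := by
    intro c
    rw [Units.val_mul, coe_embGL_succ, hK, Matrix.mul_apply, Fin.sum_univ_castSucc]
    have hc : (c : ℕ) ≤ n := Nat.lt_succ_iff.1 c.2
    simp only [blockMat_last_castSucc, blockMat_last_last, Pi.zero_apply, zero_mul,
      Finset.sum_const_zero, zero_add, one_mul, valMat, Matrix.of_apply, lowerPowNeg, if_true]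
    rw [← Nat.cast_sub hc, zpow_natCast]
    rfl
  have hL : ∀ i c : Fin (n + 1), (toGL (lowerPow (n + 1) f) * matD (n + 1) (toUnit f hf0) *
      longestWeyl F (n + 1)) i c = if n ≤ (i : ℕ) + c then (f : F) ^ ((i : ℤ) - c) else 0 := by
    intro i c
    rw [mul_matD_mul_longestWeyl_apply, hA, hz]
    have hc : (c : ℕ) ≤ n := Nat.lt_succ_iff.1 c.2
    simp only [valMat, Matrix.of_apply, lowerPow, Fin.le_def, Fin.val_rev]
    by_cases h : n ≤ (i : ℕ) + c
    · rw [if_pos h, if_pos (by omega), SubmonoidClass.coe_pow, ← zpow_natCast, ← zpow_add₀ hf']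
      congr 1
      omega
    · rw [if_neg h, if_neg (by omega), Subring.coe_zero, zero_mul]
  apply Units.ext
  ext i c
  rw [hL, Units.val_mul, coe_uniGL]
  induction i using Fin.lastCases with
  | last =>
    rw [uniGL_mul_last, hlast, if_pos (by simp)]
    rfl
  | cast i =>
    rw [uniGL_mul_castSucc, hmid, hlast, invPowVec, hz, ← zpow_add₀ hf']
    have hc : (c : ℕ) ≤ n := Nat.lt_succ_iff.1 c.2
    simp only [lowerPowNeg, Fin.le_def, Fin.val_castSucc, Fin.val_rev,
      (Fin.castSucc_lt_last i.rev).ne, if_false]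
    by_cases h : n ≤ (i : ℕ) + c
    · rw [if_pos h, if_neg (by omega), Subring.coe_zero, mul_zero, zero_add]
      congr 1
      omega
    · rw [if_neg h, if_pos (by omega), NegMemClass.coe_neg, SubmonoidClass.coe_pow, mul_neg,
        ← zpow_natCast, ← zpow_add₀ hf', eq_comm, neg_add_eq_zero]
      congr 1
      omega

/-- The recursion for the factor `w(j(g D_n w_n)) χ(det g)`. -/
theorem whittakerFactor_uniGL_mul_embGL_mul_lowerPow {m : ℕ} (h : n + 1 ≤ m) {ψ : AddChar F ℂ}
    {w : GL (Fin m) F → ℂ} (hw : IsWhittaker ψ w) (hwI : IsIwahoriInvariant w) (χ : Fˣ →* ℂˣ)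
    (hf0 : f ≠ 0) (hf : ¬ IsUnit f) (x : Fin n → F) (g : GL (Fin n) F) :
    whittakerFactor h w χ (toUnit f hf0)
        (uniGL x * embGL (Nat.le_succ n) g * toGL (lowerPow (n + 1) f)) =
      ψ (lastVec F n ⬝ᵥ x) * birchFun ((Nat.le_succ n).trans h) ψ w χ (toUnit f hf0) g := by
  have hmat : uniGL x * embGL (Nat.le_succ n) g * toGL (lowerPow (n + 1) f) *
      matD (n + 1) (toUnit f hf0) * longestWeyl F (n + 1) =
      uniGL x * (uniGL ((g : Matrix (Fin n) (Fin n) F) *ᵥ invPowVec n (toUnit f hf0)) *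
        (embGL (Nat.le_succ n) (g * matD n (toUnit f hf0) * longestWeyl F n) *
          toGL (lowerPowNeg n f))) := by
    have h1 := lowerPow_mul_matD_mul_longestWeyl (n := n) hf0 hf
    have h2 := embGL_mul_uniGL g (invPowVec n (toUnit f hf0))
    calc _ = uniGL x * (embGL (Nat.le_succ n) g * (toGL (lowerPow (n + 1) f) *
        matD (n + 1) (toUnit f hf0) * longestWeyl F (n + 1))) := by simp only [mul_assoc]
      _ = uniGL x * ((embGL (Nat.le_succ n) g * uniGL (invPowVec n (toUnit f hf0))) *
        (embGL (Nat.le_succ n) (matD n (toUnit f hf0) * longestWeyl F n) *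
          toGL (lowerPowNeg n f))) := by rw [h1]; simp only [mul_assoc]
      _ = _ := by rw [h2]; simp only [map_mul, mul_assoc]
  have hdet : Matrix.GeneralLinearGroup.det
      (uniGL x * embGL (Nat.le_succ n) g * toGL (lowerPow (n + 1) f)) =
      Matrix.GeneralLinearGroup.det g := by
    rw [map_mul, map_mul, det_of_mem_unipotent (uniGL_mem_unipotent x), det_embGL_succ,
      det_toGL_lowerPow hf, one_mul, mul_one]
  -- Of the two unipotent factors, the first gives the character of the last coordinate of `x`, the
  -- second gives `ψ(λ_n(g))`; `lowerPowNeg` disappears by Iwahori invariance.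
  rw [whittakerFactor, hdet, hmat, map_mul (embGL h), map_mul (embGL h), map_mul (embGL h),
    hw _ (embGL_mem_unipotent h (uniGL_mem_unipotent _)),
    hw _ (embGL_mem_unipotent h (uniGL_mem_unipotent _)), psiU_embGL, psiU_embGL,
    hwI _ _ (mem_iwahori_iff_mem.2 (embGL_mem_iwahoriGL h
      (isIwahoriMat_lowerPowNeg hf).toGL_mem)), psiU_uniGL, psiU_uniGL, embGL_embGL_succ,
    birchFun, whittakerFactor, lam_eq_dotProduct]
  ring

end Decomposition

/-! ### The recursion from rank `n + 1` to rank `n`. -/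

section Recursion

variable {F : Type*} [Field F] [ValuativeRel F] [TopologicalSpace F] [IsNonarchimedeanLocalField F]
variable [MeasurableSpace 𝒪[F]] [BorelSpace 𝒪[F]] (η : Measure 𝒪[F]) [η.IsAddHaarMeasure]
  [IsProbabilityMeasure η] {n : ℕ}

/-- The integral matrix with last row `p.1` and remaining rows `p.2`. -/
def glueRows (p : (Fin (n + 1) → 𝒪[F]) × (Fin n → Fin (n + 1) → 𝒪[F])) : IntMat F (n + 1) :=
  fun i => Fin.lastCases (motive := fun _ => Fin (n + 1) → 𝒪[F]) p.1 p.2 i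

@[simp] theorem glueRows_last (p : (Fin (n + 1) → 𝒪[F]) × (Fin n → Fin (n + 1) → 𝒪[F])) :
    glueRows p (Fin.last n) = p.1 := by simp [glueRows]

@[simp] theorem glueRows_castSucc (p : (Fin (n + 1) → 𝒪[F]) × (Fin n → Fin (n + 1) → 𝒪[F]))
    (i : Fin n) : glueRows p i.castSucc = p.2 i := by simp [glueRows]

theorem continuous_glueRows : Continuous (glueRows (F := F) (n := n)) := by
  refine continuous_pi fun i => ?_
  induction i using Fin.lastCases with
  | last => simpa only [glueRows_last] using continuous_fst
  | cast i =>
    simp only [glueRows_castSucc]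
    exact (continuous_apply i).comp continuous_snd

theorem measurePreserving_glueRows :
    MeasurePreserving (glueRows (F := F) (n := n))
      ((Measure.pi fun _ : Fin (n + 1) => η).prod
        (Measure.pi fun _ : Fin n => Measure.pi fun _ : Fin (n + 1) => η)) (haarMat η (n + 1)) := by
  have : (Measure.pi fun _ : Fin n => Measure.pi fun _ : Fin (n + 1) => η).IsAddHaarMeasure :=
    Measure.pi.isAddHaarMeasure _
  refine measurePreserving_addMonoidHom _ (haarMat η (n + 1))
    { toFun := glueRows
      map_zero' := ?_
      map_add' := fun p q => ?_ } continuous_glueRows fun k => ?_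
  · funext i
    induction i using Fin.lastCases with
    | last => rw [glueRows_last]; rfl
    | cast i => rw [glueRows_castSucc]; rfl
  · funext i
    induction i using Fin.lastCases with
    | last => simp only [glueRows_last, Pi.add_apply, Prod.fst_add]
    | cast i => simp only [glueRows_castSucc, Pi.add_apply, Prod.snd_add]
  · refine ⟨(k (Fin.last n), fun i => k i.castSucc), ?_⟩
    funext i
    induction i using Fin.lastCases with
    | last => exact glueRows_last _
    | cast i => exact glueRows_castSucc _ i

/-- Scaling of the columns of a rectangular matrix. -/
theorem measurePreserving_scaleColumns {k : ℕ} (t : Fin n → (𝒪[F])ˣ) :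
    MeasurePreserving (fun (T : Fin k → Fin n → 𝒪[F]) i j => T i j * (t j : 𝒪[F]))
      (Measure.pi fun _ : Fin k => Measure.pi fun _ : Fin n => η)
      (Measure.pi fun _ : Fin k => Measure.pi fun _ : Fin n => η) := by
  have : (Measure.pi fun _ : Fin k => Measure.pi fun _ : Fin n => η).IsAddHaarMeasure :=
    Measure.pi.isAddHaarMeasure _
  refine measurePreserving_addMonoidHom _ _
    { toFun := fun (T : Fin k → Fin n → 𝒪[F]) i j => T i j * (t j : 𝒪[F])
      map_zero' := by funext i j; simp
      map_add' := fun p q => by funext i j; simp [add_mul] } ?_ fun T => ?_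
  · refine continuous_pi fun i => continuous_pi fun j => ?_
    change Continuous fun T : Fin k → Fin n → 𝒪[F] => T i j * (t j : 𝒪[F])
    exact ((continuous_apply j).comp (continuous_apply (A := fun _ : Fin k => Fin n → 𝒪[F]) i)).mul
      continuous_const
  · refine ⟨fun i j => T i j * ((t j)⁻¹ : (𝒪[F])ˣ), ?_⟩
    funext i j
    exact Units.inv_mul_cancel_right _ _

theorem glueRows_scaleColumns (t : Fin (n + 1) → (𝒪[F])ˣ) (R : Fin (n + 1) → 𝒪[F])
    (T : Fin n → Fin (n + 1) → 𝒪[F]) :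
    glueRows (fun j => R j * (t j : 𝒪[F]), fun i j => T i j * (t j : 𝒪[F])) =
      mulRightMat (diagInt t) (glueRows (R, T)) := by
  rw [mulRightMat_apply]
  have : ((diagInt t : GL (Fin (n + 1)) 𝒪[F]) : Matrix (Fin (n + 1)) (Fin (n + 1)) 𝒪[F]) =
    Matrix.diagonal fun i => (t i : 𝒪[F]) := rfl
  rw [this]
  funext i j
  rw [Matrix.of_symm_apply, Matrix.mul_diagonal, Matrix.of_apply]
  induction i using Fin.lastCases with
  | last => rw [glueRows_last, glueRows_last]
  | cast i => rw [glueRows_castSucc, glueRows_castSucc]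

/-- The upper rows of the product of `(H, y; 0, 1)` with `A`. -/
def upperRows (A : GL (Fin (n + 1)) 𝒪[F]) (p : IntMat F n × (Fin n → 𝒪[F])) :
    Fin n → Fin (n + 1) → 𝒪[F] :=
  fun i j => (blockMat (Matrix.of p.1) p.2 0 1 *
    (A : Matrix (Fin (n + 1)) (Fin (n + 1)) 𝒪[F])) i.castSucc j

theorem upperRows_apply (A : GL (Fin (n + 1)) 𝒪[F]) (p : IntMat F n × (Fin n → 𝒪[F])) (i : Fin n)
    (j : Fin (n + 1)) :
    upperRows A p i j = ∑ l, p.1 i l * A l.castSucc j + p.2 i * A (Fin.last n) j := by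
  simp [upperRows, Matrix.mul_apply, Fin.sum_univ_castSucc]

/-- With the last row fixed to be that of `A`, the upper rows are parametrized by the block matrices
`(H, y; 0, 1)`. -/
theorem glueRows_upperRows (A : GL (Fin (n + 1)) 𝒪[F]) (p : IntMat F n × (Fin n → 𝒪[F])) :
    glueRows (fun j => A (Fin.last n) j, upperRows A p) =
      mulRightMat A (Matrix.of.symm (blockMat (Matrix.of p.1) p.2 0 1)) := by
  rw [mulRightMat_apply, Equiv.apply_symm_apply]
  funext i j
  rw [Matrix.of_symm_apply]
  induction i using Fin.lastCases with
  | last =>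
    rw [glueRows_last]
    simp [Matrix.mul_apply, Fin.sum_univ_castSucc]
  | cast i => rw [glueRows_castSucc]; rfl

theorem upperRows_surjective (A : GL (Fin (n + 1)) 𝒪[F]) :
    Function.Surjective (upperRows (n := n) A) := by
  intro T
  let B : Matrix (Fin (n + 1)) (Fin (n + 1)) 𝒪[F] :=
    Matrix.of (glueRows (fun j => A (Fin.last n) j, T)) *
      ((A⁻¹ : GL (Fin (n + 1)) 𝒪[F]) : Matrix (Fin (n + 1)) (Fin (n + 1)) 𝒪[F])
  have hB : B * (A : Matrix (Fin (n + 1)) (Fin (n + 1)) 𝒪[F]) =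
      Matrix.of (glueRows (fun j => A (Fin.last n) j, T)) := by
    rw [Matrix.mul_assoc, Units.inv_mul, Matrix.mul_one]
  have hlast : ∀ j, B (Fin.last n) j = (1 : Matrix (Fin (n + 1)) (Fin (n + 1)) 𝒪[F]) (Fin.last n) j := by
    intro j
    rw [← Units.mul_inv A]
    simp only [B]
    rw [Matrix.mul_apply, Matrix.mul_apply]
    refine Finset.sum_congr rfl fun l _ => ?_
    rw [Matrix.of_apply, glueRows_last]
  refine ⟨(fun i j => B i.castSucc j.castSucc, fun i => B i.castSucc (Fin.last n)), ?_⟩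
  have hblock : blockMat (Matrix.of fun i j => B i.castSucc j.castSucc)
      (fun i => B i.castSucc (Fin.last n)) 0 1 = B := by
    apply blockMat_ext
    · simp
    · simp
    · intro j
      rw [hlast, blockMat_last_castSucc, Matrix.one_apply_ne (Fin.castSucc_lt_last j).ne',
        Pi.zero_apply]
    · rw [hlast]; simp
  funext i j
  rw [upperRows, hblock, hB, Matrix.of_apply, glueRows_castSucc]

theorem measurePreserving_upperRows (A : GL (Fin (n + 1)) 𝒪[F]) :
    MeasurePreserving (upperRows (n := n) A)
      ((haarMat η n).prod (Measure.pi fun _ : Fin n => η))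
      (Measure.pi fun _ : Fin n => Measure.pi fun _ : Fin (n + 1) => η) := by
  have : (Measure.pi fun _ : Fin n => Measure.pi fun _ : Fin (n + 1) => η).IsAddHaarMeasure :=
    Measure.pi.isAddHaarMeasure _
  refine measurePreserving_addMonoidHom _ _
    { toFun := upperRows A
      map_zero' := by funext i j; simp [upperRows_apply]
      map_add' := fun p q => by
        funext i j
        simp only [upperRows_apply, Pi.add_apply, Prod.fst_add, Prod.snd_add, add_mul,
          Finset.sum_add_distrib]
        ring } ?_ (upperRows_surjective A)
  refine continuous_pi fun i => continuous_pi fun j => ?_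
  change Continuous fun p => upperRows A p i j
  simp only [upperRows_apply]
  exact (continuous_finsetSum _ fun l _ => ((continuous_apply l).comp ((continuous_apply i).comp
    continuous_fst)).mul continuous_const).add
    (((continuous_apply i).comp continuous_snd).mul continuous_const)

theorem isIwahoriMat_blockMat_iff (H : IntMat F n) (y : Fin n → 𝒪[F]) :
    IsIwahoriMat (Matrix.of.symm (blockMat (Matrix.of H) y 0 1)) ↔ IsIwahoriMat H := by
  constructor
  · rintro ⟨h1, h2⟩
    refine ⟨fun i j hij => ?_, fun i => ?_⟩
    · simpa using h1 i.castSucc j.castSucc (Fin.castSucc_lt_castSucc_iff.2 hij)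
    · simpa using h2 i.castSucc
  · rintro ⟨h1, h2⟩
    refine ⟨fun i j hij => ?_, fun i => ?_⟩
    · rw [Matrix.of_symm_apply]
      induction i using Fin.lastCases with
      | last => induction j using Fin.lastCases with
        | last => exact absurd hij (lt_irrefl _)
        | cast j => simp
      | cast i => induction j using Fin.lastCases with
        | last => exact absurd hij (Fin.castSucc_lt_last i).not_gt
        | cast j =>
          rw [blockMat_castSucc_castSucc]
          exact h1 i j (Fin.castSucc_lt_castSucc_iff.1 hij)
    · rw [Matrix.of_symm_apply]
      induction i using Fin.lastCases with
      | last => simp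
      | cast i => rw [blockMat_castSucc_castSucc]; exact h2 i

theorem toGL_blockMat {H : IntMat F n} (hH : IsIwahoriMat H) (y : Fin n → 𝒪[F]) :
    toGL (Matrix.of.symm (blockMat (Matrix.of H) y 0 1)) =
      uniGL (fun i => (y i : F)) * embGL (Nat.le_succ n) (toGL H) := by
  apply Units.ext
  rw [coe_toGL ((isIwahoriMat_blockMat_iff H y).2 hH).isUnit_det, Units.val_mul, coe_uniGL,
    coe_embGL_succ, blockMat_mul_blockMat, coe_toGL hH.isUnit_det]
  apply blockMat_ext <;> intros <;> simp [valMat]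

theorem lastVec_vecMul (M : Matrix (Fin (n + 1)) (Fin (n + 1)) F) (i : Fin (n + 1)) :
    (lastVec F (n + 1) ᵥ* M) i = M (Fin.last n) i := by
  have h : ∀ l : Fin n, lastVec F (n + 1) l.castSucc = 0 := fun l => by
    simp [lastVec, l.2.ne]
  have h' : lastVec F (n + 1) (Fin.last n) = 1 := by simp [lastVec]
  simp [Matrix.vecMul, dotProduct, Fin.sum_univ_castSucc, h, h']

/-- The last row of the embedded matrix is the last basis vector, so `λ` sees only the last row of
the integral matrix. The exponent is the one in `gaussFun` at level `n - i`. -/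
theorem lamTerm_embGL_glueRows {f : 𝒪[F]} (hf0 : f ≠ 0) (g : GL (Fin n) F) (i : Fin (n + 1))
    (p : (Fin (n + 1) → 𝒪[F]) × (Fin n → Fin (n + 1) → 𝒪[F])) :
    lamTerm (toUnit f hf0) (embGL (Nat.le_succ n) g) i (glueRows p) =
      (p.1 i : F) / (f : F) ^ (n - (i : ℕ) + 1) := by
  have hi : (i : ℕ) ≤ n := Nat.lt_succ_iff.1 i.2
  unfold lamTerm
  rw [lastVec_vecMul, coe_embGL_succ, Matrix.mul_apply, Fin.sum_univ_castSucc]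
  simp only [blockMat_last_castSucc, Pi.zero_apply, zero_mul, Finset.sum_const_zero, zero_add,
    blockMat_last_last, one_mul, valMat, Matrix.of_apply, glueRows_last]
  rw [div_eq_mul_inv, ← zpow_natCast, ← zpow_neg, Units.val_zpow_eq_zpow_val]
  congr 2
  push_cast [Nat.cast_sub hi]
  ring

/-- Integration over the upper rows leaves a function of the last row that is equivariant under the
units. On the adapted locus it is determined by one value; the last-row integral is then a product
of Gauss integrals, and that value is the integral of rank `n` times an integral over the last
column `y`. -/
theorem iwahoriIntegral_birchFun_embGL {m : ℕ} (h : n + 1 ≤ m) {ψ : AddChar F ℂ}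
    (hψc : Continuous ψ) (hψ : HasConductorIntegers ψ) {w : GL (Fin m) F → ℂ}
    (hw : IsWhittaker ψ w) (hwI : IsIwahoriInvariant w) {χ : Fˣ →* ℂˣ} (hχc : Continuous χ)
    {f : 𝒪[F]} (hf0 : f ≠ 0) (hf : ¬ IsUnit f) (hχ : HasConductor χ (Ideal.span {f}))
    (g : GL (Fin n) F) :
    iwahoriIntegral η (fun k => birchFun h ψ w χ (toUnit f hf0) (embGL (Nat.le_succ n) g * k)) =
      (∏ i : Fin (n + 1), ((normIdeal f : ℂ) ^ (n - (i : ℕ) + 1))⁻¹ * localGaussSum ψ χ f) *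
      ((∫ y : Fin n → 𝒪[F], ψ (lastVec F n ⬝ᵥ ((g : Matrix (Fin n) (Fin n) F) *ᵥ
          fun i => (y i : F))) ∂(Measure.pi fun _ => η)) *
        iwahoriIntegral η (fun k => birchFun ((Nat.le_succ n).trans h) ψ w χ (toUnit f hf0)
          (g * k))) := by
  set fU := toUnit f hf0 with hfU
  have hf' : (f : F) ≠ 0 := by simpa using hf0
  -- The base point: its last row `(f^n, …, f, 1)` is adapted, and `A` lies in the Iwahori group.
  let A : GL (Fin (n + 1)) 𝒪[F] :=
    (Matrix.of (lowerPow (n + 1) f)).nonsingInvUnit (isIwahoriMat_lowerPow hf).isUnit_det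
  have hAI : A ∈ iwahoriInt F (n + 1) := (mem_iwahoriInt_iff A).2 (isIwahoriMat_lowerPow hf).1
  have hAGL : Matrix.GeneralLinearGroup.map (𝒪[F]).subtype A = toGL (lowerPow (n + 1) f) :=
    (toGL_of_isUnit _).symm
  have hAlast : ∀ j, A (Fin.last n) j = f ^ (n - (j : ℕ)) := fun j => by
    change lowerPow (n + 1) f (Fin.last n) j = _
    rw [lowerPow, if_pos (Fin.le_last j)]; rfl
  let P : IntMat F (n + 1) → ℂ := fun k =>
    if IsIwahoriMat k then whittakerFactor h w χ fU (embGL (Nat.le_succ n) g * toGL k) else 0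
  have hP : Continuous P := continuous_ite_of_isClopen (isClopen_isIwahoriMat (n + 1))
    ((continuous_whittakerFactor h fU hwI hχc).comp
      (continuous_const.mul (continuous_toGL (n + 1)))) continuous_const
  have hPτ : ∀ (t : Fin (n + 1) → (𝒪[F])ˣ) k,
      P (mulRightMat (diagInt t) k) = (∏ i, unitChar χ (t i)) * P k := by
    intro t k
    have hbox := isIwahoriMat_mul_iff k (diagInt t) (diagInt_mem_iwahoriInt t)
    rw [← mulRightMat_apply] at hbox
    simp only [P, hbox]
    split_ifs with hk
    · rw [toGL_mulRightMat _ hk.isUnit_det, map_diagInt, ← mul_assoc,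
        whittakerFactor_mul_diagGL h fU hwI]
    · rw [mul_zero]
  let topM : Measure (Fin n → Fin (n + 1) → 𝒪[F]) := Measure.pi fun _ => Measure.pi fun _ => η
  -- `P` omits `ψ(λ)`, which depends on the row `R` alone and is restored after the integration over
  -- `T`.
  let Ψ : (Fin (n + 1) → 𝒪[F]) → ℂ := fun R => ∫ T, P (glueRows (R, T)) ∂topM
  have hΨτ : ∀ (t : Fin (n + 1) → (𝒪[F])ˣ) (R : Fin (n + 1) → 𝒪[F]),
      Ψ (fun j => R j * (t j : 𝒪[F])) = (∏ i, unitChar χ (t i)) * Ψ R := by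
    intro t R
    simp only [Ψ]
    rw [← integral_const_mul]
    have hcont : Continuous fun T => P (glueRows (fun j => R j * (t j : 𝒪[F]), T)) :=
      hP.comp (continuous_glueRows.comp (continuous_const.prodMk continuous_id))
    have hmp := measurePreserving_scaleColumns η (k := n) t
    have := integral_map (μ := topM) hmp.measurable.aemeasurable
      (f := fun T => P (glueRows (fun j => R j * (t j : 𝒪[F]), T))) hcont.aestronglyMeasurable
    rw [hmp.map_eq] at this
    rw [this]
    refine integral_congr_ae (Filter.Eventually.of_forall fun T => ?_)
    simp only []
    rw [glueRows_scaleColumns, hPτ]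
  let r0 : Fin (n + 1) → 𝒪[F] := fun j => f ^ (n - (j : ℕ))
  -- Substituting `(H, y; 0, 1) A` separates the variables: moving `y` past `g` yields `g y`, and
  -- the matrix identity turns the dependence on `H` into the integrand of rank `n`.
  have hΨ0 : Ψ r0 = (∫ y : Fin n → 𝒪[F], ψ (lastVec F n ⬝ᵥ ((g : Matrix (Fin n) (Fin n) F) *ᵥ
          fun i => (y i : F))) ∂(Measure.pi fun _ => η)) *
        iwahoriIntegral η (fun k => birchFun ((Nat.le_succ n).trans h) ψ w χ fU (g * k)) := by
    have hmp := measurePreserving_upperRows η A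
    have hcont : Continuous fun T => P (glueRows (r0, T)) :=
      hP.comp (continuous_glueRows.comp (continuous_const.prodMk continuous_id))
    have := integral_map (μ := (haarMat η n).prod (Measure.pi fun _ : Fin n => η))
      hmp.measurable.aemeasurable (f := fun T => P (glueRows (r0, T))) hcont.aestronglyMeasurable
    rw [hmp.map_eq] at this
    simp only [Ψ]
    rw [this, mul_comm, iwahoriIntegral, ← integral_prod_mul]
    refine integral_congr_ae (Filter.Eventually.of_forall fun p => ?_)
    have hr0 : r0 = fun j => A (Fin.last n) j := funext fun j => (hAlast j).symm
    have hbox : IsIwahoriMat (mulRightMat A (Matrix.of.symm (blockMat (Matrix.of p.1) p.2 0 1))) ↔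
        IsIwahoriMat p.1 := by
      rw [mulRightMat_apply, isIwahoriMat_mul_iff _ A hAI, isIwahoriMat_blockMat_iff]
    simp only []
    rw [hr0, glueRows_upperRows]
    simp only [P, hbox]
    split_ifs with hH
    · rw [toGL_mulRightMat A ((isIwahoriMat_blockMat_iff _ _).2 hH).isUnit_det, toGL_blockMat hH,
        hAGL, ← mul_assoc, ← mul_assoc, embGL_mul_uniGL, mul_assoc (uniGL _), ← map_mul,
        whittakerFactor_uniGL_mul_embGL_mul_lowerPow h hw hwI χ hf0 hf, mul_comm]
    · rw [zero_mul]
  rw [iwahoriIntegral_birchFun_eq_adapted η h hψc hψ hwI hχc hf0 hf hχ]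
  rw [← hfU]
  let Q : IntMat F (n + 1) → ℂ := fun k =>
    if IsAdapted fU (embGL (Nat.le_succ n) g) k then
      (if IsIwahoriMat k then birchFun h ψ w χ fU (embGL (Nat.le_succ n) g * toGL k) else 0) else 0
  have hadapt : IsClopen {k : IntMat F (n + 1) | IsAdapted fU (embGL (Nat.le_succ n) g) k} := by
    have : {k : IntMat F (n + 1) | IsAdapted fU (embGL (Nat.le_succ n) g) k} =
        ⋂ i, {k | valuation F (lamTerm fU (embGL (Nat.le_succ n) g) i k * fU) = 1} := by
      ext k; simp only [Set.mem_iInter, Set.mem_ofPred_eq, IsAdapted]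
    rw [this]
    exact isClopen_iInter_of_finite fun i => isClopen_valuation_eq_one.preimage
      ((continuous_lamTerm fU _ i).mul continuous_const)
  have hQ : Continuous Q := continuous_ite_of_isClopen hadapt
    (continuous_ite_of_isClopen (isClopen_isIwahoriMat (n + 1))
      ((continuous_birchFun h fU hψc hwI hχc).comp
      (continuous_const.mul (continuous_toGL (n + 1)))) continuous_const) continuous_const
  have hmp := measurePreserving_glueRows (F := F) (n := n) η
  have hQi := integral_map (μ := (Measure.pi fun _ : Fin (n + 1) => η).prod
    (Measure.pi fun _ : Fin n => Measure.pi fun _ : Fin (n + 1) => η))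
    hmp.measurable.aemeasurable (f := Q) hQ.aestronglyMeasurable
  rw [hmp.map_eq] at hQi
  change ∫ k, Q k ∂(haarMat η (n + 1)) = _
  have hQg : Continuous fun p => Q (glueRows p) := hQ.comp continuous_glueRows
  rw [hQi, integral_prod _ (hQg.integrable_of_hasCompactSupport
    (HasCompactSupport.of_compactSpace _)), ← hΨ0]
  have hdiv : ∀ (R : Fin (n + 1) → 𝒪[F]) (i : Fin (n + 1)),
      (R i : F) / (f : F) ^ (n - (i : ℕ) + 1) * f = (R i : F) / (f : F) ^ (n - (i : ℕ)) := by
    intro R i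
    rw [pow_succ]; field_simp
  have hinner : ∀ R : Fin (n + 1) → 𝒪[F], ∫ T, Q (glueRows (R, T)) ∂topM =
      (∏ i : Fin (n + 1), gaussFun ψ χ f (n - (i : ℕ)) (R i)) * Ψ r0 := by
    intro R
    have hQR : ∀ T, Q (glueRows (R, T)) =
        (if ∀ i : Fin (n + 1), valuation F ((R i : F) / (f : F) ^ (n - (i : ℕ))) = 1 then
          ∏ i : Fin (n + 1), ψ ((R i : F) / (f : F) ^ (n - (i : ℕ) + 1)) else 0) *
            P (glueRows (R, T)) := by
      intro T
      have had : IsAdapted fU (embGL (Nat.le_succ n) g) (glueRows (R, T)) ↔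
          ∀ i : Fin (n + 1), valuation F ((R i : F) / (f : F) ^ (n - (i : ℕ))) = 1 := by
        refine forall_congr' fun i => ?_
        rw [hfU, lamTerm_embGL_glueRows, ← hdiv]
        rfl
      simp only [Q, P, had]
      by_cases h1 : ∀ i : Fin (n + 1), valuation F ((R i : F) / (f : F) ^ (n - (i : ℕ))) = 1
      · rw [if_pos h1, if_pos h1]
        by_cases h2 : IsIwahoriMat (glueRows (R, T))
        · rw [if_pos h2, if_pos h2, birchFun, psi_lam_eq_prod ψ _ _ h2.isUnit_det, mul_comm]
          simp only [hfU, lamTerm_embGL_glueRows]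
        · rw [if_neg h2, if_neg h2, mul_zero]
      · rw [if_neg h1, if_neg h1, zero_mul]
    simp only [hQR]
    rw [integral_const_mul]
    change _ * Ψ R = _
    by_cases hR : ∀ i : Fin (n + 1), valuation F ((R i : F) / (f : F) ^ (n - (i : ℕ))) = 1
    -- An adapted row is `r0` scaled by the units `t i = R i / f^{n-i}`. Equivariance then produces
    -- the factors `χ(t i)`, which combine with the values of `ψ` to give `gaussFun`.
    · choose t ht using fun i => exists_unit_of_valuation_eq_one (hR i)
      have hRt : R = fun j => r0 j * (t j : 𝒪[F]) := by
        funext j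
        apply Subtype.ext
        rw [Subring.coe_mul, ht j]
        simp only [r0, SubmonoidClass.coe_pow]
        rw [mul_div_cancel₀ _ (pow_ne_zero _ hf')]
      rw [if_pos hR]
      have hΨR : Ψ R = (∏ i, unitChar χ (t i)) * Ψ r0 := by
        rw [← hΨτ t r0, ← hRt]
      rw [hΨR, ← mul_assoc, ← Finset.prod_mul_distrib]
      congr 1
      refine Finset.prod_congr rfl fun i _ => ?_
      rw [gaussFun, if_pos (hR i), ← ht i, evalChar_unit, mul_comm]
    · rw [if_neg hR, zero_mul]
      push Not at hR
      obtain ⟨i, hi⟩ := hR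
      rw [Finset.prod_eq_zero (Finset.mem_univ i), zero_mul]
      rw [gaussFun, if_neg hi, zero_mul]
  simp only [topM] at hinner
  simp only [hinner]
  rw [integral_mul_const, integral_fintype_prod_eq_prod
    (f := fun (i : Fin (n + 1)) (r : 𝒪[F]) => gaussFun ψ χ f (n - (i : ℕ)) r)]
  simp only [integral_gaussFun η hψ hf0 hf hχ]

end Recursion

/-! ### Matrices whose last row is the last basis vector. -/

section Decomposition

variable {F : Type*} [Field F] {n : ℕ}

/-- The inverse has the same last row, so the upper left blocks of `g` and `g⁻¹` are mutually
inverse. -/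
theorem exists_uniGL_mul_embGL (g : GL (Fin (n + 1)) F)
    (hg : ∀ j, g (Fin.last n) j = (1 : Matrix (Fin (n + 1)) (Fin (n + 1)) F) (Fin.last n) j) :
    ∃ (x : Fin n → F) (g' : GL (Fin n) F), g = uniGL x * embGL (Nat.le_succ n) g' := by
  have hinv : ∀ j, (g⁻¹ : GL (Fin (n + 1)) F) (Fin.last n) j =
      (1 : Matrix (Fin (n + 1)) (Fin (n + 1)) F) (Fin.last n) j := by
    intro j
    rw [← Units.mul_inv g, Matrix.mul_apply]
    simp [hg, Matrix.one_apply]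
  have hblock : ∀ M : Matrix (Fin (n + 1)) (Fin (n + 1)) F,
      (∀ j, M (Fin.last n) j = (1 : Matrix (Fin (n + 1)) (Fin (n + 1)) F) (Fin.last n) j) →
      M = blockMat (Matrix.of fun i j => M i.castSucc j.castSucc)
        (fun i => M i.castSucc (Fin.last n)) 0 1 := by
    intro M hM
    apply blockMat_ext
    · simp
    · simp
    · intro j
      rw [hM, blockMat_last_castSucc, Matrix.one_apply_ne (Fin.castSucc_lt_last j).ne',
        Pi.zero_apply]
    · rw [hM]; simp
  have h1 := hblock _ hg
  have h2 := hblock _ hinv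
  set H : Matrix (Fin n) (Fin n) F := Matrix.of fun i j => g i.castSucc j.castSucc
  set H' : Matrix (Fin n) (Fin n) F :=
    Matrix.of fun i j => (g⁻¹ : GL (Fin (n + 1)) F) i.castSucc j.castSucc
  have hcorner : ∀ A B : Matrix (Fin n) (Fin n) F, ∀ y z : Fin n → F,
      blockMat A y 0 1 * blockMat B z 0 1 = (1 : Matrix (Fin (n + 1)) (Fin (n + 1)) F) →
      A * B = 1 := by
    intro A B y z hAB
    ext i j
    have := congrFun (congrFun hAB i.castSucc) j.castSucc
    simpa [Matrix.mul_apply, Fin.sum_univ_castSucc, Matrix.one_apply] using this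
  have hHH' : H * H' = 1 := hcorner _ _ _ _ (by rw [← h1, ← h2]; exact Units.mul_inv g)
  have hH'H : H' * H = 1 := hcorner _ _ _ _ (by rw [← h1, ← h2]; exact Units.inv_mul g)
  refine ⟨fun i => g i.castSucc (Fin.last n), ⟨H, H', hHH', hH'H⟩, Units.ext ?_⟩
  rw [Units.val_mul, coe_uniGL, coe_embGL_succ, h1]
  apply blockMat_ext <;> intros <;>
    simp [Matrix.mul_apply, Fin.sum_univ_castSucc, Matrix.one_apply, H]

end Decomposition

/-! ### Vanishing away from the identity orbit, and the value at the identity. -/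

section Support

variable {F : Type*} [Field F] [ValuativeRel F] [TopologicalSpace F] [IsNonarchimedeanLocalField F]
variable [MeasurableSpace 𝒪[F]] [BorelSpace 𝒪[F]] (η : Measure 𝒪[F]) [η.IsAddHaarMeasure]
  [IsProbabilityMeasure η] {n : ℕ}

/-- Left multiplication by an element of `GL_n(𝒪_F)` on integral matrices. -/
def mulLeftMat (k : GL (Fin n) 𝒪[F]) : IntMat F n ≃ₜ IntMat F n where
  toFun x := Matrix.of.symm ((k : Matrix (Fin n) (Fin n) 𝒪[F]) * Matrix.of x)
  invFun x := Matrix.of.symm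
    (((k⁻¹ : GL (Fin n) 𝒪[F]) : Matrix (Fin n) (Fin n) 𝒪[F]) * Matrix.of x)
  left_inv x := by
    beta_reduce
    rw [Equiv.apply_symm_apply, ← Matrix.mul_assoc, ← Units.val_mul, inv_mul_cancel, Units.val_one,
      Matrix.one_mul, Equiv.symm_apply_apply]
  right_inv x := by
    beta_reduce
    rw [Equiv.apply_symm_apply, ← Matrix.mul_assoc, ← Units.val_mul, mul_inv_cancel, Units.val_one,
      Matrix.one_mul, Equiv.symm_apply_apply]
  continuous_toFun := (continuous_const.matrix_mul continuous_of : Continuous fun x : IntMat F n =>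
    (k : Matrix (Fin n) (Fin n) 𝒪[F]) * Matrix.of x)
  continuous_invFun := (continuous_const.matrix_mul continuous_of : Continuous fun x : IntMat F n =>
    ((k⁻¹ : GL (Fin n) 𝒪[F]) : Matrix (Fin n) (Fin n) 𝒪[F]) * Matrix.of x)

theorem mulLeftMat_apply (k : GL (Fin n) 𝒪[F]) (x : IntMat F n) :
    mulLeftMat k x = Matrix.of.symm ((k : Matrix (Fin n) (Fin n) 𝒪[F]) * Matrix.of x) := rfl

theorem measurePreserving_mulLeftMat (k : GL (Fin n) 𝒪[F]) :
    MeasurePreserving (mulLeftMat k) (haarMat η n) (haarMat η n) :=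
  measurePreserving_addMonoidHom (haarMat η n) (haarMat η n)
    { toFun := mulLeftMat k
      map_zero' := by
        rw [mulLeftMat_apply]
        exact congrArg Matrix.of.symm (Matrix.mul_zero (k : Matrix (Fin n) (Fin n) 𝒪[F]))
      map_add' := fun x y => by
        simp only [mulLeftMat_apply]
        exact congrArg Matrix.of.symm (Matrix.mul_add _ _ _) }
    (mulLeftMat k).continuous (mulLeftMat k).surjective

theorem isUnit_det_mulLeftMat_iff (k : GL (Fin n) 𝒪[F]) (x : IntMat F n) :
    IsUnit (Matrix.of (mulLeftMat k x)).det ↔ IsUnit (Matrix.of x).det := by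
  rw [mulLeftMat_apply, Equiv.apply_symm_apply, Matrix.det_mul, IsUnit.mul_iff]
  exact and_iff_right (isUnit_det_coe k)

theorem toGL_mulLeftMat (k : GL (Fin n) 𝒪[F]) {x : IntMat F n}
    (hx : IsUnit (Matrix.of x).det) :
    toGL (mulLeftMat k x) = Matrix.GeneralLinearGroup.map (𝒪[F]).subtype k * toGL x := by
  apply Units.ext
  rw [coe_toGL ((isUnit_det_mulLeftMat_iff k x).2 hx), Units.val_mul, coe_toGL hx, valMat_eq_map,
    mulLeftMat_apply, Equiv.apply_symm_apply, Matrix.map_mul]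
  rfl

theorem isIwahoriMat_mulLeftMat_iff {k : GL (Fin n) 𝒪[F]} (hk : k ∈ iwahoriInt F n)
    (x : IntMat F n) : IsIwahoriMat (mulLeftMat k x) ↔ IsIwahoriMat x := by
  have hdet := isUnit_det_mulLeftMat_iff k x
  by_cases h : IsUnit (Matrix.of x).det
  · rw [← toGL_mem_iwahoriGL_iff h, ← toGL_mem_iwahoriGL_iff (hdet.2 h), toGL_mulLeftMat k h]
    exact Subgroup.mul_mem_cancel_left _ ⟨k, hk, rfl⟩
  · exact ⟨fun h' => absurd (hdet.1 h'.isUnit_det) h, fun h' => absurd h'.isUnit_det h⟩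

theorem iwahoriIntegral_mul_left (φ : GL (Fin n) F → ℂ) {k : GL (Fin n) F}
    (hk : k ∈ iwahoriGL F n) :
    iwahoriIntegral η (fun g => φ (k * g)) = iwahoriIntegral η φ := by
  obtain ⟨k, hk, rfl⟩ := hk
  unfold iwahoriIntegral
  refine Eq.trans ?_ ((measurePreserving_mulLeftMat η k).integral_comp
    (mulLeftMat k).measurableEmbedding _)
  refine integral_congr_ae (Filter.Eventually.of_forall fun x => ?_)
  simp only [isIwahoriMat_mulLeftMat_iff hk]
  split_ifs with hx
  · rw [toGL_mulLeftMat k hx.isUnit_det]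
  · rfl

theorem lastVec_vecMul_coe_mul_eq (f : Fˣ) (g : GL (Fin (n + 1)) F) {k : IntMat F (n + 1)}
    (hk : IsUnit (Matrix.of k).det) (i : Fin (n + 1)) :
    (g * toGL k : GL (Fin (n + 1)) F) (Fin.last n) i =
      lamTerm f g i k * ((f ^ ((n + 1 : ℤ) - i) : Fˣ) : F) := by
  rw [lamTerm, lastVec_vecMul, Units.val_mul, coe_toGL hk, mul_assoc, ← Units.val_mul, ← zpow_add]
  simp

/-- A coset `g I` with a matrix satisfying the conductor condition contains the product of a
matrix with trivial last row and an element of the Iwahori subgroup. -/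
theorem IsAdapted.exists_decomposition {f : 𝒪[F]} (hf0 : f ≠ 0) (hf : ¬ IsUnit f)
    {g : GL (Fin (n + 1)) F} {k : IntMat F (n + 1)} (hk : IsIwahoriMat k)
    (hgk : IsAdapted (toUnit f hf0) g k) :
    ∃ (x : Fin n → F) (g' : GL (Fin n) F) (c : GL (Fin (n + 1)) F), c ∈ iwahoriGL F (n + 1) ∧
      g = uniGL x * embGL (Nat.le_succ n) g' * c := by
  have hf' : (f : F) ≠ 0 := by simpa using hf0
  have hA : IsIwahoriMat (lowerPow (n + 1) f) := isIwahoriMat_lowerPow hf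
  choose t ht using fun i => exists_unit_of_valuation_eq_one (hgk i)
  -- Rescaling the columns makes every summand of `λ` equal to `f⁻¹`. The last row of `g k'` then
  -- coincides with that of `lowerPow`, so multiplying by the inverse of `lowerPow` gives a matrix
  -- with trivial last row.
  set k' : IntMat F (n + 1) := mulRightMat (diagInt t⁻¹) k with hk'
  have hk'I : IsIwahoriMat k' := by
    rw [hk', mulRightMat_apply, isIwahoriMat_mul_iff _ _ (diagInt_mem_iwahoriInt _)]
    exact hk
  have hterm : ∀ i, lamTerm (toUnit f hf0) g i k' = (f : F)⁻¹ := by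
    intro i
    have h1 : (((t⁻¹ i : (𝒪[F])ˣ) : 𝒪[F]) : F) * ((t i : 𝒪[F]) : F) = 1 := by
      rw [← Subring.coe_mul, Pi.inv_apply, Units.inv_mul, Subring.coe_one]
    rw [hk', lamTerm_mulRightMat_diagInt]
    have h2 : ((toUnit f hf0 : Fˣ) : F) = f := rfl
    rw [ht i, h2, ← mul_assoc] at h1
    exact eq_inv_of_mul_eq_one_left h1
  have hrow : ∀ i, (g * toGL k' : GL (Fin (n + 1)) F) (Fin.last n) i =
      (toGL (lowerPow (n + 1) f)) (Fin.last n) i := by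
    intro i
    rw [lastVec_vecMul_coe_mul_eq (toUnit f hf0) g hk'I.isUnit_det, hterm, coe_toGL hA.isUnit_det]
    have h3 : valMat (lowerPow (n + 1) f) (Fin.last n) i = (f : F) ^ (n - (i : ℕ)) := by
      simp [valMat, lowerPow, Fin.le_last]
    have h2 : ((toUnit f hf0 : Fˣ) : F) = f := rfl
    have hi : (i : ℕ) ≤ n := Nat.lt_succ_iff.1 i.2
    rw [h3, Units.val_zpow_eq_zpow_val, h2, ← zpow_neg_one, ← zpow_add₀ hf', ← zpow_natCast,
      Nat.cast_sub hi]
    congr 1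
    ring
  obtain ⟨x, g', hg'⟩ := exists_uniGL_mul_embGL
    (g * toGL k' * (toGL (lowerPow (n + 1) f))⁻¹) fun j => by
      rw [Units.val_mul, Matrix.mul_apply]
      simp only [hrow]
      rw [← Matrix.mul_apply, Units.mul_inv]
  refine ⟨x, g', toGL (lowerPow (n + 1) f) * (toGL k')⁻¹,
    mul_mem hA.toGL_mem (inv_mem hk'I.toGL_mem), ?_⟩
  rw [← hg']
  group

/-- A nonzero integral requires an adapted `k`, which brings `g` to the form `u j(g') c`. The
recursion has the integral at `g'` as a factor, so that is nonzero too, and induction applies to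
`g'`. -/
theorem exists_mul_iwahori_of_iwahoriIntegral_ne_zero {m : ℕ} {ψ : AddChar F ℂ}
    (hψc : Continuous ψ) (hψ : HasConductorIntegers ψ) {w : GL (Fin m) F → ℂ}
    (hw : IsWhittaker ψ w) (hwI : IsIwahoriInvariant w) {χ : Fˣ →* ℂˣ} (hχc : Continuous χ)
    {f : 𝒪[F]} (hf0 : f ≠ 0) (hf : ¬ IsUnit f) (hχ : HasConductor χ (Ideal.span {f}))
    (h : n ≤ m) (g : GL (Fin n) F)
    (hg : iwahoriIntegral η (fun k => birchFun h ψ w χ (toUnit f hf0) (g * k)) ≠ 0) :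
    ∃ u ∈ unipotent F n, ∃ k ∈ iwahoriGL F n, g = u * k := by
  induction n with
  | zero => exact ⟨1, one_mem _, 1, one_mem _, Subsingleton.elim _ _⟩
  | succ n ih =>
    obtain ⟨k, hk, hgk⟩ : ∃ k, IsIwahoriMat k ∧ IsAdapted (toUnit f hf0) g k := by
      by_contra! hcon
      refine hg ?_
      rw [iwahoriIntegral_birchFun_eq_adapted η h hψc hψ hwI hχc hf0 hf hχ]
      refine integral_eq_zero_of_ae (Filter.Eventually.of_forall fun k => ?_)
      simp only [Pi.zero_apply]
      split_ifs with h1 h2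
      · exact absurd h1 (hcon k h2)
      · rfl
      · rfl
    obtain ⟨x, g', c, hc, rfl⟩ := hgk.exists_decomposition hf0 hf hk
    have h1 : iwahoriIntegral η (fun k => birchFun h ψ w χ (toUnit f hf0)
        (uniGL x * embGL (Nat.le_succ n) g' * c * k)) =
        psiU ψ ((uniGL x : GL (Fin (n + 1)) F) : Matrix (Fin (n + 1)) (Fin (n + 1)) F) * iwahoriIntegral η (fun k =>
          birchFun h ψ w χ (toUnit f hf0) (embGL (Nat.le_succ n) g' * k)) := by
      -- The Iwahori element `c` is absorbed by left translation, and the unipotent factor comes out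
      -- as a scalar.
      rw [← iwahoriIntegral_mul_left η (fun k => birchFun h ψ w χ (toUnit f hf0)
        (embGL (Nat.le_succ n) g' * k)) hc]
      simp only [iwahoriIntegral, mul_assoc,
        birchFun_unipotent_mul h (toUnit f hf0) hw (uniGL_mem_unipotent x)]
      rw [← integral_const_mul]
      refine integral_congr_ae (Filter.Eventually.of_forall fun k => ?_)
      simp only [mul_ite, mul_zero]
    rw [h1, iwahoriIntegral_birchFun_embGL η h hψc hψ hw hwI hχc hf0 hf hχ] at hg
    obtain ⟨u, hu, k', hk', rfl⟩ := ih ((Nat.le_succ n).trans h) g'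
      (right_ne_zero_of_mul (right_ne_zero_of_mul (right_ne_zero_of_mul hg)))
    refine ⟨uniGL x * embGL (Nat.le_succ n) u,
      mul_mem (uniGL_mem_unipotent x) (embGL_mem_unipotent _ hu),
      embGL (Nat.le_succ n) k' * c, mul_mem (embGL_mem_iwahoriGL _ hk') hc, ?_⟩
    rw [map_mul]
    group

/-- Split `k (n + 2 - k) = k + k (n + 1 - k)`; the second part vanishes at `k = n + 1`. The first
sum on the right collects the exponents of `N(f)` gained in one recursion step. -/
theorem sum_Icc_mul_succ (n : ℕ) : ∑ k ∈ Finset.Icc 1 (n + 1), k * (n + 1 + 1 - k) =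
    (∑ i : Fin (n + 1), (n - (i : ℕ) + 1)) + ∑ k ∈ Finset.Icc 1 n, k * (n + 1 - k) := by
  have hshift : ∀ (N : ℕ) (F : ℕ → ℕ), ∑ k ∈ Finset.Icc 1 N, F k = ∑ i ∈ Finset.range N, F (i + 1) := by
    intro N F
    induction N with
    | zero => simp
    | succ N ih => rw [Finset.sum_Icc_succ_top (by omega), Finset.sum_range_succ, ih]
  rw [hshift, hshift, Fin.sum_univ_eq_sum_range (fun i => n - i + 1),
    ← Finset.sum_range_reflect (fun i => n - i + 1)]
  have : ∑ i ∈ Finset.range n, (i + 1) * (n + 1 - (i + 1)) =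
      ∑ i ∈ Finset.range (n + 1), (i + 1) * (n + 1 - (i + 1)) := by
    rw [Finset.sum_range_succ]; simp
  rw [this, ← Finset.sum_add_distrib]
  refine Finset.sum_congr rfl fun i hi => ?_
  have hi : i ≤ n := Nat.lt_succ_iff.1 (Finset.mem_range.1 hi)
  obtain ⟨d, rfl⟩ := Nat.exists_eq_add_of_le hi
  have e1 : i + d + 1 + 1 - (i + 1) = d + 1 := by omega
  have e2 : i + d - (i + d + 1 - 1 - i) + 1 = i + 1 := by omega
  have e3 : i + d + 1 - (i + 1) = d := by omega
  rw [e1, e2, e3]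
  ring

theorem iwahoriIntegral_birchFun {m : ℕ} {ψ : AddChar F ℂ}
    (hψc : Continuous ψ) (hψ : HasConductorIntegers ψ) {w : GL (Fin m) F → ℂ}
    (hw : IsWhittaker ψ w) (hwI : IsIwahoriInvariant w) {χ : Fˣ →* ℂˣ} (hχc : Continuous χ)
    {f : 𝒪[F]} (hf0 : f ≠ 0) (hf : ¬ IsUnit f) (hχ : HasConductor χ (Ideal.span {f}))
    (h : n ≤ m) :
    iwahoriIntegral η (birchFun h ψ w χ (toUnit f hf0)) =
      ((normIdeal f : ℂ) ^ (∑ k ∈ Finset.Icc 1 n, k * (n + 1 - k)))⁻¹ *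
        localGaussSum ψ χ f ^ (n * (n + 1) / 2) * w 1 := by
  induction n with
  | zero =>
    have h1 : ∀ k : IntMat F 0, (if IsIwahoriMat k then birchFun h ψ w χ (toUnit f hf0) (toGL k)
        else 0) = w 1 := by
      intro k
      rw [if_pos ⟨fun i => i.elim0, fun i => i.elim0⟩, birchFun, whittakerFactor,
        Subsingleton.elim (toGL k * matD 0 (toUnit f hf0) * longestWeyl F 0) 1, map_one,
        Subsingleton.elim (toGL k) 1, map_one, map_one]
      simp [lam]
    rw [iwahoriIntegral]
    simp only [h1]
    simp
  | succ n ih =>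
    have h1 := iwahoriIntegral_birchFun_embGL η h hψc hψ hw hwI hχc hf0 hf hχ 1
    simp only [map_one, one_mul] at h1
    rw [h1, ih ((Nat.le_succ n).trans h), sum_Icc_mul_succ, Finset.prod_mul_distrib,
      Finset.prod_const, Finset.card_univ, Fintype.card_fin, Finset.prod_inv_distrib,
      Finset.prod_pow_eq_pow_sum]
    -- At `g = 1` the character is evaluated at an integer, so the integral over `y` equals one.
    have hy : ∀ y : Fin n → 𝒪[F], ψ (lastVec F n ⬝ᵥ
        (((1 : GL (Fin n) F) : Matrix (Fin n) (Fin n) F) *ᵥ fun i => (y i : F))) = 1 := by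
      intro y
      refine psi_integer hψ ?_
      rw [Units.val_one, Matrix.one_mulVec]
      have hmem : lastVec F n ⬝ᵥ (fun i => (y i : F)) ∈ 𝒪[F] := by
        refine sum_mem fun i _ => ?_
        rw [lastVec, ite_mul, one_mul, zero_mul]
        split_ifs
        · exact (y i).2
        · exact zero_mem _
      exact hmem
    simp only [hy]
    have hG : (n + 1) * (n + 1 + 1) / 2 = (n + 1) + n * (n + 1) / 2 := by
      rw [show (n + 1) * (n + 1 + 1) = n * (n + 1) + (n + 1) * 2 by ring,
        Nat.add_mul_div_right _ _ two_pos, add_comm]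
    rw [hG, pow_add, pow_add, mul_inv, integral_const]
    simp only [probReal_univ, one_smul]
    ring

end Support

/-! ### The only cell meeting the identity orbit. -/

section Cell

variable {F : Type*} [Field F] [ValuativeRel F] [TopologicalSpace F] [IsNonarchimedeanLocalField F]
variable {n : ℕ}

theorem valuation_diag_eq_one {k : GL (Fin n) F} (hk : k ∈ iwahoriGL F n) (i : Fin n) :
    valuation F (k i i) = 1 := by
  obtain ⟨k, hk, rfl⟩ := hk
  exact (isUnit_iff_valuation_eq_one _).1 (((isIwahoriMat_coe_iff k).2 hk).2 i)

/-- Diagonal entries of an Iwahori matrix are units. Here the entry at `(σ i, σ i)` is the `(σ i,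
i)` entry of `u⁻¹` times `ϖ^{e_i}`. Its nonvanishing forces `σ i ≤ i` for all `i`, hence `σ = 1`;
then `ϖ^{e_i}` is a unit and `e_i = 0`. -/
theorem eq_zero_and_eq_one_of_mem_unipotent_mul_iwahori {ϖ : 𝒪[F]} (hϖ : Irreducible ϖ)
    {e : Fin n → ℤ} {σ : Equiv.Perm (Fin n)} {u k : GL (Fin n) F} (hu : u ∈ unipotent F n)
    (hk : k ∈ iwahoriGL F n)
    (huk : diagGL (fun i => toUnit ϖ hϖ.ne_zero ^ e i) * permGL F σ = u * k) : e = 0 ∧ σ = 1 := by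
  have hk' : k = u⁻¹ * (diagGL (fun i => toUnit ϖ hϖ.ne_zero ^ e i) * permGL F σ) := by
    rw [huk, inv_mul_cancel_left]
  have hu' := inv_mem hu
  have hent : ∀ i j, k i (σ j) = (u⁻¹ : GL (Fin n) F) i j * (ϖ : F) ^ e j := by
    intro i j
    rw [hk', ← mul_assoc, mul_permGL_apply, mul_diagGL_apply]
    simp [toUnit]
  have hle : ∀ i, σ i ≤ i := by
    intro i
    by_contra! hlt
    have := valuation_diag_eq_one hk (σ i)
    rw [hent, hu'.1 _ _ hlt, zero_mul, map_zero] at this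
    exact zero_ne_one this
  have hσ : σ = 1 := by
    have hsum : ∑ i : Fin n, ((σ i : Fin n) : ℕ) = ∑ i : Fin n, (i : ℕ) :=
      Equiv.sum_comp σ (fun i : Fin n => (i : ℕ))
    have hle' : ∀ i ∈ (Finset.univ : Finset (Fin n)), ((σ i : Fin n) : ℕ) ≤ (i : ℕ) := fun i _ => hle i
    have := (Finset.sum_eq_sum_iff_of_le hle').1 hsum
    exact Equiv.ext fun i => Fin.ext (this i (Finset.mem_univ i))
  refine ⟨funext fun i => ?_, hσ⟩
  subst hσ
  have := valuation_diag_eq_one hk i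
  have h2 := hent i i
  rw [Equiv.Perm.one_apply, hu'.2, one_mul] at h2
  rw [h2, map_zpow₀] at this
  have hne : valuation F (ϖ : F) ≠ 1 := fun h =>
    hϖ.not_isUnit ((isUnit_iff_valuation_eq_one _).2 h)
  exact (zpow_eq_one_iff_right₀ zero_le hne).1 this

end Cell

/-! ### Unimodularity of the unipotent group. -/

section Unimodular

variable {F : Type*} [Field F] [ValuativeRel F] [TopologicalSpace F] [IsNonarchimedeanLocalField F]
variable {n : ℕ}

/-- The subgroup `U_n(F) ∩ g I_n g⁻¹` of `U_n(F)`. -/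
def unipotentStabilizer (g : GL (Fin n) F) : Subgroup (unipotent F n) :=
  (iwahoriGL F n).comap ((MulAut.conj g⁻¹).toMonoidHom.comp (unipotent F n).subtype)

theorem mem_unipotentStabilizer {g : GL (Fin n) F} {u : unipotent F n} :
    u ∈ unipotentStabilizer g ↔ g⁻¹ * (u : GL (Fin n) F) * g ∈ iwahoriGL F n := by
  simp [unipotentStabilizer]

theorem isOpen_unipotentStabilizer (g : GL (Fin n) F) :
    IsOpen (unipotentStabilizer g : Set (unipotent F n)) := by
  have hc : Continuous fun u : unipotent F n => g⁻¹ * (u : GL (Fin n) F) * g := by fun_prop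
  convert (isOpen_iwahoriGL (F := F) n).preimage hc using 1
  ext u
  exact mem_unipotentStabilizer

theorem isCompact_unipotentStabilizer (g : GL (Fin n) F) :
    IsCompact (unipotentStabilizer g : Set (unipotent F n)) := by
  have hK : IsCompact ((fun k => g * k * g⁻¹) '' (iwahoriGL F n : Set (GL (Fin n) F))) :=
    (isCompact_iwahoriGL n).image (by fun_prop)
  have : (unipotentStabilizer g : Set (unipotent F n)) =
      Subtype.val ⁻¹' ((fun k => g * k * g⁻¹) '' (iwahoriGL F n : Set (GL (Fin n) F))) := by
    ext u
    rw [SetLike.mem_coe, mem_unipotentStabilizer, Set.mem_preimage]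
    constructor
    · exact fun h => ⟨_, h, by group⟩
    · rintro ⟨k, hk, hku⟩
      rw [← hku]
      have : g⁻¹ * (g * k * g⁻¹) * g = k := by group
      exact this.symm ▸ hk
  rw [this]
  exact (isClosed_unipotent F n).isClosedEmbedding_subtypeVal.isCompact_preimage hK

theorem exists_pow_mul_mem_integer {ϖ : 𝒪[F]} (hϖ : Irreducible ϖ) (x : F) :
    ∃ N : ℕ, ∀ M ≥ N, (ϖ : F) ^ M * x ∈ 𝒪[F] := by
  obtain ⟨a, b, hb, rfl⟩ := IsFractionRing.div_surjective (A := 𝒪[F]) x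
  have hb0 : b ≠ 0 := nonZeroDivisors.ne_zero hb
  obtain ⟨N, hN⟩ := IsDiscreteValuationRing.associated_pow_irreducible hb0 hϖ
  obtain ⟨c, hc⟩ := hN.dvd
  refine ⟨N, fun M hM => ?_⟩
  have hb' : (algebraMap 𝒪[F] F b) ≠ 0 := by simpa using hb0
  have : (ϖ : F) ^ M * (algebraMap 𝒪[F] F a / algebraMap 𝒪[F] F b) =
      ((ϖ ^ (M - N) * c * a : 𝒪[F]) : F) := by
    rw [mul_div_assoc', div_eq_iff hb', ← Nat.sub_add_cancel hM, pow_add]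
    have h1 : (ϖ : F) ^ N = algebraMap 𝒪[F] F b * (c : F) := by
      have := congrArg (Subtype.val) hc
      exact (by simpa using this : (ϖ : F) ^ N = (b : F) * (c : F))
    rw [h1, Nat.add_sub_cancel]
    push_cast
    change _ * (a : F) = _ * (b : F)
    change (ϖ : F) ^ (M - N) * ((b : F) * c) * a = _
    ring
  rw [this]
  exact Subtype.prop _

/-- Conjugation by `diag(ϖ^{M i})` multiplies the entry at `(i, j)` by `ϖ^{M (j - i)}`, so for large
`M` everything above the diagonal becomes integral. The unipotent group is thus a union of compact
open subgroups. -/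
theorem exists_mem_unipotentStabilizer (u : unipotent F n) :
    ∃ g : GL (Fin n) F, u ∈ unipotentStabilizer g := by
  obtain ⟨ϖ, hϖ⟩ := IsDiscreteValuationRing.exists_irreducible 𝒪[F]
  choose N hN using fun p : Fin n × Fin n =>
    exists_pow_mul_mem_integer hϖ ((u : GL (Fin n) F) p.1 p.2)
  let M := ∑ p, N p
  have hM : ∀ i j, ∀ M' ≥ M, (ϖ : F) ^ M' * (u : GL (Fin n) F) i j ∈ 𝒪[F] := fun i j M' h =>
    hN (i, j) M' ((Finset.single_le_sum (fun _ _ => Nat.zero_le _) (Finset.mem_univ (i, j))).trans h)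
  have hϖ0 : (ϖ : F) ≠ 0 := by simpa using hϖ.ne_zero
  let d : Fin n → Fˣ := fun i => toUnit ϖ hϖ.ne_zero ^ (M * i)
  refine ⟨diagGL d, mem_unipotentStabilizer.2 ?_⟩
  have hent : ∀ i j, ((diagGL d)⁻¹ * (u : GL (Fin n) F) * diagGL d : GL (Fin n) F) i j =
      ((d i)⁻¹ : Fˣ) * (u : GL (Fin n) F) i j * d j := by
    intro i j
    rw [mul_diagGL_apply, Units.val_mul]
    have : (((diagGL d)⁻¹ : GL (Fin n) F) : Matrix (Fin n) (Fin n) F) =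
      Matrix.diagonal fun i => (((d i)⁻¹ : Fˣ) : F) := rfl
    rw [this, Matrix.diagonal_mul]
  have hmem : ∀ i j, ((diagGL d)⁻¹ * (u : GL (Fin n) F) * diagGL d : GL (Fin n) F) i j ∈ 𝒪[F] := by
    intro i j
    rw [hent]
    rcases lt_trichotomy i j with h | h | h
    · have : (((d i)⁻¹ : Fˣ) : F) * (u : GL (Fin n) F) i j * d j =
          (ϖ : F) ^ (M * (j - i : ℕ)) * (u : GL (Fin n) F) i j := by
        have h1 : ((d j : Fˣ) : F) = (d i : F) * (ϖ : F) ^ (M * (j - i : ℕ)) := by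
          have hji : (j : ℕ) = i + (j - i : ℕ) := by have := Fin.lt_def.1 h; omega
          simp only [d, toUnit, Units.val_pow_eq_pow_val, Units.val_mk0]
          rw [← pow_add, ← mul_add, ← hji]
        rw [h1, mul_comm (((d i)⁻¹ : Fˣ) : F), mul_assoc, Units.inv_mul_cancel_left, mul_comm]
      rw [this]
      refine hM i j _ (Nat.le_mul_of_pos_right _ ?_)
      have := Fin.lt_def.1 h
      omega
    · subst h
      rw [u.2.2, mul_one, Units.inv_mul]
      exact one_mem _
    · rw [u.2.1 _ _ h, mul_zero, zero_mul]
      exact zero_mem _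
  refine mem_iwahoriGL_of_valMat (k := fun i j => ⟨_, hmem i j⟩) ⟨fun i j hij => ?_, fun i => ?_⟩ ?_
  · convert zero_mem (𝓂[F]) using 1
    apply Subtype.ext
    simp only [hent, u.2.1 _ _ hij, mul_zero, zero_mul]
    rfl
  · convert isUnit_one using 1
    apply Subtype.ext
    simp only [hent, u.2.2, mul_one, Units.inv_mul]
    rfl
  · rfl

variable [MeasurableSpace (GL (Fin n) F)] [BorelSpace (GL (Fin n) F)]
  (ν : Measure (unipotent F n)) [ν.IsHaarMeasure]

theorem measure_unipotentStabilizer_ne_zero (g : GL (Fin n) F) :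
    ν (unipotentStabilizer g) ≠ 0 :=
  ((isOpen_unipotentStabilizer g).measure_pos ν ⟨1, one_mem _⟩).ne'

theorem measure_unipotentStabilizer_ne_top (g : GL (Fin n) F) :
    ν (unipotentStabilizer g) ≠ ∞ :=
  (isCompact_unipotentStabilizer g).measure_lt_top.ne

/-- Right translation by `u` scales `ν` by a constant. It preserves a compact open subgroup
containing `u`, whose measure is positive and finite, so the constant is one. -/
theorem isMulRightInvariant_unipotent : ν.IsMulRightInvariant := by
  have := t2Space_GL F n
  have := locallyCompactSpace_GL F n
  have := secondCountable_GL F n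
  have : LocallyCompactSpace (unipotent F n) :=
    (isClosed_unipotent F n).isClosedEmbedding_subtypeVal.locallyCompactSpace
  have : SecondCountableTopology (unipotent F n) :=
    Topology.IsEmbedding.subtypeVal.secondCountableTopology
  refine ⟨fun u => ?_⟩
  have h1 := Measure.isMulLeftInvariant_eq_smul (Measure.map (· * u) ν) ν
  obtain ⟨g, hg⟩ := exists_mem_unipotentStabilizer u
  have hS : Measure.map (· * u) ν (unipotentStabilizer g) = ν (unipotentStabilizer g) := by
    rw [Measure.map_apply (measurable_mul_const u) (isOpen_unipotentStabilizer g).measurableSet]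
    congr 1
    ext x
    exact Subgroup.mul_mem_cancel_right _ hg
  set c := Measure.haarScalarFactor (Measure.map (· * u) ν) ν
  rw [h1, Measure.smul_apply, ENNReal.smul_def, smul_eq_mul] at hS
  have hc : (c : ℝ≥0∞) = 1 := by
    rw [← ENNReal.div_self (measure_unipotentStabilizer_ne_zero ν g)
      (measure_unipotentStabilizer_ne_top ν g)]
    exact ENNReal.eq_div_iff (measure_unipotentStabilizer_ne_zero ν g)
      (measure_unipotentStabilizer_ne_top ν g) |>.2 (by rw [mul_comm]; exact hS)
  rw [h1, ENNReal.coe_eq_one.1 hc, one_smul]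

/-- An integral unipotent matrix has zeros below the diagonal and so is automatically Iwahori. The
stabilizer at `1` therefore has the volume normalized to one. -/
theorem unipotentStabilizer_one :
    (unipotentStabilizer (1 : GL (Fin n) F) : Set (unipotent F n)) =
      {u : unipotent F n | (u : GL (Fin n) F) ∈ intGL F n} := by
  ext u
  rw [SetLike.mem_coe, mem_unipotentStabilizer, inv_one, one_mul, mul_one, Set.mem_ofPred_eq]
  refine ⟨fun h => iwahoriGL_le_intGL n h, ?_⟩
  rintro ⟨k, hk⟩
  refine mem_iwahori_iff_mem.1 ⟨k, hk, fun i j hij => ?_⟩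
  convert zero_mem (𝓂[F]) using 1
  apply Subtype.ext
  have := u.2.1 i j hij
  rw [← hk] at this
  exact this

end Unimodular

/-! ### Iwahori orbits on the quotient and their measure. -/

section Orbit

variable {F : Type*} [Field F] [ValuativeRel F] [TopologicalSpace F] [IsNonarchimedeanLocalField F]
variable {n : ℕ}

/-- The orbit of `U_n(F) g` under right translation by the Iwahori subgroup. -/
def iwahoriOrbit (g : GL (Fin n) F) : Set (Quotient (QuotientGroup.rightRel (unipotent F n))) :=
  {x | ∃ k ∈ iwahori F n, x = Quotient.mk _ (g * k)}

/-- The coset `g I_n`. -/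
def iwahoriCoset (g : GL (Fin n) F) : Set (GL (Fin n) F) := {h | g⁻¹ * h ∈ iwahoriGL F n}

theorem isOpen_iwahoriCoset (g : GL (Fin n) F) : IsOpen (iwahoriCoset g) :=
  (isOpen_iwahoriGL n).preimage (continuous_const_mul g⁻¹)

theorem isCompact_iwahoriCoset (g : GL (Fin n) F) : IsCompact (iwahoriCoset g) := by
  convert (isCompact_iwahoriGL (F := F) n).image (continuous_const_mul g) using 1
  ext h
  constructor
  · exact fun hh => ⟨_, hh, by simp⟩
  · rintro ⟨k, hk, rfl⟩
    simpa [iwahoriCoset] using hk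

theorem mk_eq_mk_iff {g h : GL (Fin n) F} :
    (Quotient.mk (QuotientGroup.rightRel (unipotent F n)) g = Quotient.mk _ h) ↔
      h * g⁻¹ ∈ unipotent F n :=
  Quotient.eq.trans QuotientGroup.rightRel_apply

theorem mk_mem_iwahoriOrbit_iff {g h : GL (Fin n) F} :
    Quotient.mk _ h ∈ iwahoriOrbit g ↔ ∃ u : unipotent F n, (u : GL (Fin n) F) * h ∈ iwahoriCoset g := by
  constructor
  · rintro ⟨k, hk, hh⟩
    refine ⟨⟨_, mk_eq_mk_iff.1 hh⟩, ?_⟩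
    simpa [iwahoriCoset] using mem_iwahori_iff_mem.1 hk
  · rintro ⟨u, hu⟩
    refine ⟨_, mem_iwahori_iff_mem.2 hu, mk_eq_mk_iff.2 ?_⟩
    simp

theorem iwahoriOrbit_unipotent_mul_iwahori {u k g : GL (Fin n) F} (hu : u ∈ unipotent F n)
    (hk : k ∈ iwahoriGL F n) : iwahoriOrbit (u * g * k) = iwahoriOrbit g := by
  ext x
  constructor
  · rintro ⟨k', hk', rfl⟩
    refine ⟨k * k', mem_iwahori_iff_mem.2 (mul_mem hk (mem_iwahori_iff_mem.1 hk')),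
      mk_eq_mk_iff.2 ?_⟩
    convert inv_mem hu using 1
    group
  · rintro ⟨k', hk', rfl⟩
    refine ⟨k⁻¹ * k', mem_iwahori_iff_mem.2 (mul_mem (inv_mem hk) (mem_iwahori_iff_mem.1 hk')),
      mk_eq_mk_iff.2 ?_⟩
    convert hu using 1
    group

theorem iwahoriOrbit_eq_of_mem {g h : GL (Fin n) F} (hh : Quotient.mk _ h ∈ iwahoriOrbit g) :
    iwahoriOrbit h = iwahoriOrbit g := by
  obtain ⟨u, hu⟩ := mk_mem_iwahoriOrbit_iff.1 hh
  rw [← iwahoriOrbit_unipotent_mul_iwahori (g := g) (inv_mem u.2) hu]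
  congr 1
  group

theorem mem_iwahoriOrbit_self (g : GL (Fin n) F) : Quotient.mk _ g ∈ iwahoriOrbit g :=
  ⟨1, mem_iwahori_iff_mem.2 (one_mem _), by rw [mul_one]⟩

theorem iwahoriOrbit_eq_one_iff {g : GL (Fin n) F} : iwahoriOrbit g = iwahoriOrbit 1 ↔
    ∃ u ∈ unipotent F n, ∃ k ∈ iwahoriGL F n, g = u * k := by
  constructor
  · intro h
    obtain ⟨u, hu⟩ := mk_mem_iwahoriOrbit_iff.1 (h ▸ mem_iwahoriOrbit_self g)
    refine ⟨(u : GL (Fin n) F)⁻¹, inv_mem u.2, _, hu, ?_⟩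
    group
  · rintro ⟨u, hu, k, hk, rfl⟩
    simpa using iwahoriOrbit_unipotent_mul_iwahori (g := 1) hu hk

theorem iwahoriOrbit_disjoint {g h : GL (Fin n) F} (hgh : iwahoriOrbit g ≠ iwahoriOrbit h) :
    Disjoint (iwahoriOrbit g) (iwahoriOrbit h) := by
  rw [Set.disjoint_left]
  intro x hg hh
  induction x using Quotient.inductionOn with
  | h x => exact hgh ((iwahoriOrbit_eq_of_mem hg).symm.trans (iwahoriOrbit_eq_of_mem hh))

/-- Each coset `x I_n` is open and so meets a dense sequence. This makes it unnecessary to know that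
the cells exhaust the quotient. -/
theorem exists_countable_iwahoriOrbit : ∃ d : ℕ → GL (Fin n) F, ⋃ i, iwahoriOrbit (d i) = Set.univ := by
  have := secondCountable_GL F n
  refine ⟨TopologicalSpace.denseSeq _, Set.eq_univ_of_forall fun x => ?_⟩
  induction x using Quotient.inductionOn with
  | h x =>
    obtain ⟨i, hi⟩ := (TopologicalSpace.denseRange_denseSeq (GL (Fin n) F)).exists_mem_open
      (isOpen_iwahoriCoset x) ⟨x, by simp [iwahoriCoset]⟩
    refine Set.mem_iUnion.2 ⟨i, mk_mem_iwahoriOrbit_iff.2 ⟨1, ?_⟩⟩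
    have := (iwahoriGL F n).inv_mem hi
    simpa [iwahoriCoset] using this

variable [MeasurableSpace (GL (Fin n) F)] [BorelSpace (GL (Fin n) F)]

theorem measurableSet_iwahoriOrbit (g : GL (Fin n) F) : MeasurableSet (iwahoriOrbit g) := by
  refine measurableSet_quotient.2 ?_
  refine IsOpen.measurableSet ?_
  have : (Quotient.mk (QuotientGroup.rightRel (unipotent F n)) ⁻¹' iwahoriOrbit g) =
      ⋃ u : unipotent F n, {h | (u : GL (Fin n) F) * h ∈ iwahoriCoset g} := by
    ext h
    rw [Set.mem_iUnion]
    exact mk_mem_iwahoriOrbit_iff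
  change IsOpen (Quotient.mk (QuotientGroup.rightRel (unipotent F n)) ⁻¹' iwahoriOrbit g)
  exact this ▸ isOpen_iUnion fun u => (isOpen_iwahoriCoset g).preimage (continuous_const_mul _)

/-- Apply the defining property of `ρ` to the indicator of `g I_n`, cut down to the preimage of a
set. For `h` in `U g I_n`, the set of `u` with `u h` in `g I_n` is a right translate of the
stabilizer, so the inner integral is constant on the orbit. -/
theorem map_restrict_iwahoriCoset (μ : Measure (GL (Fin n) F)) (ν : Measure (unipotent F n))
    [ν.IsHaarMeasure] {ρ : Measure (Quotient (QuotientGroup.rightRel (unipotent F n)))}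
    (hρ : IsQuotientMeasure (unipotent F n) μ ν ρ) (g : GL (Fin n) F) :
    (μ.restrict (iwahoriCoset g)).map (Quotient.mk _) =
      ν (unipotentStabilizer g) • ρ.restrict (iwahoriOrbit g) := by
  have hri := isMulRightInvariant_unipotent ν
  have hπ : Measurable (Quotient.mk (QuotientGroup.rightRel (unipotent F n))) :=
    measurable_quotient_mk''
  have hco := (isOpen_iwahoriCoset g).measurableSet
  have hor := measurableSet_iwahoriOrbit g
  ext E hE
  rw [Measure.map_apply hπ hE, Measure.restrict_apply (hπ hE), Measure.smul_apply,
    Measure.restrict_apply hE, smul_eq_mul]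
  have key := hρ ((Quotient.mk _ ⁻¹' E ∩ iwahoriCoset g).indicator 1)
    (fun x => ν (unipotentStabilizer g) * (E ∩ iwahoriOrbit g).indicator 1 x)
    (measurable_one.indicator ((hπ hE).inter hco)) fun h => ?_
  · rw [lintegral_indicator_one ((hπ hE).inter hco), lintegral_const_mul _
      (measurable_one.indicator (hE.inter hor)), lintegral_indicator_one (hE.inter hor)] at key
    exact key
  have hmk : ∀ u : unipotent F n, Quotient.mk (QuotientGroup.rightRel (unipotent F n))
      ((u : GL (Fin n) F) * h) = Quotient.mk _ h := by
    intro u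
    rw [mk_eq_mk_iff]
    convert inv_mem u.2 using 1
    group
  by_cases hh : Quotient.mk _ h ∈ E ∩ iwahoriOrbit g
  · obtain ⟨u₀, hu₀⟩ := mk_mem_iwahoriOrbit_iff.1 hh.2
    rw [Set.indicator_of_mem hh, Pi.one_apply, mul_one,
      -- Here right invariance of `ν` enters: the fibre is the stabilizer times `u₀`.
      ← measure_preimage_mul_right ν u₀⁻¹ (unipotentStabilizer g : Set (unipotent F n)),
      ← lintegral_indicator_one (((isOpen_unipotentStabilizer g).preimage
        (continuous_mul_const u₀⁻¹)).measurableSet)]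
    refine lintegral_congr fun u => ?_
    have : (u : GL (Fin n) F) * h ∈ Quotient.mk _ ⁻¹' E ∩ iwahoriCoset g ↔
        u ∈ (fun x => x * u₀⁻¹) ⁻¹' (unipotentStabilizer g : Set (unipotent F n)) := by
      rw [Set.mem_inter_iff, Set.mem_preimage, hmk, and_iff_right hh.1, Set.mem_preimage,
        SetLike.mem_coe, mem_unipotentStabilizer]
      change g⁻¹ * (u * h) ∈ iwahoriGL F n ↔ _
      rw [← Subgroup.mul_mem_cancel_right (y := g⁻¹ * (u * h)) _ ((iwahoriGL F n).inv_mem hu₀)]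
      have : g⁻¹ * ((u : GL (Fin n) F) * h) * (g⁻¹ * ((u₀ : GL (Fin n) F) * h))⁻¹ =
          g⁻¹ * ((u * u₀⁻¹ : unipotent F n) : GL (Fin n) F) * g := by
        push_cast
        group
      rw [this]
    simp only [Set.indicator, this]
    rfl
  · rw [Set.indicator_of_notMem hh, mul_zero]
    symm
    refine (lintegral_congr fun u => ?_).trans lintegral_zero
    refine Set.indicator_of_notMem (fun hu => hh ?_) _
    have h1 := hu.1
    rw [Set.mem_preimage, hmk] at h1
    exact ⟨h1, mk_mem_iwahoriOrbit_iff.2 ⟨u, hu.2⟩⟩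

end Orbit

/-! ### The zeta integral over one orbit. -/

section ZetaIntegral

variable {F : Type*} [Field F] [ValuativeRel F] [TopologicalSpace F] [IsNonarchimedeanLocalField F]
variable {n m : ℕ}

theorem normAbs_eq_one {x : F} (hx : valuation F x = 1) : normAbs x = 1 := by
  rw [normAbs, hx, map_one, map_one, NNReal.coe_one]

theorem normAbs_mul (x y : F) : normAbs (x * y) = normAbs x * normAbs y := by
  rw [normAbs, map_mul, map_mul, map_mul, NNReal.coe_mul, normAbs, normAbs]

theorem normAbs_det_iwahori {k : GL (Fin n) F} (hk : k ∈ iwahoriGL F n) :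
    normAbs (Matrix.GeneralLinearGroup.det k : F) = 1 := by
  obtain ⟨k, -, rfl⟩ := hk
  refine normAbs_eq_one ?_
  have := (isUnit_iff_valuation_eq_one _).1 (isUnit_det_coe k)
  rwa [Matrix.GeneralLinearGroup.map_det]

/-- The factor of the integrand that is constant on the cosets of the Iwahori subgroup. -/
def iwahoriFactor (m : ℕ) (v : GL (Fin n) F → ℂ) (s : ℂ) (g : GL (Fin n) F) : ℂ :=
  v g * (normAbs (Matrix.GeneralLinearGroup.det g : F) : ℂ) ^ (s - ((m : ℂ) - n) / 2)

theorem zetaIntegrand_eq (h : n ≤ m) (ψ : AddChar F ℂ) (w : GL (Fin m) F → ℂ)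
    (v : GL (Fin n) F → ℂ) (χ : Fˣ →* ℂˣ) (f : Fˣ) (s : ℂ) (g : GL (Fin n) F) :
    zetaIntegrand h ψ w v χ f s g = birchFun h ψ w χ f g * iwahoriFactor m v s g := by
  unfold zetaIntegrand birchFun whittakerFactor iwahoriFactor
  ring

theorem iwahoriFactor_mul {v : GL (Fin n) F → ℂ} (hvI : IsIwahoriInvariant v) (s : ℂ)
    (g k : GL (Fin n) F) (hk : k ∈ iwahoriGL F n) :
    iwahoriFactor m v s (g * k) = iwahoriFactor m v s g := by
  rw [iwahoriFactor, hvI g k (mem_iwahori_iff_mem.2 hk), map_mul, Units.val_mul, normAbs_mul,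
    normAbs_det_iwahori hk, mul_one, iwahoriFactor]

theorem continuous_zetaIntegrand (h : n ≤ m) {ψ : AddChar F ℂ} (hψc : Continuous ψ)
    {w : GL (Fin m) F → ℂ} (hwI : IsIwahoriInvariant w) {v : GL (Fin n) F → ℂ}
    (hvI : IsIwahoriInvariant v) {χ : Fˣ →* ℂˣ} (hχc : Continuous χ) (f : Fˣ) (s : ℂ) :
    Continuous (zetaIntegrand h ψ w v χ f s) := by
  rw [funext (zetaIntegrand_eq h ψ w v χ f s)]
  exact (continuous_birchFun h f hψc hwI hχc).mul
    (continuous_of_iwahori_invariant (iwahoriFactor_mul hvI s))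

variable [MeasurableSpace (GL (Fin n) F)] [BorelSpace (GL (Fin n) F)]

/-- Translate `g I_n` to `I_n`, pull out the factor constant on the coset, and pass to additive
measure. -/
theorem volGL_mul_setIntegral_iwahoriCoset [MeasurableSpace 𝒪[F]] [BorelSpace 𝒪[F]]
    (η : Measure 𝒪[F]) [η.IsAddHaarMeasure] [IsProbabilityMeasure η]
    (μ : Measure (GL (Fin n) F)) [μ.IsHaarMeasure] (hμ : μ (intGL F n : Set (GL (Fin n) F)) = 1)
    (h : n ≤ m) {ψ : AddChar F ℂ} (hψc : Continuous ψ)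
    {w : GL (Fin m) F → ℂ} (hwI : IsIwahoriInvariant w) {v : GL (Fin n) F → ℂ}
    (hvI : IsIwahoriInvariant v) {χ : Fˣ →* ℂˣ} (hχc : Continuous χ) (f : Fˣ) (s : ℂ)
    (g : GL (Fin n) F) :
    ((volGL η n).toReal : ℂ) * ∫ x in iwahoriCoset g, zetaIntegrand h ψ w v χ f s x ∂μ =
      iwahoriIntegral η (fun k => birchFun h ψ w χ f (g * k)) * iwahoriFactor m v s g := by
  have hpre := (measurePreserving_mul_left μ g).setIntegral_preimage_emb
    (MeasurableEquiv.mulLeft g).measurableEmbedding (zetaIntegrand h ψ w v χ f s) (iwahoriCoset g)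
  have hset : (fun x => g * x) ⁻¹' iwahoriCoset g = iwahoriGL F n := by
    ext x
    simp [iwahoriCoset]
  rw [hset] at hpre
  rw [← hpre, volGL_mul_setIntegral_iwahori η μ hμ
    (φ := fun x => zetaIntegrand h ψ w v χ f s (g * x))
    ((continuous_zetaIntegrand h hψc hwI hvI hχc f s).comp (continuous_const_mul g)),
    iwahoriIntegral, iwahoriIntegral, ← integral_mul_const]
  refine integral_congr_ae (Filter.Eventually.of_forall fun k => ?_)
  simp only []
  split_ifs with hk
  · rw [zetaIntegrand_eq, iwahoriFactor_mul hvI s g _ hk.toGL_mem]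
  · rw [zero_mul]

theorem measurable_zetaQuotient (h : n ≤ m) {ψ : AddChar F ℂ} (hψc : Continuous ψ)
    {w : GL (Fin m) F → ℂ} (hw : IsWhittaker ψ w) (hwI : IsIwahoriInvariant w)
    {v : GL (Fin n) F → ℂ} (hv : IsWhittaker ψ⁻¹ v) (hvI : IsIwahoriInvariant v)
    {χ : Fˣ →* ℂˣ} (hχc : Continuous χ) (f : Fˣ) (s : ℂ) :
    Measurable (zetaQuotient h hw hv χ f s) := by
  refine measurable_from_quotient.2 ?_
  exact (continuous_zetaIntegrand h hψc hwI hvI hχc f s).measurable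

/-- Up to a positive finite factor, this is integrability of a continuous function on the compact
coset `g I_n`. -/
theorem integrableOn_iwahoriOrbit (μ : Measure (GL (Fin n) F)) [μ.IsHaarMeasure]
    (ν : Measure (unipotent F n)) [ν.IsHaarMeasure]
    {ρ : Measure (Quotient (QuotientGroup.rightRel (unipotent F n)))}
    (hρ : IsQuotientMeasure (unipotent F n) μ ν ρ) (h : n ≤ m) {ψ : AddChar F ℂ}
    (hψc : Continuous ψ)
    {w : GL (Fin m) F → ℂ} (hw : IsWhittaker ψ w) (hwI : IsIwahoriInvariant w)
    {v : GL (Fin n) F → ℂ} (hv : IsWhittaker ψ⁻¹ v) (hvI : IsIwahoriInvariant v)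
    {χ : Fˣ →* ℂˣ} (hχc : Continuous χ) (f : Fˣ) (s : ℂ) (g : GL (Fin n) F) :
    IntegrableOn (zetaQuotient h hw hv χ f s) (iwahoriOrbit g) ρ := by
  have := t2Space_GL F n
  have hmeas := measurable_zetaQuotient h hψc hw hwI hv hvI hχc f s
  rw [IntegrableOn, ← integrable_smul_measure (measure_unipotentStabilizer_ne_zero ν g)
    (measure_unipotentStabilizer_ne_top ν g), ← map_restrict_iwahoriCoset μ ν hρ g,
    integrable_map_measure hmeas.aestronglyMeasurable measurable_quotient_mk''.aemeasurable]
  exact (continuous_zetaIntegrand h hψc hwI hvI hχc f s).continuousOn.integrableOn_compact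
    (isCompact_iwahoriCoset g)

theorem setIntegral_iwahoriOrbit (μ : Measure (GL (Fin n) F)) [μ.IsHaarMeasure]
    (ν : Measure (unipotent F n)) [ν.IsHaarMeasure]
    {ρ : Measure (Quotient (QuotientGroup.rightRel (unipotent F n)))}
    (hρ : IsQuotientMeasure (unipotent F n) μ ν ρ) (h : n ≤ m) {ψ : AddChar F ℂ}
    (hψc : Continuous ψ)
    {w : GL (Fin m) F → ℂ} (hw : IsWhittaker ψ w) (hwI : IsIwahoriInvariant w)
    {v : GL (Fin n) F → ℂ} (hv : IsWhittaker ψ⁻¹ v) (hvI : IsIwahoriInvariant v)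
    {χ : Fˣ →* ℂˣ} (hχc : Continuous χ) (f : Fˣ) (s : ℂ) (g : GL (Fin n) F) :
    ((ν (unipotentStabilizer g)).toReal : ℂ) *
      ∫ x in iwahoriOrbit g, zetaQuotient h hw hv χ f s x ∂ρ =
        ∫ x in iwahoriCoset g, zetaIntegrand h ψ w v χ f s x ∂μ := by
  have hmeas := measurable_zetaQuotient h hψc hw hwI hv hvI hχc f s
  rw [← Complex.real_smul, ← integral_smul_measure, ← map_restrict_iwahoriCoset μ ν hρ g,
    integral_map measurable_quotient_mk''.aemeasurable hmeas.aestronglyMeasurable]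
  rfl

/-- Both volumes linking the orbit integral to `iwahoriIntegral` are nonzero, so vanishing
transfers, and at `g = 1` the value is divided by the volume of `GL_n(𝒪)`. -/
theorem setIntegral_iwahoriOrbit_eq_ite (μ : Measure (GL (Fin n) F)) [μ.IsHaarMeasure]
    (hμ : μ (intGL F n : Set (GL (Fin n) F)) = 1) (ν : Measure (unipotent F n)) [ν.IsHaarMeasure]
    (hν : ν {u : unipotent F n | (u : GL (Fin n) F) ∈ intGL F n} = 1)
    {ρ : Measure (Quotient (QuotientGroup.rightRel (unipotent F n)))}
    (hρ : IsQuotientMeasure (unipotent F n) μ ν ρ) (h : n ≤ m) {ψ : AddChar F ℂ}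
    (hψc : Continuous ψ) (hψ : HasConductorIntegers ψ)
    {w : GL (Fin m) F → ℂ} (hw : IsWhittaker ψ w) (hwI : IsIwahoriInvariant w)
    {v : GL (Fin n) F → ℂ} (hv : IsWhittaker ψ⁻¹ v) (hvI : IsIwahoriInvariant v)
    {χ : Fˣ →* ℂˣ} (hχc : Continuous χ) {f : 𝒪[F]} (hf0 : f ≠ 0) (hf : ¬ IsUnit f)
    (hχ : HasConductor χ (Ideal.span {f})) (s : ℂ) (g : GL (Fin n) F) :
    ∫ x in iwahoriOrbit g, zetaQuotient h hw hv χ (toUnit f hf0) s x ∂ρ =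
      if iwahoriOrbit g = iwahoriOrbit 1 then
        ((∏ k ∈ Finset.Icc 1 n, (1 - ((normP F : ℂ) ^ k)⁻¹)⁻¹) *
          ((normIdeal f : ℂ) ^ (∑ k ∈ Finset.Icc 1 n, k * (n + 1 - k)))⁻¹ *
          localGaussSum ψ χ f ^ (n * (n + 1) / 2) * w 1 * v 1) else 0 := by
  let : MeasurableSpace 𝒪[F] := borel _
  have : BorelSpace 𝒪[F] := ⟨rfl⟩
  let η : Measure 𝒪[F] := Measure.addHaarMeasure ⊤
  have : IsProbabilityMeasure η := ⟨Measure.addHaarMeasure_self (K₀ := ⊤)⟩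
  have hV : ((volGL η n).toReal : ℂ) ≠ 0 := by
    have hpos : volGL η n ≠ 0 := ((isClopen_isUnit_det n).isOpen.measure_pos (haarMat η n)
      ⟨Matrix.of.symm 1, by simp⟩).ne'
    exact_mod_cast (ENNReal.toReal_pos hpos (measure_ne_top _ _)).ne'
  have hval : ∀ g : GL (Fin n) F, ((volGL η n).toReal : ℂ) *
      (((ν (unipotentStabilizer g)).toReal : ℂ) *
        ∫ x in iwahoriOrbit g, zetaQuotient h hw hv χ (toUnit f hf0) s x ∂ρ) =
      iwahoriIntegral η (fun k => birchFun h ψ w χ (toUnit f hf0) (g * k)) *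
        iwahoriFactor m v s g := fun g => by
    rw [setIntegral_iwahoriOrbit μ ν hρ h hψc hw hwI hv hvI hχc,
      volGL_mul_setIntegral_iwahoriCoset η μ hμ h hψc hwI hvI hχc]
  split_ifs with hg
  · have h1 := hval 1
    simp only [one_mul] at h1
    rw [iwahoriIntegral_birchFun η hψc hψ hw hwI hχc hf0 hf hχ, unipotentStabilizer_one, hν,
      ENNReal.toReal_one, Complex.ofReal_one, one_mul] at h1
    have hone : iwahoriFactor m v s (1 : GL (Fin n) F) = v 1 := by
      rw [iwahoriFactor, normAbs_det_iwahori (one_mem _), Complex.ofReal_one, Complex.one_cpow,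
        mul_one]
    rw [hg, Finset.prod_inv_distrib, ← volGL_eq η n]
    refine mul_left_cancel₀ hV ?_
    rw [h1, hone, mul_assoc _ (w 1), mul_assoc _ (w 1)]
    simp only [← mul_assoc]
    rw [mul_inv_cancel₀ hV, one_mul]
  · have hzero : iwahoriIntegral η (fun k => birchFun h ψ w χ (toUnit f hf0) (g * k)) = 0 := by
      by_contra hne
      exact hg (iwahoriOrbit_eq_one_iff.2
        (exists_mul_iwahori_of_iwahoriIntegral_ne_zero η hψc hψ hw hwI hχc hf0 hf hχ h g hne))
    have h1 := hval g
    rw [hzero, zero_mul, mul_eq_zero_iff_left hV, mul_eq_zero_iff_left] at h1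
    · exact h1
    · exact_mod_cast (ENNReal.toReal_pos (measure_unipotentStabilizer_ne_zero ν g)
        (measure_unipotentStabilizer_ne_top ν g)).ne'

end ZetaIntegral

end LocalBirch
end

open LocalBirch MeasureTheory ValuativeRel
theorem theorem2p1 {F : Type*} [Field F] [ValuativeRel F] [TopologicalSpace F]
    [IsNonarchimedeanLocalField F] {m n : ℕ} (hnm : n ≤ m)
    [MeasurableSpace (GL (Fin n) F)] [BorelSpace (GL (Fin n) F)]
    (μ : Measure (GL (Fin n) F)) [μ.IsHaarMeasure] (hμ : μ (intGL F n : Set (GL (Fin n) F)) = 1)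
    (ν : Measure (unipotent F n)) [ν.IsHaarMeasure]
    (hν : ν {u : unipotent F n | (u : GL (Fin n) F) ∈ intGL F n} = 1)
    (ψ : AddChar F ℂ) (hψc : Continuous ψ) (hψ : HasConductorIntegers ψ)
    (w : GL (Fin m) F → ℂ) (hw : IsWhittaker ψ w) (hwI : IsIwahoriInvariant w)
    (v : GL (Fin n) F → ℂ) (hv : IsWhittaker ψ⁻¹ v) (hvI : IsIwahoriInvariant v)
    (χ : Fˣ →* ℂˣ) (hχc : Continuous χ)
    (f : 𝒪[F]) (hf0 : f ≠ 0) (hf : ¬ IsUnit f) (hχf : HasConductor χ (Ideal.span {f}))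
    (ϖ : 𝒪[F]) (hϖ : Irreducible ϖ) (s : ℂ) :
    HasIntegralAlong (cell (toUnit ϖ hϖ.ne_zero)) (zetaQuotient hnm hw hv χ (toUnit f hf0) s)
      (quotientMeasure μ ν)
      ((∏ k ∈ Finset.Icc 1 n, (1 - ((normP F : ℂ) ^ k)⁻¹)⁻¹) *
        ((normIdeal f : ℂ) ^ (∑ k ∈ Finset.Icc 1 n, k * (n + 1 - k)))⁻¹ *
        localGaussSum ψ χ f ^ (n * (n + 1) / 2) * w 1 * v 1) := by
  have hρ := quotientMeasure_spec μ ν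
  have hint := setIntegral_iwahoriOrbit_eq_ite μ hμ ν hν hρ hnm hψc hψ hw hwI hv hvI hχc hf0 hf
    hχf s
  have hcell : ∀ p : (Fin n → ℤ) × Equiv.Perm (Fin n), cell (toUnit ϖ hϖ.ne_zero) p =
      iwahoriOrbit (diagGL (fun i => toUnit ϖ hϖ.ne_zero ^ p.1 i) * permGL F p.2) := fun p => rfl
  refine ⟨fun p => ?_, ?_, fun hZ => ?_⟩
  · rw [hcell]
    exact integrableOn_iwahoriOrbit μ ν hρ hnm hψc hw hwI hv hvI hχc _ s _
  · have hone : diagGL (fun i => toUnit ϖ hϖ.ne_zero ^ (0 : Fin n → ℤ) i) * permGL F 1 =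
        (1 : GL (Fin n) F) := by
      ext i j
      rw [mul_permGL_apply, diagGL_apply]
      rw [show (1 : Equiv.Perm (Fin n)).symm j = j from rfl]
      simp [Matrix.one_apply]
    -- Only the cell with `e = 0` and trivial permutation contributes, so the sum is unconditional
    -- with at most one nonzero term.
    have hsum := hasSum_single (f := fun p => ∫ x in cell (toUnit ϖ hϖ.ne_zero) p,
      zetaQuotient hnm hw hv χ (toUnit f hf0) s x ∂(quotientMeasure μ ν)) (0, 1) fun p hp => ?_
    · rw [hcell, hone, hint, if_pos rfl] at hsum
      exact hsum
    · rw [hcell, hint, if_neg]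
      intro hor
      obtain ⟨u, hu, k, hk, huk⟩ := iwahoriOrbit_eq_one_iff.1 hor
      obtain ⟨h1, h2⟩ := eq_zero_and_eq_one_of_mem_unipotent_mul_iwahori hϖ hu hk huk
      exact hp (Prod.ext h1 h2)
  · obtain ⟨d, hd⟩ := exists_countable_iwahoriOrbit (F := F) (n := n)
    -- Indexing by the set of orbits instead of by the sequence removes repetitions, so the family
    -- is pairwise disjoint and countable additivity applies.
    let T : Set (Set (Quotient (QuotientGroup.rightRel (unipotent F n)))) :=
      Set.range fun i => iwahoriOrbit (d i)
    have hT : Countable T := (Set.countable_range _).to_subtype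
    have hTU : ⋃ C : T, (C : Set (Quotient (QuotientGroup.rightRel (unipotent F n)))) =
        Set.univ := by
      rw [← hd, ← Set.sUnion_eq_iUnion, Set.sUnion_range]
    have hsum := hasSum_integral_iUnion (μ := quotientMeasure μ ν)
      (f := zetaQuotient hnm hw hv χ (toUnit f hf0) s)
      (s := fun C : T => (C : Set (Quotient (QuotientGroup.rightRel (unipotent F n))))) ?_ ?_
      hZ.integrableOn
    · rw [hTU, setIntegral_univ] at hsum
      obtain ⟨i, hi⟩ : ∃ i, iwahoriOrbit (d i) = iwahoriOrbit 1 := by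
        have := hd.symm ▸ Set.mem_univ (Quotient.mk _ (1 : GL (Fin n) F))
        obtain ⟨i, hi⟩ := Set.mem_iUnion.1 this
        exact ⟨i, (iwahoriOrbit_eq_of_mem hi).symm⟩
      have hsingle := hasSum_single (f := fun C : T =>
        ∫ x in (C : Set (Quotient (QuotientGroup.rightRel (unipotent F n)))),
          zetaQuotient hnm hw hv χ (toUnit f hf0) s x ∂(quotientMeasure μ ν))
        ⟨iwahoriOrbit (d i), i, rfl⟩ ?_
      · rw [hsum.unique hsingle, hint, if_pos hi]
      · rintro ⟨_, j, rfl⟩ hj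
        change ∫ x in iwahoriOrbit (d j), _ ∂_ = 0
        rw [hint, if_neg]
        exact fun h => hj (Subtype.ext (h.trans hi.symm))
    · rintro ⟨_, j, rfl⟩
      exact measurableSet_iwahoriOrbit _
    · rintro ⟨_, i, rfl⟩ ⟨_, j, rfl⟩ hij
      exact iwahoriOrbit_disjoint fun h => hij (Subtype.ext h)
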